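/- Let $d,n,\ell$ be positive integers and let $F$ be either $\mathbb R$ or a locally compact field with a nontrivial ultrametric absolute value $|\cdot|$. Give $F^d$ the norm $\|x\|=\max_i|x_i|$ and let $\lambda$ be Lebesgue measure on $F^d$ if $F=\mathbb R$, a Haar measure otherwise. Let $U\subset F^d$ be open and let $f=(f_1,\dots,f_n):U\to F^n$ be a $C^\ell$ map. Definitions. If $F$ is ultrametric, a function $g$ is $C^k$ on an open box $V_1\times\dots\times V_d\subset F^d$ if for every multiindex $\beta=(i_1,\dots,i_d)$ with $|\beta|=i_1+\dots+i_d\le k$ the difference quotient $\Phi_\beta g=\Phi_1^{i_1}\circ\dots\circ\Phi_d^{i_d}g$ extends to a continuous function on $V_1^{i_1+1}\times\dots\times V_d^{i_d+1}$; here $\Phi_j^{i}$ denotes the $i$-th order difference quotient in the $j$-th variable, where in one variable $\Phi^0g=g$ and $$\Phi^ig(x_1,\dots,x_{i+1})=\frac{\Phi^{i-1}g(x_1,x_3,\dots,x_{i+1})-\Phi^{i-1}g(x_2,x_3,\dots,x_{i+1})}{x_1-x_2}$$ for pairwise distinct $x_1,\dots,x_{i+1}$. A map to $F^n$ is $C^k$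 on an open set if every point of the set has an open box neighbourhood in the set on which all components are $C^k$. If $F=\mathbb R$, $C^k$ has its usual meaning. The map $f$ is *$k$-nondegenerate* at $x_0\in U$ if it is $C^k$ on a neighbourhood of $x_0$ and the partial derivatives $\partial_\beta f(x_0)$ with $1\le|\beta|\le k$ span $F^n$; it is *nondegenerate* at $x_0$ if it is $k$-nondegenerate there for some $k$. It is *nonplanar* at $x_0$ if for every neighbourhood $B\subset U$ of $x_0$ the restrictions of $1,f_1,\dots,f_n$ to $B$ are linearly independent over $F$. For $C,\alpha>0$, a function $h$ is *$(C,\alpha)$-good* on $V\subset F^d$ if for every open ball $B\subset V$ and every $\varepsilon>0$ $$\lambda(\{x\in B:|h(x)|<\varepsilon\})\le C\Big(\frac{\varepsilon}{\sup_{B}|h|}\Big)^{\alpha}\lambda(B)$$ (the right-hand side being $\infty$ if $h=0$ on $B$). The map $f$ is *good* at $x_0$ if there are a neighbourhood $V\subset U$ of $x_0$ and $C,\alpha>0$ such that every linear combination of $1,f_1,\dots,f_n$ over $F$ is $(C,\alpha)$-good on $V$. Theorem. (1) $f$ is nonplanar and good at every point of $U$ at which it is nondegenerate. (2) Suppose that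 $F$ is ultrametric and that its absolute value is normalized, that is, the diameter of $\{x\in F:|x|<1\}$ is $1/q$, where $q$ is the number of elements of the residue class field of $F$. If $f$ is $\ell$-nondegenerate at $x_0\in U$, then there is a neighbourhood $V\subset U$ of $x_0$ such that every linear combination of $1,f_1,\dots,f_n$ over $F$ is $\big(d\,\ell^{\,3-1/\ell},\,1/(d\ell)\big)$-good on $V$. -/

import Mathlib

open Filter Topology MeasureTheory
open scoped ENNReal Valued

universe u

namespace KT

section Good

variable {X F : Type*} [PseudoMetricSpace X] [MeasurableSpace X] [NormedField F]

/-- `f` is `(C, α)`-good on `V` with respect to `μ`: for every open ball `B ⊆ V` centred in the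
support of `μ` and every `ε > 0`,
`μ {y ∈ B | |f y| < ε} ≤ C (ε / ‖f‖_{μ,B}) ^ α μ(B)`, where `‖f‖_{μ,B} = sup_{B ∩ supp μ} |f|`.
The right-hand side is computed in `[0, ∞]`, so it is `∞` when `‖f‖_{μ,B} = 0` (note that
`μ B > 0`) and `0` when `‖f‖_{μ,B} = ∞`. -/
def IsGoodOn (μ : Measure X) (C α : ℝ) (f : X → F) (V : Set X) : Prop :=
  ∀ x ∈ μ.support, ∀ r : ℝ, 0 < r → Metric.ball x r ⊆ V → ∀ ε : ℝ, 0 < ε →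
    μ {y ∈ Metric.ball x r | ‖f y‖ < ε} ≤
      ENNReal.ofReal C *
        (ENNReal.ofReal ε / ⨆ y ∈ Metric.ball x r ∩ μ.support, ‖f y‖ₑ) ^ α *
        μ (Metric.ball x r)

/-- Every linear combination `c₀ + c₁ f₁ + ⋯ + cₙ fₙ` of `1, f₁, …, fₙ` is `(C, α)`-good
on `V`. -/
def CombinationsGoodOn {n : ℕ} (μ : Measure X) (C α : ℝ) (f : X → Fin n → F) (V : Set X) : Prop :=
  ∀ (c₀ : F) (c : Fin n → F), IsGoodOn μ C α (fun x => c₀ + ∑ i, c i * f x i) V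

/-- The map `f`, defined on the open set `U`, is `μ`-good at `x₀ ∈ U`. -/
def IsGoodAt {n : ℕ} (μ : Measure X) (U : Set X) (f : X → Fin n → F) (x₀ : X) : Prop :=
  ∃ V ∈ 𝓝 x₀, V ⊆ U ∧ ∃ C α : ℝ, 0 < C ∧ 0 < α ∧ CombinationsGoodOn μ C α f V

/-- The map `f`, defined on the open set `U`, is `μ`-nonplanar at `x₀ ∈ U`: for every
neighbourhood `B ⊆ U` of `x₀` the restrictions of `1, f₁, …, fₙ` to `B ∩ supp μ` are linearly
independent over `F`. -/
def IsNonplanarAt {n : ℕ} (μ : Measure X) (U : Set X) (f : X → Fin n → F) (x₀ : X) : Prop :=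
  ∀ B ∈ 𝓝 x₀, B ⊆ U →
    LinearIndependent F
      (Fin.cons (fun _ => 1) (fun i x => f x i) :
        Fin (n + 1) → (↥(B ∩ μ.support) → F))

end Good

section Derivatives

variable {F E : Type*} [NontriviallyNormedField F] [NormedAddCommGroup E] [NormedSpace F E] {d : ℕ}

/-- The partial derivative `∂ᵢ f`. -/
noncomputable def partialDeriv (i : Fin d) (f : (Fin d → F) → E) : (Fin d → F) → E :=
  fun x => deriv (fun t => f (Function.update x i t)) (x i)

/-- The partial derivative `∂_β f = ∂₁^{β₁} ∘ ⋯ ∘ ∂_d^{β_d} f`. -/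
noncomputable def multiPartialDeriv (β : Fin d → ℕ) (f : (Fin d → F) → E) : (Fin d → F) → E :=
  (List.finRange d).foldr (fun i g => (partialDeriv i)^[β i] g) f

/-- `E` is spanned by the partial derivatives `∂_β f (x₀)` with `1 ≤ |β| ≤ k`. -/
def SpannedByPartials (k : ℕ) (f : (Fin d → F) → E) (x₀ : Fin d → F) : Prop :=
  Submodule.span F
    {v : E | ∃ β : Fin d → ℕ, 1 ≤ ∑ j, β j ∧ ∑ j, β j ≤ k ∧ v = multiPartialDeriv β f x₀} = ⊤

end Derivatives

section DifferenceQuotients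

variable {F : Type*} [Field F]

/-- The `k`-th order difference quotient of a function of one variable:
`Φ⁰f = f` and
`Φᵏf(x₁, …, x_{k+1}) = (Φᵏ⁻¹f(x₁, x₃, …, x_{k+1}) - Φᵏ⁻¹f(x₂, x₃, …, x_{k+1})) / (x₁ - x₂)`.
It is only used at pairwise distinct points. -/
def diffQuot : (k : ℕ) → (F → F) → (Fin (k + 1) → F) → F
  | 0, f, x => f (x 0)
  | k + 1, f, x =>
      (diffQuot k f (fun i => x (Fin.succAbove 1 i)) -
        diffQuot k f (fun i => x (Fin.succAbove 0 i))) / (x 0 - x 1)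

/-- The difference quotient `Φ_β f = Φ₁^{β₁} ∘ ⋯ ∘ Φ_d^{β_d} f` of order `β` of a function of `d`
variables; here `Φⱼᵏ` is the `k`-th order difference quotient in the `j`-th variable, and `x j` is
the tuple of `β j + 1` points that replace the `j`-th variable. -/
def multiDiffQuot : {d : ℕ} → (β : Fin d → ℕ) → ((Fin d → F) → F) →
    ((j : Fin d) → Fin (β j + 1) → F) → F
  | 0, _, f, _ => f Fin.elim0
  | _ + 1, β, f, x =>
      diffQuot (β 0)
        (fun t => multiDiffQuot (fun j => β j.succ) (fun y => f (Fin.cons t y)) (fun j => x j.succ))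
        (x 0)

end DifferenceQuotients

section Ultrametric

variable {F : Type*} [NontriviallyNormedField F] {d n : ℕ}

/-- `f ∈ Cᵏ(V₁ × ⋯ × V_d)`: for every `β` with `|β| ≤ k` the difference quotient `Φ_β f`, which
lives on the tuples with pairwise distinct entries in each variable, extends to a continuous
function on `V₁^{β₁+1} × ⋯ × V_d^{β_d+1}`. -/
def UltraCkOnBox (k : ℕ) (f : (Fin d → F) → F) (V : Fin d → Set F) : Prop :=
  ∀ β : Fin d → ℕ, ∑ j, β j ≤ k →
    ∃ g : ((j : Fin d) → Fin (β j + 1) → F) → F,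
      ContinuousOn g {x | ∀ j i, x j i ∈ V j} ∧
      ∀ x, (∀ j i, x j i ∈ V j) → (∀ j, Function.Injective (x j)) → g x = multiDiffQuot β f x

/-- A map `f = (f₁, …, fₙ)` is `Cᵏ` on the open set `U`, in the sense of ultrametric calculus:
every point of `U` has an open box neighbourhood in `U` on which every `fᵢ` is `Cᵏ`. -/
def UltraCkOn (k : ℕ) (f : (Fin d → F) → Fin n → F) (U : Set (Fin d → F)) : Prop :=
  ∀ x ∈ U, ∃ V : Fin d → Set F, (∀ j, IsOpen (V j)) ∧ (∀ j, x j ∈ V j) ∧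
    Set.univ.pi V ⊆ U ∧ ∀ i, UltraCkOnBox k (fun y => f y i) V

/-- `f` is `k`-nondegenerate at `x₀` (ultrametric case): it is `Cᵏ` near `x₀`, and `Fⁿ` is spanned
by the partial derivatives of `f` at `x₀` of orders `1, …, k`. -/
def UltraNondegenerateOfOrder (k : ℕ) (f : (Fin d → F) → Fin n → F) (x₀ : Fin d → F) : Prop :=
  (∃ W : Set (Fin d → F), IsOpen W ∧ x₀ ∈ W ∧ UltraCkOn k f W) ∧ SpannedByPartials k f x₀

/-- `f` is nondegenerate at `x₀` (ultrametric case). -/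
def UltraNondegenerateAt (f : (Fin d → F) → Fin n → F) (x₀ : Fin d → F) : Prop :=
  ∃ k : ℕ, UltraNondegenerateOfOrder k f x₀

/-- The absolute value of `F` is normalized: the diameter of the valuation ideal `{|x| < 1}` is
`1 / q`, where `q` is the number of elements of the residue class field. -/
def IsNormalized (F : Type*) [NontriviallyNormedField F] [IsUltrametricDist F] : Prop :=
  letI : Valued F NNReal := NormedField.toValued
  Metric.diam (Metric.ball (0 : F) 1) = 1 / (Nat.card 𝓀[F] : ℝ)

end Ultrametric

section Real

variable {d n : ℕ}

/-- `f` is `k`-nondegenerate at `x₀` (real case): it is `Cᵏ` near `x₀`, and `ℝⁿ` is spanned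
by the partial derivatives of `f` at `x₀` of orders `1, …, k`. -/
def RealNondegenerateOfOrder (k : ℕ) (f : (Fin d → ℝ) → Fin n → ℝ) (x₀ : Fin d → ℝ) : Prop :=
  (∃ W : Set (Fin d → ℝ), IsOpen W ∧ x₀ ∈ W ∧ ContDiffOn ℝ k f W) ∧ SpannedByPartials k f x₀

/-- `f` is nondegenerate at `x₀` (real case). -/
def RealNondegenerateAt (f : (Fin d → ℝ) → Fin n → ℝ) (x₀ : Fin d → ℝ) : Prop :=
  ∃ k : ℕ, RealNondegenerateOfOrder k f x₀

end Real

end KT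

/-!
The proof rests on divided differences. Written as `∑_{x ∈ T} f x / ∏_{y ∈ T, y ≠ x} (x - y)`, the
divided difference of a function of one variable is a function of a finite *set* `T` of nodes,
hence symmetric in them; in several variables it is attached to a grid `T 1 × ⋯ × T d`.

*Jets.* Besides continuity, all that is used of smoothness is `HasGridJet`: the divided
differences of order `β`, `|β| ≤ k`, of `f` converge to some `a β` when all nodes tend to `x₀`,
and `β! • a β = ∂_β f x₀`. In the ultrametric case the limit exists by definition of `Cᵏ`, and the
recursion for divided differences, extended by continuity to coinciding nodes, identifies it with
a derivative (`multiPartialDeriv_eq_diffExtension`). In the real case both facts follow from the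
mean value theorem for divided differences (`exists_gridDiff_eq_multiPartialDeriv`). Since the
partial derivatives of orders `1, …, k` span, no nontrivial combination `∑ cᵢ fᵢ` has `∑ cᵢ a β i
= 0` for all `1 ≤ |β| ≤ k` (`SpannedByPartials.isNondegenerateJet`). Nonplanarity is immediate
from this, because divided differences of positive order kill constants
(`HasGridJet.isNonplanarAt`).

*Good directions.* By an iterated Leibniz rule (`exists_divDiff_line`), the divided differences of
order `m` of `∑ cᵢ fᵢ` along short segments with direction `v` near `x₀` tend to a form of degree
`m` in `v` with the coefficients `∑ cᵢ a β i`, `|β| = m`. For some `1 ≤ m ≤ k` this form is not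
zero, so it does not vanish at suitable vectors `v 1, …, v d` arbitrarily close to the standard
basis. Hence in each of these directions the divided differences of order `m` are nearly constant
and nonzero on a fixed ball. By homogeneity and compactness of the unit sphere, the ball can be
chosen independently of `c` (`HasGridJet.exists_hasGoodDirections`), and it does not depend on the
constant term `c₀`, which disappears because `m ≥ 1`.

*One variable.* If the divided differences of order `m` of `h` are nearly constant on a ball `B`,
and the set `{|h| < ε}` has large measure in `B`, then it contains `m + 1` points at mutual
distance at least some `δ` (`exists_separated`). Newton's interpolation formula at these points
bounds `|h|` on all of `B` by a multiple of `ε` (`IsNearlyConstDivDiff.norm_lt`). This is a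
sublevel bound with exponent `1 / m`. In the ultrametric case the interpolation loses no constant,
and if the absolute value is normalized, the measure of a ball grows linearly in its radius
(`exists_measure_ball_le`), so the constant is `m`.

*Several variables.* Fubini's theorem turns sublevel bounds with constants `C`, `α` in every
single variable into one on a box with constants `d * C`, `α / d` (`SublevelBound.pi`). It is
applied in the coordinates given by `v 1, …, v d`. In the ultrametric case this linear change of
variables is an isometry (`norm_columnMap_of_ultrametric`), so that balls stay balls and the final
constants are `d * k` and `1 / (d * k)`; as `ℓ ≤ ℓ ^ (3 - 1 / ℓ)`, this is stronger than required.
In the real case balls are distorted by a bounded factor, which only affects the constant.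
-/

namespace KT

open scoped Classical

/-! ### Divided differences -/

section Nodes

variable {F : Type*}

/-- The nodes `t m, …, t (m + n)`. -/
noncomputable def nodes (t : ℕ → F) (m n : ℕ) : Finset F :=
  (Finset.range (n + 1)).image fun i => t (m + i)

theorem card_nodes {t : ℕ → F} {m n : ℕ} (ht : Set.InjOn t (Set.Iic (m + n))) :
    (nodes t m n).card = n + 1 := by
  rw [nodes, Finset.card_image_of_injOn, Finset.card_range]
  intro i hi j hj hij
  simp only [Finset.coe_range, Set.mem_Iio] at hi hj
  have := ht (show m + i ∈ Set.Iic (m + n) by simp; omega)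
    (show m + j ∈ Set.Iic (m + n) by simp; omega) hij
  omega

end Nodes

section DividedDifferences

variable {F : Type*} [Field F]

/-- The divided difference of `f` at a finite set `T` of points,
`∑_{x ∈ T} f x / ∏_{y ∈ T, y ≠ x} (x - y)`. Encoding the nodes as a finset makes the symmetry in
the nodes definitional. -/
noncomputable def divDiff (f : F → F) (T : Finset F) : F :=
  ∑ x ∈ T, f x * ∏ y ∈ T.erase x, (x - y)⁻¹

/-- The divided difference of a function of `d` variables on the grid `T 0 × ⋯ × T (d - 1)`. -/
noncomputable def gridDiff : {d : ℕ} → ((Fin d → F) → F) → (Fin d → Finset F) → F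
  | 0, f, _ => f Fin.elim0
  | _ + 1, f, T =>
      divDiff (fun t => gridDiff (fun y => f (Fin.cons t y)) (fun j => T j.succ)) (T 0)

theorem divDiff_congr {f g : F → F} {T : Finset F} (h : ∀ x ∈ T, f x = g x) :
    divDiff f T = divDiff g T :=
  Finset.sum_congr rfl fun x hx => by rw [h x hx]

theorem divDiff_singleton (f : F → F) (x : F) : divDiff f {x} = f x := by
  simp [divDiff]

theorem divDiff_add (f g : F → F) (T : Finset F) :
    divDiff (fun x => f x + g x) T = divDiff f T + divDiff g T := by
  simp [divDiff, add_mul, Finset.sum_add_distrib]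

theorem divDiff_sub (f g : F → F) (T : Finset F) :
    divDiff (fun x => f x - g x) T = divDiff f T - divDiff g T := by
  simp [divDiff, sub_mul, Finset.sum_sub_distrib]

theorem divDiff_const_mul (c : F) (f : F → F) (T : Finset F) :
    divDiff (fun x => c * f x) T = c * divDiff f T := by
  simp [divDiff, Finset.mul_sum, mul_assoc]

theorem divDiff_sum {ι : Type*} (s : Finset ι) (f : ι → F → F) (T : Finset F) :
    divDiff (fun x => ∑ i ∈ s, f i x) T = ∑ i ∈ s, divDiff (f i) T := by
  simp only [divDiff, Finset.sum_mul]
  exact Finset.sum_comm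

/-- Removing a node amounts to multiplying the function by `x - b`. -/
theorem divDiff_erase (f : F → F) {T : Finset F} {b : F} (hb : b ∈ T) :
    divDiff f (T.erase b) = divDiff (fun x => f x * (x - b)) T := by
  unfold divDiff
  rw [← Finset.add_sum_erase T _ hb]
  simp only [sub_self, mul_zero, zero_mul, zero_add]
  refine Finset.sum_congr rfl fun x hx => ?_
  have hxb : x ≠ b := Finset.ne_of_mem_erase hx
  rw [Finset.erase_right_comm,
    ← Finset.mul_prod_erase (T.erase x) _ (Finset.mem_erase.2 ⟨hxb.symm, hb⟩)]
  field_simp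

/-- The recursion satisfied by divided differences. -/
theorem divDiff_erase_sub (f : F → F) {T : Finset F} {a b : F} (ha : a ∈ T) (hb : b ∈ T) :
    divDiff f (T.erase b) - divDiff f (T.erase a) = (a - b) * divDiff f T := by
  rw [divDiff_erase f hb, divDiff_erase f ha, ← divDiff_sub, ← divDiff_const_mul]
  exact divDiff_congr fun x _ => by ring

/-- The divided difference of a constant at two or more nodes vanishes. -/
theorem divDiff_const (c : F) {T : Finset F} (hT : 2 ≤ T.card) : divDiff (fun _ => c) T = 0 := by
  induction hk : T.card using Nat.strong_induction_on generalizing T with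
  | _ k ih =>
    obtain ⟨a, ha, b, hb, hab⟩ := Finset.one_lt_card.1 hT
    have h := divDiff_erase_sub (fun _ => c) ha hb
    have h0 : divDiff (fun _ => c) (T.erase b) - divDiff (fun _ => c) (T.erase a) = 0 := by
      have hca := Finset.card_erase_of_mem ha
      have hcb := Finset.card_erase_of_mem hb
      rcases hT.eq_or_lt with h2 | h2
      · obtain ⟨a', ha'⟩ := Finset.card_eq_one.1 (show (T.erase a).card = 1 by omega)
        obtain ⟨b', hb'⟩ := Finset.card_eq_one.1 (show (T.erase b).card = 1 by omega)
        rw [ha', hb', divDiff_singleton, divDiff_singleton, sub_self]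
      · rw [ih (T.erase a).card (by omega) (by omega) rfl,
          ih (T.erase b).card (by omega) (by omega) rfl, sub_self]
    rw [h0] at h
    exact (mul_eq_zero.1 h.symm).resolve_left (sub_ne_zero.2 hab)

/-- The recursively defined difference quotient is the divided difference. -/
theorem diffQuot_eq_divDiff (k : ℕ) (f : F → F) (x : Fin (k + 1) → F)
    (hx : Function.Injective x) : diffQuot k f x = divDiff f (Finset.univ.image x) := by
  induction k with
  | zero =>
    have : Finset.univ.image x = {x 0} := by ext y; simp
    rw [this, divDiff_singleton]; rfl
  | succ k ih =>
    have key : ∀ i : Fin (k + 2), (Finset.univ.image fun j => x (i.succAbove j)) =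
        (Finset.univ.image x).erase (x i) := by
      intro i
      ext y
      simp only [Finset.mem_image, Finset.mem_univ, true_and, Finset.mem_erase]
      constructor
      · rintro ⟨j, rfl⟩
        exact ⟨fun h => Fin.succAbove_ne i j (hx h), _, rfl⟩
      · rintro ⟨hne, j, rfl⟩
        obtain ⟨l, hl⟩ := Fin.exists_succAbove_eq (fun h : j = i => hne (by rw [h]))
        exact ⟨l, by rw [hl]⟩
    have h01 : x 0 - x 1 ≠ 0 := sub_ne_zero.2 fun h => by simpa using hx h
    rw [diffQuot, ih (fun i => x (Fin.succAbove 1 i)) (hx.comp Fin.succAbove_right_injective),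
      ih (fun i => x (Fin.succAbove 0 i)) (hx.comp Fin.succAbove_right_injective), key, key,
      divDiff_erase_sub f (by simp) (by simp), mul_div_cancel_left₀ _ h01]

theorem multiDiffQuot_eq_gridDiff {d : ℕ} (β : Fin d → ℕ) (f : (Fin d → F) → F)
    (x : (j : Fin d) → Fin (β j + 1) → F) (hx : ∀ j, Function.Injective (x j)) :
    multiDiffQuot β f x = gridDiff f fun j => Finset.univ.image (x j) := by
  induction d with
  | zero => rfl
  | succ d ih =>
    rw [multiDiffQuot, gridDiff, diffQuot_eq_divDiff _ _ _ (hx 0)]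
    exact divDiff_congr fun t _ => ih _ _ _ fun j => hx j.succ

theorem gridDiff_congr {d : ℕ} {f g : (Fin d → F) → F} {T : Fin d → Finset F}
    (h : ∀ x, (∀ j, x j ∈ T j) → f x = g x) : gridDiff f T = gridDiff g T := by
  induction d with
  | zero => exact h _ fun j => j.elim0
  | succ d ih =>
    refine divDiff_congr fun t ht => ih fun y hy => h _ fun j => ?_
    refine Fin.cases ?_ (fun j => ?_) j
    · simpa using ht
    · simpa using hy j

/-- A divided difference on a grid is a fixed linear combination of the values on the grid. -/
theorem exists_gridDiff_eq_sum {d : ℕ} (T : Fin d → Finset F) :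
    ∃ w : (Fin d → F) → F, ∀ f : (Fin d → F) → F,
      gridDiff f T = ∑ x ∈ Fintype.piFinset T, w x * f x := by
  induction d with
  | zero =>
    refine ⟨fun _ => 1, fun f => ?_⟩
    simp [gridDiff, Subsingleton.elim (default : Fin 0 → F) Fin.elim0]
  | succ d ih =>
    obtain ⟨w, hw⟩ := ih fun j => T j.succ
    refine ⟨fun x => (∏ y ∈ (T 0).erase (x 0), (x 0 - y)⁻¹) * w (Fin.tail x), fun f => ?_⟩
    have e : ∑ x ∈ Fintype.piFinset T,
        (∏ y ∈ (T 0).erase (x 0), (x 0 - y)⁻¹) * w (Fin.tail x) * f x =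
        ∑ p ∈ T 0 ×ˢ Fintype.piFinset (fun j => T (Fin.succ j)),
          (∏ y ∈ (T 0).erase p.1, (p.1 - y)⁻¹) * w p.2 * f (Fin.cons p.1 p.2) := by
      refine Finset.sum_nbij' (fun x => (x 0, Fin.tail x)) (fun p => Fin.cons p.1 p.2)
        ?_ ?_ ?_ ?_ ?_
      · intro x hx
        simp only [Finset.mem_product, Fintype.mem_piFinset] at hx ⊢
        exact ⟨hx 0, fun j => hx j.succ⟩
      · rintro ⟨a, y⟩ hp
        simp only [Finset.mem_product, Fintype.mem_piFinset] at hp ⊢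
        refine fun j => Fin.cases ?_ (fun j => ?_) j
        · simpa using hp.1
        · simpa using hp.2 j
      · intro x _
        exact Fin.cons_self_tail x
      · rintro ⟨a, y⟩ _
        simp
      · intro x _
        simp only [Fin.cons_self_tail]
    rw [e, Finset.sum_product, gridDiff, divDiff]
    refine Finset.sum_congr rfl fun t _ => ?_
    rw [hw, Finset.sum_mul]
    exact Finset.sum_congr rfl fun y _ => by ring

theorem gridDiff_sum_mul {d : ℕ} {ι : Type*} (s : Finset ι) (c : ι → F) (f : ι → (Fin d → F) → F)
    (T : Fin d → Finset F) :
    gridDiff (fun x => ∑ i ∈ s, c i * f i x) T = ∑ i ∈ s, c i * gridDiff (f i) T := by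
  obtain ⟨w, hw⟩ := exists_gridDiff_eq_sum T
  simp only [hw, Finset.mul_sum]
  rw [Finset.sum_comm]
  exact Finset.sum_congr rfl fun i _ => Finset.sum_congr rfl fun x _ => by ring

/-- The divided difference on a grid may be taken in the variable `j` last. -/
theorem gridDiff_eq_divDiff_update {d : ℕ} (f : (Fin d → F) → F) (T : Fin d → Finset F)
    (j : Fin d) :
    gridDiff f T = divDiff (fun t => gridDiff f (Function.update T j {t})) (T j) := by
  induction d with
  | zero => exact j.elim0
  | succ d ih =>
    refine Fin.cases ?_ (fun j => ?_) j
    · refine divDiff_congr fun t _ => ?_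
      simp [gridDiff, divDiff_singleton]
    · have h1 : ∀ t : F, gridDiff f (Function.update T j.succ {t}) =
          divDiff (fun s => gridDiff (fun y => f (Fin.cons s y))
            (Function.update (fun i : Fin d => T i.succ) j {t})) (T 0) := by
        intro t
        rw [gridDiff, Function.update_of_ne (Fin.succ_ne_zero j).symm]
        congr 1
        ext s
        congr 1
        ext i : 1
        by_cases hij : i = j
        · subst hij; simp
        · simp [Function.update_of_ne hij,
            Function.update_of_ne fun h => hij (Fin.succ_injective _ h)]
      simp only [h1]
      conv_lhs => rw [gridDiff]
      rw [divDiff_congr fun t _ => ih (fun y => f (Fin.cons t y)) (fun i => T i.succ) j]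
      simp only [divDiff, Finset.sum_mul]
      rw [Finset.sum_comm]
      exact Finset.sum_congr rfl fun _ _ => Finset.sum_congr rfl fun _ _ => by ring

theorem gridDiff_update_singleton {d : ℕ} (f : (Fin d → F) → F) (T : Fin d → Finset F)
    (j : Fin d) (t s : F) :
    gridDiff f (Function.update T j {t}) =
      gridDiff (fun x => f (Function.update x j t)) (Function.update T j {s}) := by
  induction d with
  | zero => exact j.elim0
  | succ d ih =>
    revert j
    refine Fin.cases ?_ (fun j => ?_)
    · simp [gridDiff, divDiff_singleton, Fin.update_cons_zero]
    · simp only [gridDiff]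
      rw [Function.update_of_ne (Fin.succ_ne_zero j).symm,
        Function.update_of_ne (Fin.succ_ne_zero j).symm]
      refine divDiff_congr fun a _ => ?_
      have e : ∀ r : F, (fun i : Fin d => Function.update T j.succ {r} i.succ) =
          Function.update (fun i : Fin d => T i.succ) j {r} := by
        intro r
        ext i : 1
        by_cases hij : i = j
        · subst hij; simp
        · simp [Function.update_of_ne hij,
            Function.update_of_ne fun h => hij (Fin.succ_injective _ h)]
      rw [e, e, ih]
      simp [Fin.cons_update]

theorem gridDiff_singleton {d : ℕ} (f : (Fin d → F) → F) (x : Fin d → F) :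
    gridDiff f (fun j => {x j}) = f x := by
  induction d with
  | zero => exact congrArg f (Subsingleton.elim _ _)
  | succ d ih =>
    rw [gridDiff, divDiff_singleton, ih (fun y => f (Fin.cons (x 0) y)) fun j : Fin d => x j.succ]
    exact congrArg f (Fin.cons_self_tail x)

/-- The recursion satisfied by divided differences on grids, in the variable `j`. -/
theorem gridDiff_erase_sub {d : ℕ} (f : (Fin d → F) → F) (T : Fin d → Finset F) (j : Fin d)
    {a b : F} (ha : a ∈ T j) (hb : b ∈ T j) :
    gridDiff f (Function.update T j ((T j).erase b)) -
      gridDiff f (Function.update T j ((T j).erase a)) = (a - b) * gridDiff f T := by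
  rw [gridDiff_eq_divDiff_update f T j, gridDiff_eq_divDiff_update f _ j,
    gridDiff_eq_divDiff_update f (Function.update T j ((T j).erase a)) j]
  simp only [Function.update_idem, Function.update_self]
  exact divDiff_erase_sub _ ha hb

theorem divDiff_nodes_succ {t : ℕ → F} {m n : ℕ} (ht : Set.InjOn t (Set.Iic (m + (n + 1))))
    (f : F → F) :
    (t m - t (m + (n + 1))) * divDiff f (nodes t m (n + 1)) =
      divDiff f (nodes t m n) - divDiff f (nodes t (m + 1) n) := by
  have inj : ∀ i j, i ≤ n + 1 → j ≤ n + 1 → t (m + i) = t (m + j) → i = j := by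
    intro i j hi hj h
    have := ht (show m + i ∈ Set.Iic (m + (n + 1)) by simp; omega)
      (show m + j ∈ Set.Iic (m + (n + 1)) by simp; omega) h
    omega
  have h1 : nodes t m n = (nodes t m (n + 1)).erase (t (m + (n + 1))) := by
    ext y
    simp only [nodes, Finset.mem_image, Finset.mem_range, Finset.mem_erase]
    constructor
    · rintro ⟨i, hi, rfl⟩
      exact ⟨fun h => by have := inj i (n + 1) (by omega) le_rfl h; omega, i, by omega, rfl⟩
    · rintro ⟨hne, i, hi, rfl⟩
      have : i ≠ n + 1 := fun h => hne (by rw [h])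
      exact ⟨i, by omega, rfl⟩
  have h2 : nodes t (m + 1) n = (nodes t m (n + 1)).erase (t m) := by
    ext y
    simp only [nodes, Finset.mem_image, Finset.mem_range, Finset.mem_erase]
    constructor
    · rintro ⟨i, hi, rfl⟩
      refine ⟨fun h => ?_, i + 1, by omega, by congr 1; omega⟩
      have := inj (1 + i) 0 (by omega) (by omega) (by rw [← add_assoc]; exact h)
      omega
    · rintro ⟨hne, i, hi, rfl⟩
      have : i ≠ 0 := fun h => hne (by rw [h, add_zero])
      exact ⟨i - 1, by omega, by congr 1; omega⟩
  rw [h1, h2]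
  refine (divDiff_erase_sub f ?_ ?_).symm
  · exact Finset.mem_image.2 ⟨0, by simp, by simp⟩
  · exact Finset.mem_image.2 ⟨n + 1, by simp, rfl⟩

/-- The Leibniz rule for divided differences, for a function of two variables restricted to the
diagonal. -/
theorem divDiff_diag {t : ℕ → F} (G : F → F → F) (n m : ℕ)
    (ht : Set.InjOn t (Set.Iic (m + n))) :
    divDiff (fun x => G x x) (nodes t m n) =
      ∑ p ∈ Finset.HasAntidiagonal.antidiagonal n,
        divDiff (fun x => divDiff (fun y => G x y) (nodes t (m + p.1) p.2)) (nodes t m p.1) := by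
  induction n generalizing m with
  | zero =>
    have : ∀ m, nodes t m 0 = {t m} := fun m => by simp [nodes]
    simp [this, divDiff_singleton]
  | succ n ih =>
    have hne : t m - t (m + (n + 1)) ≠ 0 := by
      refine sub_ne_zero.2 fun h => ?_
      have := ht (show m ∈ Set.Iic (m + (n + 1)) by simp)
        (show m + (n + 1) ∈ Set.Iic (m + (n + 1)) by simp) h
      omega
    refine mul_left_cancel₀ hne ?_
    rw [divDiff_nodes_succ ht, ih m (ht.mono (Set.Iic_subset_Iic.2 (by omega))),
      ih (m + 1) (ht.mono (Set.Iic_subset_Iic.2 (by omega))), Finset.mul_sum]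
    set D : ℕ → ℕ → ℕ → ℕ → F := fun a i b j =>
      divDiff (fun x => divDiff (fun y => G x y) (nodes t b j)) (nodes t a i) with hD
    have hL : ∀ i b j, m + (i + 1) ≤ m + (n + 1) →
        (t m - t (m + (i + 1))) * D m (i + 1) b j = D m i b j - D (m + 1) i b j := by
      intro i b j hi
      exact divDiff_nodes_succ (ht.mono (Set.Iic_subset_Iic.2 (by omega))) _
    have hR : ∀ a i b j, b + (j + 1) ≤ m + (n + 1) →
        (t b - t (b + (j + 1))) * D a i b (j + 1) = D a i b j - D a i (b + 1) j := by
      intro a i b j hj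
      simp only [hD]
      rw [← divDiff_const_mul, ← divDiff_sub]
      exact divDiff_congr fun x _ =>
        divDiff_nodes_succ (ht.mono (Set.Iic_subset_Iic.2 (by omega))) _
    change (∑ p ∈ Finset.HasAntidiagonal.antidiagonal n, D m p.1 (m + p.1) p.2) -
      (∑ p ∈ Finset.HasAntidiagonal.antidiagonal n, D (m + 1) p.1 (m + 1 + p.1) p.2) =
      ∑ p ∈ Finset.HasAntidiagonal.antidiagonal (n + 1),
        (t m - t (m + (n + 1))) * D m p.1 (m + p.1) p.2
    -- Split `t m - t (m + n + 1)` at the common node `t (m + p.1)`; the mixed terms telescope.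
    have hsplit : ∑ p ∈ Finset.HasAntidiagonal.antidiagonal (n + 1),
        (t m - t (m + (n + 1))) * D m p.1 (m + p.1) p.2 =
        (∑ p ∈ Finset.HasAntidiagonal.antidiagonal (n + 1),
          (t m - t (m + p.1)) * D m p.1 (m + p.1) p.2) +
        ∑ p ∈ Finset.HasAntidiagonal.antidiagonal (n + 1),
          (t (m + p.1) - t (m + p.1 + p.2)) * D m p.1 (m + p.1) p.2 := by
      rw [← Finset.sum_add_distrib]
      refine Finset.sum_congr rfl fun p hp => ?_
      have := Finset.HasAntidiagonal.mem_antidiagonal.1 hp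
      rw [show m + p.1 + p.2 = m + (n + 1) by omega]
      ring
    rw [hsplit, Finset.Nat.sum_antidiagonal_succ, Finset.Nat.sum_antidiagonal_succ'
      (f := fun p : ℕ × ℕ => (t (m + p.1) - t (m + p.1 + p.2)) * D m p.1 (m + p.1) p.2)]
    simp only [add_zero, sub_self, zero_mul, zero_add]
    have e1 : ∀ p ∈ Finset.HasAntidiagonal.antidiagonal n,
        (t m - t (m + (p.1 + 1))) * D m (p.1 + 1) (m + (p.1 + 1)) p.2 =
        D m p.1 (m + (p.1 + 1)) p.2 - D (m + 1) p.1 (m + 1 + p.1) p.2 := by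
      intro p hp
      have := Finset.HasAntidiagonal.mem_antidiagonal.1 hp
      rw [hL _ _ _ (by omega), show m + 1 + p.1 = m + (p.1 + 1) by omega]
    have e2 : ∀ p ∈ Finset.HasAntidiagonal.antidiagonal n,
        (t (m + p.1) - t (m + p.1 + (p.2 + 1))) * D m p.1 (m + p.1) (p.2 + 1) =
        D m p.1 (m + p.1) p.2 - D m p.1 (m + (p.1 + 1)) p.2 := by
      intro p hp
      have := Finset.HasAntidiagonal.mem_antidiagonal.1 hp
      rw [hR _ _ _ _ (by omega), add_assoc]
    rw [Finset.sum_congr rfl e1, Finset.sum_congr rfl e2, Finset.sum_sub_distrib,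
      Finset.sum_sub_distrib]
    ring

/-- Divided differences under an affine change of variable. -/
theorem divDiff_comp_affine (H : F → F) (z v : F) (hv : v ≠ 0) {k : ℕ} {T : Finset F}
    (hT : T.card = k + 1) :
    divDiff (fun τ => H (z + τ * v)) T = v ^ k * divDiff H (T.image fun τ => z + τ * v) := by
  have inj : Function.Injective fun τ : F => z + τ * v := fun a b h => by
    simpa [hv] using h
  unfold divDiff
  rw [Finset.sum_image fun a _ b _ h => inj h, Finset.mul_sum]
  refine Finset.sum_congr rfl fun x hx => ?_
  rw [← Finset.image_erase inj, Finset.prod_image fun a _ b _ h => inj h]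
  have : ∏ y ∈ T.erase x, (z + x * v - (z + y * v))⁻¹ =
      (v ^ k)⁻¹ * ∏ y ∈ T.erase x, (x - y)⁻¹ := by
    have hc : (T.erase x).card = k := by rw [Finset.card_erase_of_mem hx, hT]; rfl
    rw [← hc, ← inv_pow, ← Finset.prod_const, ← Finset.prod_mul_distrib]
    refine Finset.prod_congr rfl fun y _ => ?_
    rw [← mul_inv]
    congr 1
    ring
  rw [this]
  field_simp

/-- Divided differences along a line are combinations of divided differences on grids: this is the
iterated Leibniz rule. The grids depend only on the line and on the nodes. -/
theorem exists_divDiff_line {d : ℕ} (z v : Fin d → F) (hv : ∀ j, v j ≠ 0) {t : ℕ → F} (m k : ℕ)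
    (ht : Set.InjOn t (Set.Iic (m + k))) :
    ∃ T : (Fin d → ℕ) → Fin d → Finset F,
      (∀ β, ∑ j, β j = k → ∀ j, (T β j).card = β j + 1 ∧
        T β j ⊆ (nodes t m k).image fun τ => z j + τ * v j) ∧
      ∀ f : (Fin d → F) → F, divDiff (fun τ => f (z + τ • v)) (nodes t m k) =
        ∑ β ∈ Finset.Nat.antidiagonalTuple d k, (∏ j, v j ^ β j) * gridDiff f (T β) := by
  induction d generalizing m k with
  | zero =>
    refine ⟨fun _ => Fin.elim0, fun _ _ j => j.elim0, fun f => ?_⟩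
    have hf : ∀ x, f x = f Fin.elim0 := fun x => congrArg f (Subsingleton.elim _ _)
    rcases k with _ | k
    · have : nodes t m 0 = {t m} := by simp [nodes]
      simp [this, divDiff_singleton, gridDiff, hf]
    · rw [divDiff_congr (g := fun _ => f Fin.elim0) (fun x _ => hf _),
        divDiff_const _ (by rw [card_nodes ht]; omega)]
      simp
  | succ d ih =>
    have hsub : ∀ a b, a + b ≤ k → nodes t (m + a) b ⊆ nodes t m k := by
      intro a b hab y hy
      simp only [nodes, Finset.mem_image, Finset.mem_range] at hy ⊢
      obtain ⟨i, hi, rfl⟩ := hy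
      exact ⟨a + i, by omega, by rw [add_assoc]⟩
    choose! T' hT' hTf using fun (a b : ℕ) (hab : a + b = k) =>
      ih (fun j => z j.succ) (fun j => v j.succ) (fun j => hv _) (m + a) b
        (ht.mono (Set.Iic_subset_Iic.2 (by omega)))
    have inj : Function.Injective fun τ : F => z 0 + τ * v 0 := fun a b h => by
      simpa [hv 0] using h
    refine ⟨fun β => Fin.cons ((nodes t m (β 0)).image fun τ => z 0 + τ * v 0)
      (T' (β 0) (∑ j : Fin d, β j.succ) (Fin.tail β)), ?_, ?_⟩
    · intro β hβ j
      rw [Fin.sum_univ_succ] at hβ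
      refine Fin.cases ?_ (fun j => ?_) j
      · simp only [Fin.cons_zero]
        rw [Finset.card_image_of_injective _ inj,
          card_nodes (ht.mono (Set.Iic_subset_Iic.2 (by omega)))]
        refine ⟨rfl, Finset.image_subset_image ?_⟩
        simpa using hsub 0 (β 0) (by omega)
      · simp only [Fin.cons_succ]
        obtain ⟨h1, h2⟩ := hT' (β 0) _ hβ (Fin.tail β) rfl j
        exact ⟨h1, h2.trans (Finset.image_subset_image (hsub _ _ hβ.le))⟩
    · intro f
      have hline : ∀ τ, z + τ • v =
          Fin.cons (z 0 + τ * v 0)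
            ((fun j : Fin d => z j.succ) + τ • fun j : Fin d => v j.succ) := by
        intro τ
        ext j
        refine Fin.cases ?_ (fun j => ?_) j <;> simp
      simp only [hline]
      rw [divDiff_diag (fun x y => f (Fin.cons (z 0 + x * v 0)
        ((fun j : Fin d => z j.succ) + y • fun j : Fin d => v j.succ))) k m ht]
      have hrhs : ∀ g : (Fin (d + 1) → ℕ) → F, ∑ β ∈ Finset.Nat.antidiagonalTuple (d + 1) k, g β =
          ∑ p ∈ Finset.HasAntidiagonal.antidiagonal k, ∑ β ∈ Finset.Nat.antidiagonalTuple d p.2,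
            g (Fin.cons p.1 β) := by
        intro g
        rw [Finset.sum_sigma']
        refine Finset.sum_bij' (fun β _ => ⟨(β 0, ∑ j : Fin d, β j.succ), Fin.tail β⟩)
          (fun q _ => Fin.cons q.1.1 q.2) ?_ ?_ ?_ ?_ ?_
        · intro β hβ
          rw [Finset.Nat.mem_antidiagonalTuple, Fin.sum_univ_succ] at hβ
          simp only [Finset.mem_sigma, Finset.HasAntidiagonal.mem_antidiagonal,
            Finset.Nat.mem_antidiagonalTuple]
          exact ⟨hβ, rfl⟩
        · rintro ⟨⟨a, b⟩, β⟩ hq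
          simp only [Finset.mem_sigma, Finset.HasAntidiagonal.mem_antidiagonal,
            Finset.Nat.mem_antidiagonalTuple] at hq ⊢
          rw [Fin.sum_univ_succ]
          simp [hq.1, hq.2]
        · intro β _
          exact Fin.cons_self_tail β
        · rintro ⟨⟨a, b⟩, β⟩ hq
          simp only [Finset.mem_sigma, Finset.HasAntidiagonal.mem_antidiagonal,
            Finset.Nat.mem_antidiagonalTuple] at hq
          simp [hq.2]
        · intro β _
          simp only [Fin.cons_self_tail]
      rw [hrhs]
      refine Finset.sum_congr rfl fun p hp => ?_
      have hp' := Finset.HasAntidiagonal.mem_antidiagonal.1 hp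
      have hin : ∀ x, divDiff (fun y => f (Fin.cons (z 0 + x * v 0)
            ((fun j : Fin d => z j.succ) + y • fun j : Fin d => v j.succ)))
            (nodes t (m + p.1) p.2) =
          ∑ β ∈ Finset.Nat.antidiagonalTuple d p.2, (∏ j : Fin d, v j.succ ^ β j) *
            gridDiff (fun y => f (Fin.cons (z 0 + x * v 0) y)) (T' p.1 p.2 β) :=
        fun x => hTf p.1 p.2 hp' (fun y => f (Fin.cons (z 0 + x * v 0) y))
      simp only [hin]
      rw [divDiff_sum]
      refine Finset.sum_congr rfl fun β hβ => ?_
      rw [Finset.Nat.mem_antidiagonalTuple] at hβ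
      rw [divDiff_const_mul, divDiff_comp_affine
        (fun x => gridDiff (fun y => f (Fin.cons x y)) (T' p.1 p.2 β)) _ _ (hv 0)
        (card_nodes (ht.mono (Set.Iic_subset_Iic.2 (by omega)))), Fin.prod_univ_succ]
      simp only [gridDiff, Fin.cons_zero, Fin.cons_succ, Fin.tail_cons, hβ]
      ring

end DividedDifferences

/-! ### Continuous extensions of divided differences in ultrametric calculus -/

section UltrametricJets

variable {F : Type*} [NontriviallyNormedField F] {d n : ℕ}

/-- The constant tuples at a point, at which the divided differences degenerate to derivatives. -/
def diag {ι α : Type*} (x : ι → α) : ι → ℕ → α := fun j _ => x j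

/-- A system of continuous extensions of the divided differences of orders at most `k` of `f` to
tuples of points of the box `V`, possibly with coincidences. The tuples are indexed by `ℕ`, and
`E β` only uses the first `β j + 1` entries in the variable `j`. -/
structure IsDiffExtension (k : ℕ) (f : (Fin d → F) → F) (V : Fin d → Set F)
    (E : (Fin d → ℕ) → (Fin d → ℕ → F) → F) : Prop where
  continuousOn : ∀ β, ∑ j, β j ≤ k → ContinuousOn (E β) {s | ∀ j i, s j i ∈ V j}
  eq_gridDiff : ∀ β, ∑ j, β j ≤ k → ∀ s : Fin d → ℕ → F, (∀ j i, s j i ∈ V j) →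
    (∀ j, Set.InjOn (s j) (Set.Iic (β j))) → E β s = gridDiff f fun j => nodes (s j) 0 (β j)
  congr : ∀ β s s', (∀ j, ∀ i ≤ β j, s j i = s' j i) → E β s = E β s'

theorem UltraCkOnBox.exists_isDiffExtension {k : ℕ} {f : (Fin d → F) → F} {V : Fin d → Set F}
    (hf : UltraCkOnBox k f V) : ∃ E, IsDiffExtension k f V E := by
  choose! g hg using hf
  refine ⟨fun β s => g β fun j i => s j i, ?_, ?_, ?_⟩
  · intro β hβ
    refine (hg β hβ).1.comp (Continuous.continuousOn ?_) ?_
    · fun_prop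
    · exact fun s hs j i => hs j i
  · intro β hβ s hs hinj
    have hinj' : ∀ j, Function.Injective fun i : Fin (β j + 1) => s j i := by
      intro j a b hab
      exact Fin.ext (hinj j (Nat.lt_succ_iff.1 a.2) (Nat.lt_succ_iff.1 b.2) hab)
    refine ((hg β hβ).2 (fun j i => s j i) (fun j i => hs j i) hinj').trans ?_
    rw [multiDiffQuot_eq_gridDiff _ _ _ hinj']
    congr 1
    ext j y
    simp only [nodes, Finset.mem_image, Finset.mem_univ, true_and, Finset.mem_range, zero_add]
    exact ⟨fun ⟨i, hi⟩ => ⟨i, i.2, hi⟩, fun ⟨i, hi, h⟩ => ⟨⟨i, hi⟩, h⟩⟩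
  · intro β s s' h
    refine congrArg (g β) ?_
    ext j i
    exact h j i (Nat.lt_succ_iff.1 i.2)

theorem nodes_update_last {α : Type*} {t : ℕ → α} {n i : ℕ}
    (ht : Set.InjOn t (Set.Iic (n + 1))) (hi : i ≤ n) :
    nodes (Function.update t i (t (n + 1))) 0 n = (nodes t 0 (n + 1)).erase (t i) := by
  ext y
  simp only [nodes, Finset.mem_image, Finset.mem_range, Finset.mem_erase, zero_add]
  constructor
  · rintro ⟨m, hm, rfl⟩
    by_cases hmi : m = i
    · subst hmi
      rw [Function.update_self]
      refine ⟨fun h => ?_, n + 1, by omega, rfl⟩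
      have := ht (show n + 1 ∈ Set.Iic (n + 1) by simp) (show m ∈ Set.Iic (n + 1) by simp; omega) h
      omega
    · rw [Function.update_of_ne hmi]
      exact ⟨fun h => hmi (ht (show m ∈ Set.Iic (n + 1) by simp; omega)
        (show i ∈ Set.Iic (n + 1) by simp; omega) h), m, by omega, rfl⟩
  · rintro ⟨hne, m, hm, rfl⟩
    have hmi : m ≠ i := fun h => hne (by rw [h])
    by_cases hmn : m = n + 1
    · exact ⟨i, by omega, by rw [Function.update_self, hmn]⟩
    · exact ⟨m, by omega, Function.update_of_ne hmi _ _⟩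

theorem nodes_erase_last {α : Type*} {t : ℕ → α} {n : ℕ}
    (ht : Set.InjOn t (Set.Iic (n + 1))) :
    nodes t 0 n = (nodes t 0 (n + 1)).erase (t (n + 1)) := by
  ext y
  simp only [nodes, Finset.mem_image, Finset.mem_range, Finset.mem_erase, zero_add]
  constructor
  · rintro ⟨m, hm, rfl⟩
    refine ⟨fun h => ?_, m, by omega, rfl⟩
    have := ht (show m ∈ Set.Iic (n + 1) by simp; omega) (show n + 1 ∈ Set.Iic (n + 1) by simp) h
    omega
  · rintro ⟨hne, m, hm, rfl⟩
    have : m ≠ n + 1 := fun h => hne (by rw [h])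
    exact ⟨m, by omega, rfl⟩

theorem sum_update_succ (β : Fin d → ℕ) (j : Fin d) :
    ∑ m, Function.update β j (β j + 1) m = ∑ m, β m + 1 := by
  rw [Finset.sum_update_of_mem (Finset.mem_univ j), ← Finset.add_sum_erase _ β (Finset.mem_univ j),
    Finset.sdiff_singleton_eq_erase]
  ring

/-- The recursion for divided differences persists at tuples with coincidences: such tuples are
limits of tuples with distinct entries. -/
theorem IsDiffExtension.sub_eq {k : ℕ} {f : (Fin d → F) → F} {V : Fin d → Set F}
    {E : (Fin d → ℕ) → (Fin d → ℕ → F) → F} (hE : IsDiffExtension k f V E)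
    (hV : ∀ j, IsOpen (V j)) {β : Fin d → ℕ} (hβ : ∑ j, β j + 1 ≤ k) {s : Fin d → ℕ → F}
    (hs : ∀ j i, s j i ∈ V j) (j : Fin d) {i : ℕ} (hi : i ≤ β j) :
    E β s - E β (Function.update s j (Function.update (s j) i (s j (β j + 1)))) =
      (s j i - s j (β j + 1)) * E (Function.update β j (β j + 1)) s := by
  set β' := Function.update β j (β j + 1) with hβ'
  have hsum : ∑ m, β' m = ∑ m, β m + 1 := sum_update_succ β j
  set S : (Fin d → ℕ → F) → Fin d → ℕ → F := fun s =>
    Function.update s j (Function.update (s j) i (s j (β j + 1))) with hS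
  have hScont : Continuous S := by
    refine continuous_id.update j ?_
    exact Continuous.update (by fun_prop) i (by fun_prop)
  have hSbox : ∀ s : Fin d → ℕ → F, (∀ j i, s j i ∈ V j) → ∀ j i, S s j i ∈ V j := by
    intro s hs m l
    by_cases hm : m = j
    · subst hm
      simp only [hS, Function.update_self]
      by_cases hl : l = i
      · subst hl; simpa using hs _ _
      · simpa [Function.update_of_ne hl] using hs _ _
    · simpa [hS, Function.update_of_ne hm] using hs _ _
  have hgen : ∀ s : Fin d → ℕ → F, (∀ j i, s j i ∈ V j) →
      (∀ j, Set.InjOn (s j) (Set.Iic (β' j))) →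
      E β s - E β (S s) = (s j i - s j (β j + 1)) * E β' s := by
    intro s hs hinj
    have hle : ∀ m, β m ≤ β' m := by
      intro m
      by_cases hm : m = j
      · subst hm; simp [hβ']
      · simp [hβ', Function.update_of_ne hm]
    have hj' : Set.InjOn (s j) (Set.Iic (β j + 1)) := by simpa [hβ'] using hinj j
    have hSinj : ∀ m, Set.InjOn (S s m) (Set.Iic (β m)) := by
      intro m
      by_cases hm : m = j
      · subst hm
        simp only [hS, Function.update_self]
        intro a ha b hb hab
        simp only [Set.mem_Iic] at ha hb
        have hmem : ∀ c, c ≤ β m + 1 → c ∈ Set.Iic (β m + 1) := fun c hc => hc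
        by_cases hai : a = i <;> by_cases hbi : b = i
        · rw [hai, hbi]
        · subst hai
          rw [Function.update_self, Function.update_of_ne hbi] at hab
          have := hj' (hmem _ le_rfl) (hmem b (by omega)) hab
          omega
        · subst hbi
          rw [Function.update_self, Function.update_of_ne hai] at hab
          have := hj' (hmem a (by omega)) (hmem _ le_rfl) hab
          omega
        · rw [Function.update_of_ne hai, Function.update_of_ne hbi] at hab
          exact hj' (hmem a (by omega)) (hmem b (by omega)) hab
      · simpa [hS, Function.update_of_ne hm] using
          (hinj m).mono (Set.Iic_subset_Iic.2 (hle m))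
    rw [hE.eq_gridDiff β (by omega) s hs fun m => (hinj m).mono (Set.Iic_subset_Iic.2 (hle m)),
      hE.eq_gridDiff β (by omega) (S s) (hSbox s hs) hSinj,
      hE.eq_gridDiff β' (by omega) s hs hinj]
    set T : Fin d → Finset F := fun m => nodes (s m) 0 (β' m) with hT
    have hTj : T j = nodes (s j) 0 (β j + 1) := by simp [hT, hβ']
    have h1 : (fun m => nodes (s m) 0 (β m)) =
        Function.update T j ((T j).erase (s j (β j + 1))) := by
      ext m : 1
      by_cases hm : m = j
      · subst hm
        rw [Function.update_self, hTj, ← nodes_erase_last hj']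
      · simp [Function.update_of_ne hm, hT, hβ']
    have h2 : (fun m => nodes (S s m) 0 (β m)) = Function.update T j ((T j).erase (s j i)) := by
      ext m : 1
      by_cases hm : m = j
      · subst hm
        simp only [hS, Function.update_self]
        rw [hTj, ← nodes_update_last hj' hi]
      · simp [Function.update_of_ne hm, hT, hβ', hS]
    rw [h1, h2]
    refine gridDiff_erase_sub f T j ?_ ?_ <;> rw [hTj, nodes, Finset.mem_image]
    · exact ⟨i, by simp; omega, by simp⟩
    · exact ⟨β j + 1, by simp, by simp⟩
  -- Perturb `s` along pairwise distinct directions.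
  set u : ℕ → F := fun m => if m ≤ k then Infinite.natEmbedding F m else 0 with hu
  set σ : F → Fin d → ℕ → F := fun ε m l => s m l + ε * u l with hσ
  have hσcont : Continuous σ := by fun_prop
  have hσ0 : σ 0 = s := by ext m l; simp [hσ]
  have hσlim : Tendsto σ (𝓝[≠] 0) (𝓝 s) := by
    have := hσcont.tendsto 0
    rw [hσ0] at this
    exact this.mono_left nhdsWithin_le_nhds
  have hσbox : ∀ᶠ ε in 𝓝[≠] (0 : F), ∀ j i, σ ε j i ∈ V j := by
    have h1 : ∀ m : Fin d, ∀ l ∈ Finset.range (k + 1), ∀ᶠ ε in 𝓝[≠] (0 : F), σ ε m l ∈ V m := by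
      intro m l _
      have : Tendsto (fun ε => σ ε m l) (𝓝[≠] 0) (𝓝 (s m l)) :=
        (tendsto_pi_nhds.1 ((tendsto_pi_nhds.1 hσlim) m)) l
      exact this.eventually ((hV m).mem_nhds (hs m l))
    filter_upwards [eventually_all.2 fun m => (Finset.eventually_all _).2 (h1 m)] with ε hε m l
    by_cases hl : l ≤ k
    · exact hε m l (by simp; omega)
    · simpa [hσ, hu, hl] using hs m l
  have hσinj : ∀ᶠ ε in 𝓝[≠] (0 : F), ∀ j, Set.InjOn (σ ε j) (Set.Iic (β' j)) := by
    have h1 : ∀ m : Fin d, ∀ a ∈ Finset.range (k + 1), ∀ b ∈ Finset.range (k + 1),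
        ∀ᶠ ε in 𝓝[≠] (0 : F), a ≠ b → σ ε m a ≠ σ ε m b := by
      intro m a ha b hb
      by_cases hab : a = b
      · exact Eventually.of_forall fun _ h => absurd hab h
      simp only [Finset.mem_range, Nat.lt_succ_iff] at ha hb
      by_cases hsab : s m a = s m b
      · filter_upwards [self_mem_nhdsWithin] with ε hε _ h
        simp only [hσ, hu, hsab, ha, hb, if_true, add_right_inj] at h
        exact hab ((Infinite.natEmbedding F).injective (mul_left_cancel₀ hε h))
      · have h2 : Tendsto (fun ε => σ ε m a - σ ε m b) (𝓝[≠] 0) (𝓝 (s m a - s m b)) :=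
          ((tendsto_pi_nhds.1 ((tendsto_pi_nhds.1 hσlim) m)) a).sub
            ((tendsto_pi_nhds.1 ((tendsto_pi_nhds.1 hσlim) m)) b)
        filter_upwards [h2.eventually_ne (sub_ne_zero.2 hsab)] with ε hε _
        exact sub_ne_zero.1 hε
    filter_upwards [eventually_all.2 fun m => (Finset.eventually_all _).2 fun a ha =>
      (Finset.eventually_all _).2 (h1 m a ha)] with ε hε m a ha b hb hab
    have hm : β' m ≤ k := by
      have := Finset.single_le_sum (f := β') (fun _ _ => Nat.zero_le _) (Finset.mem_univ m)
      omega
    simp only [Set.mem_Iic] at ha hb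
    by_contra hne
    exact hε m a (by simp; omega) b (by simp; omega) hne hab
  have hEt : ∀ γ, ∑ m, γ m ≤ k → Tendsto (fun ε => E γ (σ ε)) (𝓝[≠] 0) (𝓝 (E γ s)) := by
    intro γ hγ
    exact ((hE.continuousOn γ hγ) s hs).tendsto.comp (tendsto_nhdsWithin_iff.2 ⟨hσlim, hσbox⟩)
  have hES : Tendsto (fun ε => E β (S (σ ε))) (𝓝[≠] 0) (𝓝 (E β (S s))) := by
    refine ((hE.continuousOn β (by omega)) (S s) (hSbox s hs)).tendsto.comp
      (tendsto_nhdsWithin_iff.2 ⟨(hScont.tendsto s).comp hσlim, ?_⟩)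
    filter_upwards [hσbox] with ε hε using hSbox _ hε
  have hc : ∀ l, Tendsto (fun ε => σ ε j l) (𝓝[≠] 0) (𝓝 (s j l)) := fun l =>
    (tendsto_pi_nhds.1 ((tendsto_pi_nhds.1 hσlim) j)) l
  refine tendsto_nhds_unique_of_eventuallyEq ((hEt β (by omega)).sub hES)
    (((hc i).sub (hc (β j + 1))).mul (hEt β' (by omega))) ?_
  filter_upwards [hσbox, hσinj] with ε h1 h2 using hgen _ h1 h2

/-- The extended divided difference of order `β` on the diagonal has partial derivatives given by
the divided differences of the next order. -/
theorem IsDiffExtension.hasDerivAt {k : ℕ} {f : (Fin d → F) → F} {V : Fin d → Set F}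
    {E : (Fin d → ℕ) → (Fin d → ℕ → F) → F} (hE : IsDiffExtension k f V E)
    (hV : ∀ j, IsOpen (V j)) {β : Fin d → ℕ} (hβ : ∑ j, β j + 1 ≤ k) {x : Fin d → F}
    (hx : ∀ j, x j ∈ V j) (j : Fin d) :
    HasDerivAt (fun t => E β (diag (Function.update x j t)))
      ((β j + 1 : ℕ) * E (Function.update β j (β j + 1)) (diag x)) (x j) := by
  set β' := Function.update β j (β j + 1) with hβ'
  have hsum : ∑ m, β' m = ∑ m, β m + 1 := sum_update_succ β j
  set ρ : ℕ → F → Fin d → ℕ → F := fun i t =>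
    Function.update (diag x) j fun m => if m < i then t else x j with hρ
  have hρcont : ∀ i, Continuous (ρ i) := by
    intro i
    refine Continuous.update continuous_const j (continuous_pi fun m => ?_)
    split_ifs <;> fun_prop
  have hρx : ∀ i, ρ i (x j) = diag x := by
    intro i
    ext m l
    by_cases hm : m = j
    · subst hm; simp [hρ, diag]
    · simp [hρ, Function.update_of_ne hm]
  have hρ0 : ∀ t, ρ 0 t = diag x := by
    intro t
    ext m l
    by_cases hm : m = j
    · subst hm; simp [hρ, diag]
    · simp [hρ, Function.update_of_ne hm]
  have hρbox : ∀ i, ∀ t ∈ V j, ∀ m l, ρ i t m l ∈ V m := by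
    intro i t ht m l
    by_cases hm : m = j
    · subst hm
      simp only [hρ, Function.update_self]
      split_ifs
      exacts [ht, hx _]
    · simpa [hρ, Function.update_of_ne hm, diag] using hx m
  have hstep : ∀ t ∈ V j, ∀ i ∈ Finset.range (β j + 1),
      E β (ρ (i + 1) t) - E β (ρ i t) = (t - x j) * E β' (ρ (i + 1) t) := by
    intro t ht i hi
    simp only [Finset.mem_range] at hi
    have h := hE.sub_eq hV hβ (hρbox (i + 1) t ht) j (Nat.lt_succ_iff.1 hi)
    have e1 : ρ (i + 1) t j i = t := by simp [hρ]
    have e2 : ρ (i + 1) t j (β j + 1) = x j := by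
      simp [hρ]; omega
    have e3 : Function.update (ρ (i + 1) t) j
        (Function.update (ρ (i + 1) t j) i (ρ (i + 1) t j (β j + 1))) = ρ i t := by
      rw [e2]
      ext m l
      by_cases hm : m = j
      · subst hm
        by_cases hl : l = i
        · subst hl; simp [hρ]
        · have : l ≤ i ↔ l < i := by omega
          simp [hρ, Function.update_of_ne hl, this]
      · simp [hρ, Function.update_of_ne hm]
    rw [e3, e1, e2] at h
    exact h
  have htel : ∀ t ∈ V j, E β (diag (Function.update x j t)) - E β (diag x) =
      (t - x j) * ∑ i ∈ Finset.range (β j + 1), E β' (ρ (i + 1) t) := by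
    intro t ht
    rw [Finset.mul_sum, ← Finset.sum_congr rfl (hstep t ht),
      Finset.sum_range_sub (fun i => E β (ρ i t)), hρ0]
    congr 1
    refine hE.congr _ _ _ fun m l hl => ?_
    by_cases hm : m = j
    · subst hm
      simp [hρ, diag, Nat.lt_succ_iff.2 hl]
    · simp [hρ, diag, Function.update_of_ne hm]
  have hupd : Function.update x j (x j) = x := Function.update_eq_self j x
  rw [hasDerivAt_iff_tendsto_slope]
  have hlim : Tendsto (fun t => ∑ i ∈ Finset.range (β j + 1), E β' (ρ (i + 1) t)) (𝓝[≠] (x j))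
      (𝓝 (∑ i ∈ Finset.range (β j + 1), E β' (diag x))) := by
    refine tendsto_finsetSum _ fun i _ => ?_
    refine ((hE.continuousOn β' (by omega)) (diag x) (fun m _ => hx m)).tendsto.comp
      (tendsto_nhdsWithin_iff.2 ⟨?_, ?_⟩)
    · have := (hρcont (i + 1)).tendsto (x j)
      rw [hρx] at this
      exact this.mono_left nhdsWithin_le_nhds
    · filter_upwards [mem_nhdsWithin_of_mem_nhds ((hV j).mem_nhds (hx j))] with t ht
      exact hρbox _ t ht
  rw [Finset.sum_const, Finset.card_range, nsmul_eq_mul] at hlim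
  refine hlim.congr' ?_
  filter_upwards [self_mem_nhdsWithin, mem_nhdsWithin_of_mem_nhds ((hV j).mem_nhds (hx j))]
    with t hne ht
  have : t - x j ≠ 0 := sub_ne_zero.2 hne
  rw [slope_def_field, hupd, htel t ht, mul_div_cancel_left₀ _ this]

/-- Partial derivatives are factorials times diagonal values of divided differences. -/
theorem multiPartialDeriv_eq_diffExtension {k : ℕ} {f : (Fin d → F) → Fin n → F}
    {V : Fin d → Set F} {E : Fin n → (Fin d → ℕ) → (Fin d → ℕ → F) → F}
    (hE : ∀ i, IsDiffExtension k (fun x => f x i) V (E i)) (hV : ∀ j, IsOpen (V j))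
    {β : Fin d → ℕ} (hβ : ∑ j, β j ≤ k) {x : Fin d → F} (hx : ∀ j, x j ∈ V j) (i : Fin n) :
    multiPartialDeriv β f x i = (∏ j, (β j).factorial : ℕ) * E i β (diag x) := by
  set N : List (Fin d) → Fin d → ℕ := fun l j => if j ∈ l then β j else 0 with hN
  -- One further partial derivative.
  have hpd : ∀ (γ : Fin d → ℕ) (c : F) (g : (Fin d → F) → Fin n → F), ∑ j, γ j + 1 ≤ k →
      (∀ x, (∀ j, x j ∈ V j) → ∀ i, g x i = c * E i γ (diag x)) → ∀ (j : Fin d) (x),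
      (∀ j, x j ∈ V j) → ∀ i, partialDeriv j g x i =
        c * (γ j + 1 : ℕ) * E i (Function.update γ j (γ j + 1)) (diag x) := by
    intro γ c g hγ hg j x hx i
    have hder : HasDerivAt (fun t => g (Function.update x j t))
        (fun i => c * ((γ j + 1 : ℕ) * E i (Function.update γ j (γ j + 1)) (diag x))) (x j) := by
      rw [hasDerivAt_pi]
      intro i
      refine (((hE i).hasDerivAt hV hγ hx j).const_mul c).congr_of_eventuallyEq ?_
      filter_upwards [(hV j).mem_nhds (hx j)] with t ht
      refine hg _ (fun m => ?_) i
      by_cases hm : m = j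
      · subst hm; simpa using ht
      · simpa [Function.update_of_ne hm] using hx m
    rw [partialDeriv, hder.deriv, mul_assoc]
  have hiter : ∀ (γ : Fin d → ℕ) (c : F) (g : (Fin d → F) → Fin n → F) (j : Fin d) (m : ℕ),
      γ j = 0 → ∑ j, γ j + m ≤ k →
      (∀ x, (∀ j, x j ∈ V j) → ∀ i, g x i = c * E i γ (diag x)) → ∀ x,
      (∀ j, x j ∈ V j) → ∀ i, (partialDeriv j)^[m] g x i =
        c * (m.factorial : ℕ) * E i (Function.update γ j m) (diag x) := by
    intro γ c g j m hγj
    induction m with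
    | zero =>
      intro _ hg x hx i
      have : Function.update γ j 0 = γ := by rw [← hγj, Function.update_eq_self]
      simp [this, hg x hx i]
    | succ m ih =>
      intro hγ hg x hx i
      have hs : ∑ l, Function.update γ j m l + 1 ≤ k := by
        rw [Finset.sum_update_of_mem (Finset.mem_univ j), Finset.sdiff_singleton_eq_erase]
        rw [← Finset.add_sum_erase _ γ (Finset.mem_univ j), hγj] at hγ
        omega
      rw [Function.iterate_succ_apply', hpd _ _ _ hs (ih (by omega) hg) j x hx i]
      simp only [Function.update_self, Function.update_idem, Nat.factorial_succ]
      push_cast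
      ring
  have hlist : ∀ l : List (Fin d), l.Nodup → ∀ x, (∀ j, x j ∈ V j) → ∀ i,
      l.foldr (fun j g => (partialDeriv j)^[β j] g) f x i =
        ((l.map fun j => (β j).factorial).prod : ℕ) * E i (N l) (diag x) := by
    intro l
    induction l with
    | nil =>
      intro _ x hx i
      have h0 : N [] = fun _ => 0 := by ext j; simp [hN]
      have hb : ∀ j m, diag x j m ∈ V j := fun j _ => hx j
      have hnodes : (fun j => nodes (diag x j) 0 (0 : ℕ)) = fun j => {x j} := by
        ext j y; simp [nodes, diag]
      rw [h0, (hE i).eq_gridDiff _ (by simp) _ hb (fun j a ha b hb _ => by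
        simp only [Set.mem_Iic] at ha hb; omega), hnodes, gridDiff_singleton]
      simp
    | cons j l ih =>
      intro hnd x hx i
      rw [List.nodup_cons] at hnd
      have hNj : N l j = 0 := by simp [hN, hnd.1]
      have hupd : Function.update (N l) j (β j) = N (j :: l) := by
        ext m
        by_cases hm : m = j
        · subst hm; simp [hN]
        · simp [hN, hm]
      have hs : ∑ m, N l m + β j ≤ k := by
        refine le_trans ?_ hβ
        rw [← Finset.add_sum_erase _ β (Finset.mem_univ j),
          ← Finset.add_sum_erase _ (N l) (Finset.mem_univ j), hNj]
        have : ∑ m ∈ Finset.univ.erase j, N l m ≤ ∑ m ∈ Finset.univ.erase j, β m :=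
          Finset.sum_le_sum fun m _ => by simp only [hN]; split_ifs <;> omega
        omega
      rw [List.foldr_cons, hiter (N l) _ _ j (β j) hNj hs (ih hnd.2) x hx i, hupd]
      simp only [List.map_cons, List.prod_cons]
      push_cast
      ring
  have h := hlist (List.finRange d) (List.nodup_finRange d) x hx i
  have hNβ : N (List.finRange d) = β := by ext j; simp [hN]
  rw [hNβ] at h
  rw [multiPartialDeriv, h, ← List.ofFn_eq_map, List.prod_ofFn]

end UltrametricJets

/-! ### Jets -/

section Jets

variable {F : Type*} [NontriviallyNormedField F] {d n : ℕ}

/-- The divided differences of order `β` of `f`, `|β| ≤ k`, converge to `a β` when all the nodes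
tend to `x₀`. -/
def HasGridJet (k : ℕ) (f : (Fin d → F) → Fin n → F) (x₀ : Fin d → F)
    (a : (Fin d → ℕ) → Fin n → F) : Prop :=
  ∀ β : Fin d → ℕ, ∑ j, β j ≤ k → ∀ i, ∀ η > 0, ∃ r > 0, ∀ T : Fin d → Finset F,
    (∀ j, (T j).card = β j + 1) → (∀ j, ∀ y ∈ T j, ‖y - x₀ j‖ < r) →
      ‖gridDiff (fun x => f x i) T - a β i‖ < η

/-- No nontrivial combination of `f₁, …, fₙ` has vanishing coefficients `a β` for all
`1 ≤ |β| ≤ k`. -/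
def IsNondegenerateJet (k : ℕ) (a : (Fin d → ℕ) → Fin n → F) : Prop :=
  ∀ c : Fin n → F, c ≠ 0 → ∃ β : Fin d → ℕ, 1 ≤ ∑ j, β j ∧ ∑ j, β j ≤ k ∧ ∑ i, c i * a β i ≠ 0

/-- If the partial derivatives are the multiples `β! • a β` of the coefficients, then a combination
of `f₁, …, fₙ` with vanishing coefficients defines a linear form that vanishes on all of them. No
invertibility of `β!` is needed, so the characteristic of `F` plays no role. -/
theorem SpannedByPartials.isNondegenerateJet {k : ℕ} {f : (Fin d → F) → Fin n → F}
    {x₀ : Fin d → F} {a : (Fin d → ℕ) → Fin n → F} (h : SpannedByPartials k f x₀)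
    (ha : ∀ β : Fin d → ℕ, ∑ j, β j ≤ k → ∀ i,
      multiPartialDeriv β f x₀ i = (∏ j, (β j).factorial : ℕ) * a β i) :
    IsNondegenerateJet k a := by
  intro c hc
  by_contra! hcon
  apply hc
  set φ : (Fin n → F) →ₗ[F] F := ∑ i, c i • LinearMap.proj i with hφ
  have hφa : ∀ v, φ v = ∑ i, c i * v i := fun v => by simp [hφ]
  have hle : (⊤ : Submodule F (Fin n → F)) ≤ LinearMap.ker φ := by
    rw [← h, Submodule.span_le]
    rintro v ⟨β, h1, h2, rfl⟩
    simp only [SetLike.mem_coe, LinearMap.mem_ker, hφa, ha β h2]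
    have := hcon β h1 h2
    calc ∑ i, c i * ((∏ j, (β j).factorial : ℕ) * a β i)
        = (∏ j, (β j).factorial : ℕ) * ∑ i, c i * a β i := by
          rw [Finset.mul_sum]; exact Finset.sum_congr rfl fun i _ => by ring
      _ = 0 := by rw [this, mul_zero]
  ext i
  have := LinearMap.mem_ker.1 (hle (Submodule.mem_top (x := Pi.single i (1 : F))))
  rw [hφa] at this
  simpa [Pi.single_apply] using this

/-- An ultrametric `Cᵏ` map has a jet: its divided differences extend continuously to the diagonal,
and their diagonal values are the coefficients. -/
theorem UltraCkOn.exists_hasGridJet {k : ℕ} {f : (Fin d → F) → Fin n → F}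
    {W : Set (Fin d → F)} (hf : UltraCkOn k f W) {x₀ : Fin d → F} (hx₀ : x₀ ∈ W) :
    ∃ a, HasGridJet k f x₀ a ∧ (∀ β : Fin d → ℕ, ∑ j, β j ≤ k → ∀ i,
      multiPartialDeriv β f x₀ i = (∏ j, (β j).factorial : ℕ) * a β i) := by
  obtain ⟨V, hV, hxV, hVW, hfV⟩ := hf x₀ hx₀
  choose E hE using fun i => (hfV i).exists_isDiffExtension
  refine ⟨fun β i => E i β (diag x₀), ?_, fun β hβ i =>
    multiPartialDeriv_eq_diffExtension hE hV hβ hxV i⟩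
  intro β hβ i η hη
  -- Tuples indexed by a finite type, on which the topology is given by the maximum norm.
  set Ψ : (Fin d → Fin (k + 1) → F) → Fin d → ℕ → F := fun p j m =>
    p j ⟨min m k, by omega⟩ with hΨ
  have hΨc : Continuous Ψ := by fun_prop
  set p₀ : Fin d → Fin (k + 1) → F := fun j _ => x₀ j with hp₀
  have hΨp₀ : Ψ p₀ = diag x₀ := rfl
  obtain ⟨r₀, hr₀, hr₀V⟩ : ∃ r₀ > 0, ∀ j, Metric.ball (x₀ j) r₀ ⊆ V j := by
    have : Set.univ.pi V ∈ 𝓝 x₀ :=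
      (isOpen_set_pi Set.finite_univ fun j _ => hV j).mem_nhds fun j _ => hxV j
    obtain ⟨r₀, hr₀, h⟩ := Metric.mem_nhds_iff.1 this
    refine ⟨r₀, hr₀, fun j y hy => ?_⟩
    have h1 : Function.update x₀ j y ∈ Metric.ball x₀ r₀ := by
      rw [Metric.mem_ball, dist_pi_lt_iff hr₀]
      intro m
      by_cases hm : m = j
      · subst hm; simpa using hy
      · simpa [Function.update_of_ne hm] using hr₀
    simpa using h h1 j (Set.mem_univ j)
  have hcont : ContinuousWithinAt (fun p => E i β (Ψ p)) {p | ∀ j m, p j m ∈ V j} p₀ := by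
    have h1 := ((hE i).continuousOn β hβ) (diag x₀) fun j _ => hxV j
    rw [← hΨp₀] at h1
    exact h1.comp hΨc.continuousWithinAt fun p hp j m => hp j _
  obtain ⟨δ, hδ, h⟩ := Metric.continuousWithinAt_iff.1 hcont η hη
  refine ⟨min δ r₀, lt_min hδ hr₀, fun T hT hTr => ?_⟩
  set e : ∀ j, Fin (β j + 1) ≃ T j := fun j => ((T j).equivFinOfCardEq (hT j)).symm with he
  set p : Fin d → Fin (k + 1) → F := fun j m => e j ⟨min m (β j), by omega⟩ with hp
  have hβk : ∀ j, β j ≤ k := fun j =>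
    (Finset.single_le_sum (f := β) (fun _ _ => Nat.zero_le _) (Finset.mem_univ j)).trans hβ
  have hpV : ∀ j m, p j m ∈ V j := fun j m => hr₀V j <| by
    rw [Metric.mem_ball, dist_eq_norm]
    exact (hTr j _ (e j _).2).trans_le (min_le_right _ _)
  have hdist : dist p p₀ < δ := by
    rw [dist_pi_lt_iff hδ]
    intro j
    rw [dist_pi_lt_iff hδ]
    intro m
    rw [dist_eq_norm]
    exact (hTr j _ (e j _).2).trans_le (min_le_left _ _)
  have hval : ∀ j m (hm : m ≤ β j), Ψ p j m = e j ⟨m, by omega⟩ := by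
    intro j m hm
    have := hβk j
    simp only [hΨ, hp]
    congr 2
    simp
    omega
  have hinj : ∀ j, Set.InjOn (Ψ p j) (Set.Iic (β j)) := by
    intro j a ha b hb hab
    rw [hval j a ha, hval j b hb] at hab
    have := (e j).injective (Subtype.ext hab)
    simpa using this
  have hnodes : (fun j => nodes (Ψ p j) 0 (β j)) = T := by
    ext j y
    simp only [nodes, Finset.mem_image, Finset.mem_range, zero_add]
    constructor
    · rintro ⟨m, hm, rfl⟩
      rw [hval j m (by omega)]
      exact (e j _).2
    · intro hy
      refine ⟨((e j).symm ⟨y, hy⟩ : ℕ), ((e j).symm ⟨y, hy⟩).2, ?_⟩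
      rw [hval j _ (Nat.lt_succ_iff.1 ((e j).symm ⟨y, hy⟩).2)]
      simp
  have := h (x := p) hpV hdist
  rw [dist_eq_norm, (hE i).eq_gridDiff β hβ _ (fun j m => hpV j _) hinj, hnodes, hΨp₀] at this
  exact this

theorem UltraCkOn.continuousOn {k : ℕ} {f : (Fin d → F) → Fin n → F}
    {W : Set (Fin d → F)} (hf : UltraCkOn k f W) : ContinuousOn f W := by
  intro x hx
  obtain ⟨V, hV, hxV, hVW, hfV⟩ := hf x hx
  refine ContinuousAt.continuousWithinAt (continuousAt_pi.2 fun i => ?_)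
  obtain ⟨E, hE⟩ := (hfV i).exists_isDiffExtension
  have hbox : Set.univ.pi V ∈ 𝓝 x :=
    (isOpen_set_pi Set.finite_univ fun j _ => hV j).mem_nhds fun j _ => hxV j
  have hc : ContinuousAt (fun y => E (fun _ => 0) (diag y)) x := by
    have hd : Continuous (diag : (Fin d → F) → Fin d → ℕ → F) := by unfold diag; fun_prop
    refine ContinuousWithinAt.continuousAt (s := Set.univ.pi V) ?_ hbox
    exact (hE.continuousOn (fun _ => 0) (by simp) (diag x) fun j _ => hxV j).comp
      hd.continuousWithinAt fun y hy j _ => hy j (Set.mem_univ j)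
  refine hc.congr ?_
  filter_upwards [hbox] with y hy
  have hnodes : (fun j => nodes (diag y j) 0 (0 : ℕ)) = fun j => {y j} := by
    ext j z; simp [nodes, diag]
  rw [hE.eq_gridDiff _ (by simp) (diag y) (fun j _ => hy j (Set.mem_univ j))
    (fun j a ha b hb _ => by simp only [Set.mem_Iic] at ha hb; omega), hnodes, gridDiff_singleton]

end Jets

/-! ### The mean value theorem for divided differences on grids -/

section RealJets

variable {d n : ℕ}

/-- Rolle's theorem, iterated. -/
theorem exists_eq_zero_of_strictMono {s : Set ℝ} (hs : s.OrdConnected) (k : ℕ) (g : ℕ → ℝ → ℝ)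
    (hg : ∀ m < k, ∀ t ∈ s, HasDerivAt (g m) (g (m + 1) t) t) (t : Fin (k + 1) → ℝ)
    (ht : StrictMono t) (hts : ∀ i, t i ∈ s) (h0 : ∀ i, g 0 (t i) = 0) : ∃ ξ ∈ s, g k ξ = 0 := by
  induction k generalizing g with
  | zero => exact ⟨t 0, hts 0, h0 0⟩
  | succ k ih =>
    have hξ : ∀ i : Fin (k + 1), ∃ ξ ∈ Set.Ioo (t i.castSucc) (t i.succ), g 1 ξ = 0 := by
      intro i
      have hsub : Set.Icc (t i.castSucc) (t i.succ) ⊆ s := hs.out (hts _) (hts _)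
      have hd : ∀ x ∈ Set.Icc (t i.castSucc) (t i.succ), HasDerivAt (g 0) (g 1 x) x :=
        fun x hx => hg 0 (by omega) x (hsub hx)
      refine exists_hasDerivAt_eq_zero (ht (Fin.castSucc_lt_succ (i := i)))
        (fun x hx => (hd x hx).continuousAt.continuousWithinAt) (by rw [h0, h0])
        fun x hx => hd x (Set.Ioo_subset_Icc_self hx)
    choose ξ hξ hξ0 using hξ
    refine ih (fun m => g (m + 1)) (fun m hm => hg (m + 1) (by omega)) ξ ?_ (fun i =>
      hs.out (hts _) (hts _) (Set.Ioo_subset_Icc_self (hξ i))) hξ0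
    intro i j hij
    exact (hξ i).2.trans_le ((ht.monotone (by
      rw [Fin.le_def]; simp; exact hij)).trans (hξ j).1.le)

/-- The mean value theorem for divided differences. -/
theorem exists_divDiff_eq {s : Set ℝ} (hs : s.OrdConnected) {k : ℕ} (φ : ℕ → ℝ → ℝ)
    (hφ : ∀ m < k, ∀ t ∈ s, HasDerivAt (φ m) (φ (m + 1) t) t) {T : Finset ℝ}
    (hT : T.card = k + 1) (hTs : ∀ t ∈ T, t ∈ s) :
    ∃ ξ ∈ s, divDiff (φ 0) T = (k.factorial : ℝ)⁻¹ * φ k ξ := by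
  set p := Lagrange.interpolate T id (φ 0) with hp
  have hinj : Set.InjOn (id : ℝ → ℝ) T := Function.injective_id.injOn
  have hpe : ∀ t ∈ T, p.eval t = φ 0 t := fun t ht =>
    Lagrange.eval_interpolate_at_node (φ 0) hinj ht
  have hpk : ∀ x, (Polynomial.derivative^[k] p).eval x = k.factorial * divDiff (φ 0) T := by
    intro x
    rw [Lagrange.eval_iterate_derivative_eq_sum hinj (Lagrange.degree_interpolate_lt _ hinj)
      (by omega)]
    congr 1
    refine Finset.sum_congr rfl fun t ht => ?_
    · rw [hT]
      simp only [Nat.sub_self, Finset.powersetCard_zero, Finset.sum_singleton, Finset.prod_empty,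
        mul_one, id]
      rw [hpe t ht, div_eq_mul_inv, ← Finset.prod_inv_distrib]
  obtain ⟨ξ, hξ, h⟩ := exists_eq_zero_of_strictMono hs k
    (fun m t => φ m t - (Polynomial.derivative^[m] p).eval t)
    (fun m hm t ht => (hφ m hm t ht).sub (by
      rw [Function.iterate_succ_apply']; exact Polynomial.hasDerivAt _ _))
    (T.orderEmbOfFin hT) (T.orderEmbOfFin hT).strictMono
    (fun i => hTs _ (Finset.orderEmbOfFin_mem T hT i))
    (fun i => by simp [hpe _ (Finset.orderEmbOfFin_mem T hT i)])
  refine ⟨ξ, hξ, ?_⟩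
  rw [hpk] at h
  field_simp
  linarith

theorem hasDerivAt_partialDeriv {W : Set (Fin d → ℝ)} (hW : IsOpen W)
    {g : (Fin d → ℝ) → Fin n → ℝ} {m : ℕ} (hg : ContDiffOn ℝ (m + 1 : ℕ) g W) (j : Fin d)
    {x : Fin d → ℝ} (hx : x ∈ W) :
    HasDerivAt (fun t => g (Function.update x j t)) (partialDeriv j g x) (x j) ∧
      partialDeriv j g x = fderiv ℝ g x (Pi.single j 1) := by
  have hd : DifferentiableAt ℝ g x :=
    (hg.differentiableOn (by simp)).differentiableAt (hW.mem_nhds hx)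
  have hd' : HasFDerivAt g (fderiv ℝ g x) (Function.update x j (x j)) := by
    rw [Function.update_eq_self]; exact hd.hasFDerivAt
  have h := hd'.comp_hasDerivAt (x j) (hasDerivAt_update x j (x j))
  have he : partialDeriv j g x = fderiv ℝ g x (Pi.single j 1) := h.deriv
  exact ⟨by rw [he]; exact h, he⟩

theorem contDiffOn_partialDeriv {W : Set (Fin d → ℝ)} (hW : IsOpen W)
    {g : (Fin d → ℝ) → Fin n → ℝ} {m : ℕ} (hg : ContDiffOn ℝ (m + 1 : ℕ) g W) (j : Fin d) :
    ContDiffOn ℝ m (partialDeriv j g) W := by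
  have h : ContDiffOn ℝ m (fun x => fderiv ℝ g x (Pi.single j 1)) W :=
    (hg.fderiv_of_isOpen hW (m := m) (by simp)).clm_apply contDiffOn_const
  exact h.congr fun x hx => (hasDerivAt_partialDeriv hW hg j hx).2

theorem contDiffOn_iterate_partialDeriv {W : Set (Fin d → ℝ)} (hW : IsOpen W)
    {g : (Fin d → ℝ) → Fin n → ℝ} (j : Fin d) (m k : ℕ) (hg : ContDiffOn ℝ (k + m : ℕ) g W) :
    ContDiffOn ℝ k ((partialDeriv j)^[m] g) W := by
  induction m generalizing k with
  | zero => exact hg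
  | succ m ih =>
    rw [Function.iterate_succ_apply']
    exact contDiffOn_partialDeriv hW (ih (k + 1) (by rwa [add_right_comm])) j

/-- The mean value theorem in the variable `j` for divided differences on grids. -/
theorem exists_gridDiff_eq_update {I : Fin d → Set ℝ} (hI : ∀ j, (I j).OrdConnected)
    {W : Set (Fin d → ℝ)} (hW : IsOpen W) (hIW : Set.univ.pi I ⊆ W)
    {g : (Fin d → ℝ) → Fin n → ℝ} (j : Fin d) (m : ℕ) (hg : ContDiffOn ℝ m g W) (i : Fin n)
    {T : Fin d → Finset ℝ} (hT : ∀ j, ∀ y ∈ T j, y ∈ I j) (hTj : (T j).card = m + 1) :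
    ∃ ξ ∈ I j, gridDiff (fun x => g x i) T = (m.factorial : ℝ)⁻¹ *
      gridDiff (fun x => (partialDeriv j)^[m] g x i) (Function.update T j {ξ}) := by
  obtain ⟨s₀, hs₀⟩ : (T j).Nonempty := Finset.card_pos.1 (by omega)
  obtain ⟨w, hw⟩ := exists_gridDiff_eq_sum (Function.update T j {s₀})
  have h := exists_divDiff_eq (hI j) (k := m) (fun l t =>
    gridDiff (fun x => (partialDeriv j)^[l] g x i) (Function.update T j {t})) ?_ hTj (hT j)
  · rw [gridDiff_eq_divDiff_update _ T j]
    exact h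
  · intro l hl t ht
    have hsum : ∀ (h : (Fin d → ℝ) → ℝ) (t : ℝ), gridDiff h (Function.update T j {t}) =
        ∑ x ∈ Fintype.piFinset (Function.update T j {s₀}), w x * h (Function.update x j t) :=
      fun h t => by rw [gridDiff_update_singleton _ T j t s₀, hw]
    simp only [hsum]
    refine HasDerivAt.fun_sum fun x hx => HasDerivAt.const_mul _ ?_
    have hxW : Function.update x j t ∈ W := by
      refine hIW fun b _ => ?_
      by_cases hb : b = j
      · subst hb; simpa using ht
      · have := Fintype.mem_piFinset.1 hx b
        rw [Function.update_of_ne hb] at this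
        simpa [Function.update_of_ne hb] using hT b _ this
    have hc : ContDiffOn ℝ (m - l - 1 + 1 : ℕ) ((partialDeriv j)^[l] g) W :=
      contDiffOn_iterate_partialDeriv hW j l _ (by
        rwa [show m - l - 1 + 1 + l = m by omega])
    have := (hasDerivAt_partialDeriv hW hc j hxW).1
    rw [Function.update_self] at this
    simp only [Function.update_idem] at this
    rw [Function.iterate_succ_apply']
    exact hasDerivAt_pi.1 this i

theorem contDiffOn_foldr_partialDeriv {W : Set (Fin d → ℝ)} (hW : IsOpen W)
    {f : (Fin d → ℝ) → Fin n → ℝ} {k : ℕ} (hf : ContDiffOn ℝ k f W) (β : Fin d → ℕ)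
    (l : List (Fin d)) (hl : (l.map β).sum ≤ k) :
    ContDiffOn ℝ (k - (l.map β).sum : ℕ)
      (l.foldr (fun j g => (partialDeriv j)^[β j] g) f) W := by
  induction l with
  | nil => simpa using hf
  | cons j l ih =>
    simp only [List.map_cons, List.sum_cons] at hl
    have hc' : ContDiffOn ℝ (k - (β j + (l.map β).sum) + β j : ℕ)
        (l.foldr (fun j g => (partialDeriv j)^[β j] g) f) W := by
      rw [show k - (β j + (l.map β).sum) + β j = k - (l.map β).sum by omega]
      exact ih (by omega)
    simpa using contDiffOn_iterate_partialDeriv hW j (β j) _ hc'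

theorem continuousOn_multiPartialDeriv {W : Set (Fin d → ℝ)} (hW : IsOpen W)
    {f : (Fin d → ℝ) → Fin n → ℝ} {k : ℕ} (hf : ContDiffOn ℝ k f W) {β : Fin d → ℕ}
    (hβ : ∑ j, β j ≤ k) : ContinuousOn (multiPartialDeriv β f) W := by
  refine (contDiffOn_foldr_partialDeriv hW hf β (List.finRange d) ?_).continuousOn
  rwa [← List.ofFn_eq_map, List.sum_ofFn]

/-- The mean value theorem for divided differences on grids. -/
theorem exists_gridDiff_eq_multiPartialDeriv {I : Fin d → Set ℝ} (hI : ∀ j, (I j).OrdConnected)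
    {W : Set (Fin d → ℝ)} (hW : IsOpen W) (hIW : Set.univ.pi I ⊆ W)
    {f : (Fin d → ℝ) → Fin n → ℝ} {k : ℕ} (hf : ContDiffOn ℝ k f W) {β : Fin d → ℕ}
    (hβ : ∑ j, β j ≤ k) (i : Fin n) {T : Fin d → Finset ℝ} (hT : ∀ j, ∀ y ∈ T j, y ∈ I j)
    (hTc : ∀ j, (T j).card = β j + 1) :
    ∃ ξ ∈ Set.univ.pi I, gridDiff (fun x => f x i) T =
      ((∏ j, (β j).factorial : ℕ) : ℝ)⁻¹ * multiPartialDeriv β f ξ i := by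
  have key : ∀ l : List (Fin d), l.Nodup →
      ∃ T' : Fin d → Finset ℝ, (∀ j, ∀ y ∈ T' j, y ∈ I j) ∧ (∀ j ∈ l, ∃ ξ, T' j = {ξ}) ∧
        (∀ j ∉ l, T' j = T j) ∧ gridDiff (fun x => f x i) T =
          (((l.map fun j => (β j).factorial).prod : ℕ) : ℝ)⁻¹ *
            gridDiff (fun x => l.foldr (fun j g => (partialDeriv j)^[β j] g) f x i) T' := by
    intro l
    induction l with
    | nil => exact fun _ => ⟨T, hT, by simp, by simp, by simp⟩
    | cons j l ih =>
      intro hnd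
      have hsum : ((j :: l).map β).sum ≤ k := by
        refine le_trans ?_ hβ
        rw [← List.sum_toFinset β hnd]
        exact Finset.sum_le_sum_of_subset (Finset.subset_univ _)
      simp only [List.map_cons, List.sum_cons] at hsum
      rw [List.nodup_cons] at hnd
      obtain ⟨T', hT'I, hT'1, hT'2, hT'⟩ := ih hnd.2
      have hc := contDiffOn_foldr_partialDeriv hW hf β l (by omega)
      obtain ⟨ξ, hξ, h⟩ := exists_gridDiff_eq_update hI hW hIW j (β j)
        (hc.of_le (by exact_mod_cast (by omega : β j ≤ k - (l.map β).sum))) i hT'I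
        (by rw [hT'2 j hnd.1, hTc])
      refine ⟨Function.update T' j {ξ}, fun m y hy => ?_, fun m hm => ?_, fun m hm => ?_, ?_⟩
      · by_cases hmj : m = j
        · subst hmj
          rw [Function.update_self, Finset.mem_singleton] at hy
          rwa [hy]
        · rw [Function.update_of_ne hmj] at hy
          exact hT'I m y hy
      · by_cases hmj : m = j
        · subst hmj; exact ⟨ξ, Function.update_self ..⟩
        · rw [Function.update_of_ne hmj]
          exact hT'1 m ((List.mem_cons.1 hm).resolve_left hmj)
      · rw [List.mem_cons, not_or] at hm
        rw [Function.update_of_ne hm.1, hT'2 m hm.2]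
      · rw [hT', h]
        simp only [List.map_cons, List.prod_cons, List.foldr_cons]
        push_cast
        rw [mul_inv]
        ring
  obtain ⟨T', hT'I, hT'1, -, h⟩ := key (List.finRange d) (List.nodup_finRange d)
  choose ξ hξ using fun j => hT'1 j (List.mem_finRange j)
  obtain rfl : T' = fun j => {ξ j} := funext hξ
  refine ⟨ξ, fun j _ => hT'I j _ (by simp), ?_⟩
  rw [h, gridDiff_singleton, multiPartialDeriv, ← List.ofFn_eq_map, List.prod_ofFn]

/-- A real `Cᵏ` map has a jet, given by its Taylor coefficients: by the mean value theorem the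
divided differences are values of `∂_β f / β!` at intermediate points. -/
theorem exists_hasGridJet_of_contDiffOn {k : ℕ} {f : (Fin d → ℝ) → Fin n → ℝ}
    {W : Set (Fin d → ℝ)} (hW : IsOpen W) (hf : ContDiffOn ℝ k f W) {x₀ : Fin d → ℝ}
    (hx₀ : x₀ ∈ W) :
    ∃ a, HasGridJet k f x₀ a ∧ (∀ β : Fin d → ℕ, ∑ j, β j ≤ k → ∀ i,
      multiPartialDeriv β f x₀ i = (∏ j, (β j).factorial : ℕ) * a β i) := by
  have hfac : ∀ β : Fin d → ℕ, ((∏ j, (β j).factorial : ℕ) : ℝ) ≠ 0 := fun β =>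
    Nat.cast_ne_zero.2 (Finset.prod_ne_zero_iff.2 fun j _ => Nat.factorial_ne_zero _)
  refine ⟨fun β i => ((∏ j, (β j).factorial : ℕ) : ℝ)⁻¹ * multiPartialDeriv β f x₀ i, ?_,
    fun β _ i => by rw [mul_inv_cancel_left₀ (hfac β)]⟩
  intro β hβ i η hη
  have hc : ContinuousAt (fun x => ((∏ j, (β j).factorial : ℕ) : ℝ)⁻¹ *
      multiPartialDeriv β f x i) x₀ :=
    continuousAt_const.mul (continuousAt_pi.1
      ((continuousOn_multiPartialDeriv hW hf hβ).continuousAt (hW.mem_nhds hx₀)) i)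
  obtain ⟨r₁, hr₁, h₁⟩ := Metric.continuousAt_iff.1 hc η hη
  obtain ⟨r₂, hr₂, h₂⟩ := Metric.isOpen_iff.1 hW x₀ hx₀
  have hr : 0 < min r₁ r₂ := lt_min hr₁ hr₂
  refine ⟨min r₁ r₂, hr, fun T hT hTr => ?_⟩
  have hpi : Set.univ.pi (fun j => Metric.ball (x₀ j) (min r₁ r₂)) = Metric.ball x₀ (min r₁ r₂) :=
    (ball_pi x₀ hr).symm
  obtain ⟨ξ, hξ, h⟩ := exists_gridDiff_eq_multiPartialDeriv
    (I := fun j => Metric.ball (x₀ j) (min r₁ r₂))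
    (fun j => (convex_ball _ _).ordConnected) hW
    (hpi ▸ (Metric.ball_subset_ball (min_le_right _ _)).trans h₂) hf hβ i
    (fun j y hy => by rw [Metric.mem_ball, dist_eq_norm]; exact hTr j y hy) hT
  rw [hpi] at hξ
  rw [h, ← dist_eq_norm]
  exact h₁ (Metric.ball_subset_ball (min_le_left _ _) hξ)

end RealJets

/-! ### Separated points in large sets -/

section SeparatedPoints

/-- A set that is too large to be covered by `k` balls of radius `δ` contains `k + 1` points at
mutual distance at least `δ`. -/
theorem exists_separated {X : Type*} [PseudoMetricSpace X] [MeasurableSpace X] (ν : Measure X)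
    {S : Set X} {δ : ℝ} (hδ : 0 < δ) {c : ℝ≥0∞} (k : ℕ) (hc : ∀ x ∈ S, ν (Metric.ball x δ) ≤ c)
    (hS : k * c < ν S) :
    ∃ P : Finset X, P.card = k + 1 ∧ (∀ x ∈ P, x ∈ S) ∧
      ∀ x ∈ P, ∀ y ∈ P, x ≠ y → δ ≤ dist x y := by
  have key : ∀ m ≤ k + 1, ∃ P : Finset X, P.card = m ∧ (∀ x ∈ P, x ∈ S) ∧
      ∀ x ∈ P, ∀ y ∈ P, x ≠ y → δ ≤ dist x y := by
    intro m
    induction m with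
    | zero => exact fun _ => ⟨∅, by simp⟩
    | succ m ih =>
      intro hm
      obtain ⟨P, hPc, hPS, hPd⟩ := ih (by omega)
      have hlt : ν (⋃ x ∈ P, Metric.ball x δ) < ν S := by
        refine (measure_biUnion_finset_le _ _).trans_lt (lt_of_le_of_lt ?_ hS)
        refine (Finset.sum_le_sum fun x hx => hc x (hPS x hx)).trans ?_
        rw [Finset.sum_const, nsmul_eq_mul, hPc]
        gcongr
        omega
      obtain ⟨y, hyS, hy⟩ : ∃ y ∈ S, y ∉ ⋃ x ∈ P, Metric.ball x δ := by
        by_contra! h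
        exact hlt.not_ge (measure_mono h)
      have hyd : ∀ x ∈ P, δ ≤ dist y x := by
        intro x hx
        by_contra! h
        exact hy (Set.mem_biUnion hx h)
      have hyP : y ∉ P := fun h => by
        have := hyd y h
        rw [dist_self] at this
        exact this.not_gt hδ
      refine ⟨insert y P, by rw [Finset.card_insert_of_notMem hyP, hPc], ?_, ?_⟩
      · intro x hx
        rcases Finset.mem_insert.1 hx with rfl | hx
        exacts [hyS, hPS x hx]
      · intro a ha b hb hab
        rcases Finset.mem_insert.1 ha with rfl | ha' <;>
          rcases Finset.mem_insert.1 hb with rfl | hb'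
        · exact absurd rfl hab
        · exact hyd b hb'
        · rw [dist_comm]; exact hyd a ha'
        · exact hPd a ha' b hb' hab
  exact key (k + 1) le_rfl

end SeparatedPoints

/-! ### Interpolation at separated points -/

section Interpolation

variable {F : Type*}

/-- Newton's form of the interpolation error: the value at `y` is recovered from the values at the
nodes and from the divided difference. -/
theorem eq_divDiff_mul_add_sum [Field F] (h : F → F) {T : Finset F} {y : F} (hy : y ∉ T) :
    h y = divDiff h (insert y T) * ∏ x ∈ T, (y - x) +
      ∑ x ∈ T, h x * ∏ z ∈ T.erase x, ((y - z) * (x - z)⁻¹) := by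
  have hne : ∀ x ∈ T, y - x ≠ 0 := fun x hx => sub_ne_zero.2 fun h => hy (h ▸ hx)
  have hprod : ∏ x ∈ T, (y - x) ≠ 0 := Finset.prod_ne_zero_iff.2 hne
  rw [divDiff, Finset.sum_insert hy, Finset.erase_insert hy, add_mul, Finset.prod_inv_distrib,
    inv_mul_cancel_right₀ hprod, Finset.sum_mul, add_assoc, ← Finset.sum_add_distrib,
    Finset.sum_eq_zero, add_zero]
  intro x hx
  have hxy : y ≠ x := fun h => hy (h ▸ hx)
  have hyx : y ∉ T.erase x := fun h => hy (Finset.mem_of_mem_erase h)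
  rw [Finset.erase_insert_of_ne hxy, Finset.prod_insert hyx, Finset.prod_mul_distrib,
    ← Finset.mul_prod_erase T _ hx]
  have h1 : x - y ≠ 0 := sub_ne_zero.2 hxy.symm
  have h2 : (x - y)⁻¹ * (y - x) = -1 := by
    rw [← neg_sub x y, mul_neg, inv_mul_cancel₀ h1]
  linear_combination (h x * (∏ z ∈ T.erase x, (x - z)⁻¹) * ∏ z ∈ T.erase x, (y - z)) * h2

/-- All divided differences of order `k` of `h` at points of `B` are comparable to `p`. -/
def IsNearlyConstDivDiff [NormedField F] (k : ℕ) (h : F → F) (B : Set F) (p : F) : Prop :=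
  ∀ T : Finset F, T.card = k + 1 → (∀ x ∈ T, x ∈ B) → ‖divDiff h T - p‖ < ‖p‖ / 2

variable [NormedField F] {k : ℕ} {h : F → F} {B : Set F} {p : F} {ρ δ ε : ℝ} {T : Finset F}

theorem norm_divDiff_term_lt (hδ : 0 < δ)
    (hT : T.card = k + 1) (hTd : ∀ x ∈ T, ∀ y ∈ T, x ≠ y → δ ≤ ‖x - y‖) (hTh : ∀ x ∈ T, ‖h x‖ < ε)
    {x : F} (hx : x ∈ T) : ‖h x * ∏ y ∈ T.erase x, (x - y)⁻¹‖ < ε / δ ^ k := by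
  have hc : (T.erase x).card = k := by rw [Finset.card_erase_of_mem hx, hT]; rfl
  rw [norm_mul, norm_prod, div_eq_mul_inv]
  have h1 : ∏ y ∈ T.erase x, ‖(x - y)⁻¹‖ ≤ (δ ^ k)⁻¹ := by
    rw [← inv_pow, ← hc, ← Finset.prod_const]
    refine Finset.prod_le_prod (fun _ _ => norm_nonneg _) fun y hy => ?_
    rw [norm_inv]
    exact inv_anti₀ hδ (hTd x hx y (Finset.mem_of_mem_erase hy) (Finset.ne_of_mem_erase hy).symm)
  calc _ ≤ ‖h x‖ * (δ ^ k)⁻¹ := by gcongr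
    _ < ε * (δ ^ k)⁻¹ := by
      have := hTh x hx
      gcongr

theorem norm_interpolation_term_lt (hδ : 0 < δ) (hδρ : δ ≤ ρ) (hk : T.card ≤ k + 1)
    (hTd : ∀ x ∈ T, ∀ y ∈ T, x ≠ y → δ ≤ ‖x - y‖) (hTh : ∀ x ∈ T, ‖h x‖ < ε)
    {y : F} (hy : ∀ x ∈ T, ‖y - x‖ ≤ ρ) {x : F} (hx : x ∈ T) :
    ‖h x * ∏ z ∈ T.erase x, ((y - z) * (x - z)⁻¹)‖ < ε * (ρ / δ) ^ k := by
  have hc : (T.erase x).card ≤ k := by rw [Finset.card_erase_of_mem hx]; omega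
  have h1 : 1 ≤ ρ / δ := (one_le_div hδ).2 hδρ
  rw [norm_mul, norm_prod]
  have h2 : ∏ z ∈ T.erase x, ‖(y - z) * (x - z)⁻¹‖ ≤ (ρ / δ) ^ k := by
    refine le_trans ?_ (pow_le_pow_right₀ h1 hc)
    rw [← Finset.prod_const]
    refine Finset.prod_le_prod (fun _ _ => norm_nonneg _) fun z hz => ?_
    rw [norm_mul, norm_inv, div_eq_mul_inv]
    exact mul_le_mul (hy z (Finset.mem_of_mem_erase hz))
      (inv_anti₀ hδ (hTd x hx z (Finset.mem_of_mem_erase hz) (Finset.ne_of_mem_erase hz).symm))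
      (by positivity) (hδ.le.trans hδρ)
  calc _ ≤ ‖h x‖ * (ρ / δ) ^ k := by gcongr
    _ < ε * (ρ / δ) ^ k := by
      have := hTh x hx
      gcongr

theorem norm_mul_prod_le (D : F) (hD : ‖D‖ ≤ ε / δ ^ k) (hT : T.card = k) {y : F}
    (hy : ∀ x ∈ T, ‖y - x‖ ≤ ρ) : ‖D * ∏ x ∈ T, (y - x)‖ ≤ ε * (ρ / δ) ^ k := by
  rw [norm_mul, norm_prod, div_pow, mul_div_assoc', mul_div_right_comm]
  have h1 : ∏ x ∈ T, ‖y - x‖ ≤ ρ ^ k := by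
    rw [← hT, ← Finset.prod_const]
    exact Finset.prod_le_prod (fun _ _ => norm_nonneg _) hy
  exact mul_le_mul hD h1 (Finset.prod_nonneg fun _ _ => norm_nonneg _) ((norm_nonneg _).trans hD)

/-- A function with nearly constant divided differences which is small at `k + 1` separated points
is small everywhere. -/
theorem IsNearlyConstDivDiff.norm_lt (hh : IsNearlyConstDivDiff k h B p) (hk : 1 ≤ k)
    (hB : ∀ x ∈ B, ∀ y ∈ B, ‖x - y‖ ≤ ρ) (hδ : 0 < δ) (hT : T.card = k + 1)
    (hTB : ∀ x ∈ T, x ∈ B) (hTd : ∀ x ∈ T, ∀ y ∈ T, x ≠ y → δ ≤ ‖x - y‖)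
    (hTh : ∀ x ∈ T, ‖h x‖ < ε) {y : F} (hy : y ∈ B) :
    ‖h y‖ < (4 * k + 3 : ℕ) * ε * (ρ / δ) ^ k := by
  obtain ⟨a, ha, b, hb, hab⟩ := Finset.one_lt_card.1 (show 1 < T.card by omega)
  have hε : 0 < ε := (norm_nonneg _).trans_lt (hTh a ha)
  have hδρ : δ ≤ ρ := (hTd a ha b hb hab).trans (hB a (hTB a ha) b (hTB b hb))
  have h1 : 1 ≤ ρ / δ := (one_le_div hδ).2 hδρ
  have hpos : 0 < ε * (ρ / δ) ^ k := by positivity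
  by_cases hyT : y ∈ T
  · calc ‖h y‖ < ε * 1 := by rw [mul_one]; exact hTh y hyT
      _ ≤ ε * (ρ / δ) ^ k := by gcongr; exact one_le_pow₀ h1
      _ ≤ (4 * k + 3 : ℕ) * (ε * (ρ / δ) ^ k) := by
        refine le_mul_of_one_le_left hpos.le ?_
        exact_mod_cast (by omega : 1 ≤ 4 * k + 3)
      _ = _ := by ring
  set T₀ := T.erase a with hT₀
  have hT₀T : ∀ x ∈ T₀, x ∈ T := fun x hx => Finset.mem_of_mem_erase hx
  have hT₀c : T₀.card = k := by rw [hT₀, Finset.card_erase_of_mem ha, hT]; rfl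
  have hyT₀ : y ∉ T₀ := fun h => hyT (hT₀T y h)
  have hyρ : ∀ x ∈ T₀, ‖y - x‖ ≤ ρ := fun x hx => hB y hy x (hTB x (hT₀T x hx))
  have hD : ‖divDiff h T‖ ≤ (k + 1 : ℕ) * (ε / δ ^ k) := by
    refine (norm_sum_le _ _).trans ?_
    rw [← hT, ← nsmul_eq_mul]
    exact Finset.sum_le_card_nsmul _ _ _ fun x hx =>
      (norm_divDiff_term_lt hδ hT hTd hTh hx).le
  have hD' : ‖divDiff h (insert y T₀)‖ ≤ 3 * ‖divDiff h T‖ := by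
    have e1 := hh T hT hTB
    have e2 := hh (insert y T₀) (by rw [Finset.card_insert_of_notMem hyT₀, hT₀c]) (by
      intro x hx
      rcases Finset.mem_insert.1 hx with rfl | hx
      exacts [hy, hTB x (hT₀T x hx)])
    have e3 := norm_sub_norm_le (divDiff h (insert y T₀)) p
    have e4 := norm_sub_norm_le p (divDiff h T)
    rw [norm_sub_rev p] at e4
    linarith
  have hmain : ‖divDiff h (insert y T₀) * ∏ x ∈ T₀, (y - x)‖ ≤
      (3 * (k + 1 : ℕ) * ε) * (ρ / δ) ^ k := by
    refine norm_mul_prod_le _ ?_ hT₀c hyρ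
    calc _ ≤ 3 * ((k + 1 : ℕ) * (ε / δ ^ k)) := hD'.trans (by gcongr)
      _ = _ := by ring
  have hsum : ‖∑ x ∈ T₀, h x * ∏ z ∈ T₀.erase x, ((y - z) * (x - z)⁻¹)‖ <
      k * (ε * (ρ / δ) ^ k) := by
    refine (norm_sum_le _ _).trans_lt ?_
    rw [← hT₀c, ← nsmul_eq_mul, ← Finset.sum_const]
    refine Finset.sum_lt_sum_of_nonempty (Finset.card_pos.1 (by omega)) fun x hx => ?_
    rw [hT₀c]
    exact norm_interpolation_term_lt hδ hδρ (by omega)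
      (fun x hx y hy => hTd x (hT₀T x hx) y (hT₀T y hy)) (fun x hx => hTh x (hT₀T x hx)) hyρ hx
  rw [eq_divDiff_mul_add_sum h hyT₀]
  calc _ < (3 * (k + 1 : ℕ) * ε) * (ρ / δ) ^ k + k * (ε * (ρ / δ) ^ k) :=
        (norm_add_le _ _).trans_lt (add_lt_add_of_le_of_lt hmain hsum)
    _ = _ := by push_cast; ring

/-- The ultrametric version of `IsNearlyConstDivDiff.norm_lt`, with the sharp constant `1`. -/
theorem IsNearlyConstDivDiff.norm_lt_of_ultrametric [IsUltrametricDist F]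
    (hh : IsNearlyConstDivDiff k h B p) (hk : 1 ≤ k)
    (hB : ∀ x ∈ B, ∀ y ∈ B, ‖x - y‖ ≤ ρ) (hδ : 0 < δ) (hT : T.card = k + 1)
    (hTB : ∀ x ∈ T, x ∈ B) (hTd : ∀ x ∈ T, ∀ y ∈ T, x ≠ y → δ ≤ ‖x - y‖)
    (hTh : ∀ x ∈ T, ‖h x‖ < ε) {y : F} (hy : y ∈ B) :
    ‖h y‖ < ε * (ρ / δ) ^ k := by
  obtain ⟨a, ha, b, hb, hab⟩ := Finset.one_lt_card.1 (show 1 < T.card by omega)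
  have hε : 0 < ε := (norm_nonneg _).trans_lt (hTh a ha)
  have hδρ : δ ≤ ρ := (hTd a ha b hb hab).trans (hB a (hTB a ha) b (hTB b hb))
  have h1 : 1 ≤ ρ / δ := (one_le_div hδ).2 hδρ
  by_cases hyT : y ∈ T
  · calc ‖h y‖ < ε * 1 := by rw [mul_one]; exact hTh y hyT
      _ ≤ ε * (ρ / δ) ^ k := by gcongr; exact one_le_pow₀ h1
  set T₀ := T.erase a with hT₀
  have hT₀T : ∀ x ∈ T₀, x ∈ T := fun x hx => Finset.mem_of_mem_erase hx
  have hT₀c : T₀.card = k := by rw [hT₀, Finset.card_erase_of_mem ha, hT]; rfl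
  have hyT₀ : y ∉ T₀ := fun h => hyT (hT₀T y h)
  have hyρ : ∀ x ∈ T₀, ‖y - x‖ ≤ ρ := fun x hx => hB y hy x (hTB x (hT₀T x hx))
  -- In an ultrametric field, nearly constant norm means constant norm.
  have hconst : ∀ S : Finset F, S.card = k + 1 → (∀ x ∈ S, x ∈ B) → ‖divDiff h S‖ = ‖p‖ := by
    intro S hS hSB
    have := hh S hS hSB
    have hlt : ‖divDiff h S - p‖ < ‖p‖ := by linarith [norm_nonneg p]
    have := IsUltrametricDist.norm_add_eq_max_of_norm_ne_norm hlt.ne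
    rwa [sub_add_cancel, max_eq_right hlt.le] at this
  have hsup : ∀ (S : Finset F) (u : F → F) (c : ℝ), S.Nonempty → (∀ x ∈ S, ‖u x‖ < c) →
      ‖∑ x ∈ S, u x‖ < c := by
    intro S u c hS hu
    obtain ⟨x, hx, hle⟩ := IsUltrametricDist.exists_norm_finsetSum_le_of_nonempty hS u
    exact hle.trans_lt (hu x hx)
  have hD : ‖divDiff h T‖ < ε / δ ^ k :=
    hsup T _ _ ⟨a, ha⟩ fun x hx => norm_divDiff_term_lt hδ hT hTd hTh hx
  have hD' : ‖divDiff h (insert y T₀)‖ = ‖divDiff h T‖ := by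
    rw [hconst T hT hTB, hconst _ (by rw [Finset.card_insert_of_notMem hyT₀, hT₀c])]
    intro x hx
    rcases Finset.mem_insert.1 hx with rfl | hx
    exacts [hy, hTB x (hT₀T x hx)]
  have hmain : ‖divDiff h (insert y T₀) * ∏ x ∈ T₀, (y - x)‖ < ε * (ρ / δ) ^ k := by
    have := norm_mul_prod_le (δ := δ) (k := k) (T := T₀) (ε := ‖divDiff h T‖ * δ ^ k)
      (divDiff h (insert y T₀)) (by rw [hD', mul_div_cancel_right₀ _ (by positivity)]) hT₀c hyρ
    refine this.trans_lt ?_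
    rw [lt_div_iff₀ (by positivity)] at hD
    gcongr
  have hsum : ‖∑ x ∈ T₀, h x * ∏ z ∈ T₀.erase x, ((y - z) * (x - z)⁻¹)‖ < ε * (ρ / δ) ^ k :=
    hsup _ _ _ (Finset.card_pos.1 (by omega)) fun x hx =>
      norm_interpolation_term_lt hδ hδρ (by omega)
        (fun x hx y hy => hTd x (hT₀T x hx) y (hT₀T y hy)) (fun x hx => hTh x (hT₀T x hx)) hyρ hx
  rw [eq_divDiff_mul_add_sum h hyT₀]
  exact (IsUltrametricDist.norm_add_le_max _ _).trans_lt (max_lt hmain hsum)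

end Interpolation

/-! ### Sublevel bounds -/

section Sublevel

/-- The sublevel sets of `h` in `B` are small relative to every value of `h` on `B`. This is the
estimate that defines `(C, α)`-good functions, on a single set `B` and with the supremum of `|h|`
replaced by an arbitrary value. -/
def SublevelBound {X F : Type*} [MeasurableSpace X] [NormedField F] (ν : Measure X) (B : Set X)
    (h : X → F) (C α : ℝ) : Prop :=
  ∀ y ∈ B, h y ≠ 0 → ∀ ε : ℝ, 0 < ε →
    ν {x ∈ B | ‖h x‖ < ε} ≤ ENNReal.ofReal (C * (ε / ‖h y‖) ^ α) * ν B

/-- A sublevel bound in one variable. The hypothesis `hsep` says that `h` is small on all of `B`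
once it is small at `k + 1` separated points. If a sublevel set were too large, it would contain
such points, at a distance for which the conclusion of `hsep` fails at `y`. -/
theorem SublevelBound.of_separated {F : Type*} [NormedField F] [MeasurableSpace F] {ν : Measure F}
    {B : Set F} {h : F → F} {k : ℕ} (hk : 1 ≤ k) {K M s ρ : ℝ} (hK : 0 < K)
    (hρ : 0 < ρ)
    (hν : ∀ x, ∀ δ > 0, ν (Metric.ball x δ) ≤ ENNReal.ofReal (M * (δ / ρ) ^ s) * ν B)
    (hsep : ∀ δ > 0, ∀ ε > 0, ∀ T : Finset F, T.card = k + 1 → (∀ x ∈ T, x ∈ B) →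
      (∀ x ∈ T, ∀ y ∈ T, x ≠ y → δ ≤ ‖x - y‖) → (∀ x ∈ T, ‖h x‖ < ε) →
      ∀ y ∈ B, ‖h y‖ < K * ε * (ρ / δ) ^ k) :
    SublevelBound ν B h (k * M * K ^ (s / k)) (s / k) := by
  intro y hy hy0 ε hε
  by_contra! hlt
  have hk0 : (k : ℝ) ≠ 0 := by positivity
  -- The separation at which the bound of `hsep` at `y` is an equality.
  set δ : ℝ := ρ * (K * ε / ‖h y‖) ^ (1 / (k : ℝ)) with hδ
  have hδ0 : 0 < δ := by positivity
  have hδρ : (δ / ρ) ^ s = K ^ (s / k) * (ε / ‖h y‖) ^ (s / k) := by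
    rw [hδ, mul_div_cancel_left₀ _ hρ.ne', ← Real.rpow_mul (by positivity),
      ← Real.mul_rpow hK.le (by positivity)]
    congr 1
    · ring
    · ring
  obtain ⟨T, hT, hTS, hTd⟩ := exists_separated ν hδ0 k (fun x _ => hν x δ hδ0)
    (S := {x ∈ B | ‖h x‖ < ε}) (by
      refine lt_of_le_of_lt (le_of_eq ?_) hlt
      rw [hδρ, ← mul_assoc, ← ENNReal.ofReal_natCast, ← ENNReal.ofReal_mul (by positivity)]
      congr 2
      ring)
  have := hsep δ hδ0 ε hε T hT (fun x hx => (hTS x hx).1)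
    (fun x hx y hy hxy => by rw [← dist_eq_norm]; exact hTd x hx y hy hxy)
    (fun x hx => (hTS x hx).2) y hy
  refine this.ne' ?_
  have h1 : ρ / δ = ((K * ε / ‖h y‖) ^ (1 / (k : ℝ)))⁻¹ := by
    rw [hδ, ← div_div, div_self hρ.ne', one_div]
  rw [h1, inv_pow, ← Real.rpow_natCast, ← Real.rpow_mul (by positivity), one_div,
    inv_mul_cancel₀ hk0, Real.rpow_one, inv_div]
  field_simp

/-- Passing from arbitrary values to the supremum. -/
theorem measure_sublevel_le_of_sublevelBound {X F : Type*} [MeasurableSpace X] [NormedField F]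
    {ν : Measure X} {B' : Set X} {h : X → F} {C α : ℝ}
    (hC : 0 < C) (hα : 0 < α) {D : ℝ≥0∞} (hD : D ≠ ∞) {S : Set X} {ε : ℝ} (hε : 0 < ε)
    (hb : ∀ y ∈ B', h y ≠ 0 → ν S ≤ ENNReal.ofReal (C * (ε / ‖h y‖) ^ α) * D)
    (hSD : ν S ≤ D) :
    ν S ≤ ENNReal.ofReal C * (ENNReal.ofReal ε / ⨆ y ∈ B', ‖h y‖ₑ) ^ α * D := by
  set s : ℝ≥0∞ := ⨆ y ∈ B', ‖h y‖ₑ with hs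
  have hC' : ENNReal.ofReal C ≠ 0 := by simpa using hC
  have hε' : ENNReal.ofReal ε ≠ 0 := by simpa using hε
  rcases eq_or_ne (ν S) 0 with h0 | h0
  · rw [h0]; exact zero_le
  have hD0 : D ≠ 0 := fun h => h0 (le_antisymm (h ▸ hSD) zero_le)
  have hSt : ν S ≠ ∞ := ne_top_of_le_ne_top hD hSD
  rcases eq_or_ne s 0 with hs0 | hs0
  · rw [hs0, ENNReal.div_zero hε', ENNReal.top_rpow_of_pos hα, ENNReal.mul_top hC',
      ENNReal.top_mul hD0]
    exact le_top
  set N : ℝ≥0∞ := ENNReal.ofReal C * ENNReal.ofReal ε ^ α * D with hN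
  have hNt : N ≠ ∞ := by
    refine ENNReal.mul_ne_top (ENNReal.mul_ne_top ENNReal.ofReal_ne_top ?_) hD
    exact ENNReal.rpow_ne_top_of_nonneg hα.le ENNReal.ofReal_ne_top
  have hval : ∀ y ∈ B', ‖h y‖ₑ ≤ (N / ν S) ^ α⁻¹ := by
    intro y hy
    rw [ENNReal.le_rpow_inv_iff hα, ENNReal.le_div_iff_mul_le (Or.inl h0) (Or.inl hSt)]
    rcases eq_or_ne (h y) 0 with hy0 | hy0
    · simp [hy0, ENNReal.zero_rpow_of_pos hα]
    have hyp : 0 < ‖h y‖ := norm_pos_iff.2 hy0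
    calc ‖h y‖ₑ ^ α * ν S ≤ ‖h y‖ₑ ^ α * (ENNReal.ofReal (C * (ε / ‖h y‖) ^ α) * D) := by
          gcongr; exact hb y hy hy0
      _ = N := by
          rw [← ofReal_norm, ENNReal.ofReal_rpow_of_pos hyp, hN,
            ENNReal.ofReal_rpow_of_pos hε, ← mul_assoc, ← ENNReal.ofReal_mul (by positivity),
            ← ENNReal.ofReal_mul hC.le]
          congr 2
          rw [Real.div_rpow hε.le hyp.le]
          field_simp
  have hsα : s ^ α * ν S ≤ N := by
    have : s ≤ (N / ν S) ^ α⁻¹ := iSup₂_le hval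
    rwa [ENNReal.le_rpow_inv_iff hα, ENNReal.le_div_iff_mul_le (Or.inl h0) (Or.inl hSt)] at this
  have hst : s ^ α ≠ ∞ := by
    intro h
    rw [h, ENNReal.top_mul h0] at hsα
    exact hNt (top_le_iff.1 hsα)
  have hs0' : s ^ α ≠ 0 := by
    rw [Ne, ENNReal.rpow_eq_zero_iff]
    simp [hs0, hα.le.not_gt]
  rw [ENNReal.div_rpow_of_nonneg _ _ hα.le]
  calc ν S ≤ N / s ^ α := by
        rw [ENNReal.le_div_iff_mul_le (Or.inl hs0') (Or.inl hst), mul_comm]; exact hsα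
    _ = _ := by rw [hN]; simp only [div_eq_mul_inv]; ring

/-- Weakening the constants of a sublevel bound. -/
theorem SublevelBound.mono {X F : Type*} [MeasurableSpace X] [NormedField F] {ν : Measure X}
    {B : Set X} {h : X → F} {C C' α α' : ℝ} (hb : SublevelBound ν B h C α) (hC : C ≤ C')
    (hC' : 1 ≤ C') (hα' : 0 ≤ α') (hα : α' ≤ α) : SublevelBound ν B h C' α' := by
  intro y hy hy0 ε hε
  have hq : 0 < ε / ‖h y‖ := by positivity
  rcases le_total (ε / ‖h y‖) 1 with h1 | h1
  · refine (hb y hy hy0 ε hε).trans ?_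
    have : C * (ε / ‖h y‖) ^ α ≤ C' * (ε / ‖h y‖) ^ α' :=
      mul_le_mul hC (Real.rpow_le_rpow_of_exponent_ge hq h1 hα) (by positivity) (by linarith)
    gcongr
  · have h2 : (1 : ℝ≥0∞) ≤ ENNReal.ofReal (C' * (ε / ‖h y‖) ^ α') := by
      rw [← ENNReal.ofReal_one]
      exact ENNReal.ofReal_le_ofReal (one_le_mul_of_one_le_of_one_le hC'
        (Real.one_le_rpow h1 hα'))
    calc ν {x ∈ B | ‖h x‖ < ε} ≤ 1 * ν B := by
          rw [one_mul]; exact measure_mono fun x hx => hx.1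
      _ ≤ _ := by gcongr

end Sublevel

/-! ### The growth of balls in a local field -/

section BallGrowth

variable {F : Type*} [NontriviallyNormedField F] [IsUltrametricDist F]

/-- The number of elements of the residue class field. -/
noncomputable def residueCard (F : Type*) [NontriviallyNormedField F] [IsUltrametricDist F] : ℕ :=
  letI : Valued F NNReal := NormedField.toValued
  Nat.card 𝓀[F]

/-- Representatives of the residue classes. -/
theorem exists_residue_representatives [LocallyCompactSpace F] :
    2 ≤ residueCard F ∧ ∃ t : Fin (residueCard F) → F, (∀ i, ‖t i‖ ≤ 1) ∧
      (∀ i j, i ≠ j → 1 ≤ ‖t i - t j‖) ∧ ∀ x : F, ‖x‖ ≤ 1 → ∃ i, ‖x - t i‖ < 1 := by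
  let _ : Valued F NNReal := NormedField.toValued
  have : ProperSpace F := ProperSpace.of_locallyCompactSpace F
  have hmem : ∀ x : F, x ∈ 𝒪[F] ↔ ‖x‖ ≤ 1 := fun x => Iff.rfl
  have hres : ∀ a b : 𝒪[F], IsLocalRing.residue 𝒪[F] a = IsLocalRing.residue 𝒪[F] b ↔
      ‖(a : F) - b‖ < 1 := by
    intro a b
    rw [← sub_eq_zero, ← map_sub, IsLocalRing.residue_eq_zero_iff, IsLocalRing.mem_maximalIdeal,
      mem_nonunits_iff]
    have := Valuation.Integer.not_isUnit_iff_valuation_lt_one (v := (Valued.v : Valuation F NNReal))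
      (x := a - b)
    exact this
  choose τ hτ using IsLocalRing.residue_surjective (R := 𝒪[F])
  have hsep : ∀ i j : 𝓀[F], i ≠ j → 1 ≤ ‖(τ i : F) - τ j‖ := by
    intro i j hij
    by_contra! h
    exact hij (by rw [← hτ i, ← hτ j]; exact (hres _ _).2 h)
  have hcov : ∀ x : F, ‖x‖ ≤ 1 → ∃ i, ‖x - τ i‖ < 1 := fun x hx =>
    ⟨IsLocalRing.residue 𝒪[F] ⟨x, hx⟩, (hres ⟨x, hx⟩ _).1 (hτ _).symm⟩
  have : Finite 𝓀[F] := by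
    obtain ⟨Z, -, hZ, hZc⟩ :=
      (isCompact_closedBall (0 : F) 1).finite_cover_balls (e := 1) one_pos
    have hc : ∀ i : 𝓀[F], ∃ z ∈ Z, ‖(τ i : F) - z‖ < 1 := by
      intro i
      have : (τ i : F) ∈ Metric.closedBall (0 : F) 1 := by
        rw [mem_closedBall_zero_iff]; exact (hmem _).1 (τ i).2
      obtain ⟨z, hz, h⟩ := Set.mem_iUnion₂.1 (hZc this)
      exact ⟨z, hz, by rwa [Metric.mem_ball, dist_eq_norm] at h⟩
    choose z hz hzn using hc
    have := hZ.to_subtype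
    refine Finite.of_injective (fun i => (⟨z i, hz i⟩ : Z)) fun i j hij => ?_
    by_contra hne
    refine (hsep i j hne).not_gt ?_
    have e : (τ i : F) - τ j = ((τ i : F) - z i) + (z j - τ j) := by
      rw [show z i = z j from congrArg Subtype.val hij]; ring
    rw [e]
    refine (IsUltrametricDist.norm_add_le_max _ _).trans_lt (max_lt (hzn i) ?_)
    rw [norm_sub_rev]; exact hzn j
  have hcard : residueCard F = Nat.card 𝓀[F] := rfl
  refine ⟨by rw [hcard]; exact Finite.one_lt_card, ?_⟩
  set e : 𝓀[F] ≃ Fin (Nat.card 𝓀[F]) := Finite.equivFin _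
  refine ⟨fun i => τ (e.symm i), fun i => (hmem _).1 (τ _).2,
    fun i j hij => hsep _ _ (e.symm.injective.ne hij), fun x hx => ?_⟩
  obtain ⟨i, hi⟩ := hcov x hx
  exact ⟨e i, by simpa using hi⟩

/-- A closed ball is the disjoint union of `q` open balls of the same radius. -/
theorem measure_closedBall_eq_mul [LocallyCompactSpace F] [MeasurableSpace F] [BorelSpace F]
    (ν : Measure F) [ν.IsAddHaarMeasure] {a : F} (ha : a ≠ 0) :
    ν (Metric.closedBall 0 ‖a‖) = residueCard F * ν (Metric.ball 0 ‖a‖) := by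
  obtain ⟨-, t, ht1, htd, htc⟩ := exists_residue_representatives (F := F)
  have ha' : 0 < ‖a‖ := norm_pos_iff.2 ha
  have hU : Metric.closedBall (0 : F) ‖a‖ = ⋃ i, Metric.ball (a * t i) ‖a‖ := by
    ext x
    simp only [mem_closedBall_zero_iff, Set.mem_iUnion, Metric.mem_ball, dist_eq_norm]
    constructor
    · intro hx
      obtain ⟨i, hi⟩ := htc (a⁻¹ * x) (by
        rw [norm_mul, norm_inv]; exact inv_mul_le_one_of_le₀ hx (norm_nonneg _))
      refine ⟨i, ?_⟩
      have e : x - a * t i = a * (a⁻¹ * x - t i) := by field_simp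
      rw [e, norm_mul]
      exact mul_lt_of_lt_one_right ha' hi
    · rintro ⟨i, hi⟩
      rw [show x = (x - a * t i) + a * t i by ring]
      refine (IsUltrametricDist.norm_add_le_max _ _).trans (max_le hi.le ?_)
      rw [norm_mul]
      exact mul_le_of_le_one_right (norm_nonneg _) (ht1 i)
  rw [hU, measure_iUnion]
  · have : ∀ i, ν (Metric.ball (a * t i) ‖a‖) = ν (Metric.ball 0 ‖a‖) := fun i =>
      Measure.addHaar_ball_center ν _ _
    simp [this, tsum_fintype]
  · intro i j hij
    refine Set.disjoint_left.2 fun x hxi hxj => (htd i j hij).not_gt ?_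
    simp only [Metric.mem_ball, dist_eq_norm] at hxi hxj
    have h1 : ‖a * (t i - t j)‖ < ‖a‖ := by
      rw [show a * (t i - t j) = (x - a * t j) + -(x - a * t i) by ring]
      refine (IsUltrametricDist.norm_add_le_max _ _).trans_lt (max_lt hxj ?_)
      rwa [norm_neg]
    rw [norm_mul] at h1
    exact (mul_lt_iff_lt_one_right ha').1 h1
  · exact fun i => measurableSet_ball

/-- The largest absolute value below `1`; it generates the value group. -/
theorem exists_uniformizer (F : Type*) [NontriviallyNormedField F] [IsUltrametricDist F]
    [LocallyCompactSpace F] : ∃ w : F, 0 < ‖w‖ ∧ ‖w‖ < 1 ∧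
      (∀ x : F, ‖x‖ < 1 → ‖x‖ ≤ ‖w‖) ∧ Metric.diam (Metric.ball (0 : F) 1) = ‖w‖ := by
  have : ProperSpace F := ProperSpace.of_locallyCompactSpace F
  have hcomp : IsCompact (Metric.ball (0 : F) 1) :=
    Metric.isCompact_of_isClosed_isBounded (IsUltrametricDist.isClosed_ball _ _)
      Metric.isBounded_ball
  obtain ⟨w, hw, hmax⟩ := hcomp.exists_isMaxOn ⟨0, by simp⟩ continuous_norm.continuousOn
  rw [mem_ball_zero_iff] at hw
  have hmax' : ∀ x : F, ‖x‖ < 1 → ‖x‖ ≤ ‖w‖ := fun x hx => hmax (mem_ball_zero_iff.2 hx)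
  obtain ⟨x, hx0, hx1⟩ := NormedField.exists_norm_lt_one F
  refine ⟨w, hx0.trans_le (hmax' x hx1), hw, hmax', le_antisymm ?_ ?_⟩
  · refine Metric.diam_le_of_forall_dist_le (norm_nonneg _) fun a ha b hb => ?_
    rw [mem_ball_zero_iff] at ha hb
    rw [dist_eq_norm, sub_eq_add_neg]
    refine (IsUltrametricDist.norm_add_le_max _ _).trans (max_le (hmax' a ha) ?_)
    rw [norm_neg]; exact hmax' b hb
  · have := Metric.dist_le_diam_of_mem (Metric.isBounded_ball (x := (0 : F)) (r := 1))
      (mem_ball_zero_iff.2 hw) (Metric.mem_ball_self one_pos)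
    rwa [dist_zero_right] at this

/-- The measure of balls grows at least like a power `s` of the diameter. For the normalized
absolute value, `s = 1`. -/
theorem exists_measure_ball_le [LocallyCompactSpace F] [MeasurableSpace F] [BorelSpace F]
    (ν : Measure F) [ν.IsAddHaarMeasure] : ∃ s : ℝ, 0 < s ∧ (IsNormalized F → s = 1) ∧
      ∀ r > 0, ∃ ρ > 0, ∀ c : F, (∀ x ∈ Metric.ball c r, ∀ y ∈ Metric.ball c r, ‖x - y‖ ≤ ρ) ∧
        ∀ x, ∀ δ > 0, ν (Metric.ball x δ) ≤
          ENNReal.ofReal (1 * (δ / ρ) ^ s) * ν (Metric.ball c r) := by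
  have : ProperSpace F := ProperSpace.of_locallyCompactSpace F
  obtain ⟨w, hw0, hw1, hmax, hdiam⟩ := exists_uniformizer F
  obtain ⟨hq, -⟩ := exists_residue_representatives (F := F)
  set q := residueCard F with hqdef
  have hq1 : (1 : ℝ) < q := by exact_mod_cast hq
  have hq0 : (0 : ℝ) < q := by linarith
  have hwinv : 1 < ‖w‖⁻¹ := (one_lt_inv₀ hw0).2 hw1
  have hlogw : 0 < Real.log ‖w‖⁻¹ := Real.log_pos hwinv
  have hlogq : 0 < Real.log q := Real.log_pos hq1
  set s := Real.log q / Real.log ‖w‖⁻¹ with hs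
  have hws : ‖w‖ ^ s = (q : ℝ)⁻¹ := by
    rw [Real.rpow_def_of_pos hw0, hs, Real.log_inv]
    have : Real.log ‖w‖ ≠ 0 := by rw [Real.log_inv] at hlogw; linarith
    rw [show Real.log ‖w‖ * (Real.log q / -Real.log ‖w‖) = -Real.log q by field_simp,
      Real.exp_neg, Real.exp_log hq0]
  have hw0' : w ≠ 0 := norm_pos_iff.1 hw0
  -- Every open ball is a closed ball whose radius is a power of `‖w‖`.
  have hval : ∀ (x : F) (m : ℤ), ‖x‖ < ‖w‖ ^ m → ‖x‖ ≤ ‖w‖ ^ (m + 1) := by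
    intro x m hx
    have h1 := hmax (x * (w ^ m)⁻¹) (by
      rw [norm_mul, norm_inv, norm_zpow, ← div_eq_mul_inv, div_lt_one (by positivity)]; exact hx)
    rw [norm_mul, norm_inv, norm_zpow, ← div_eq_mul_inv, div_le_iff₀ (by positivity)] at h1
    rwa [zpow_add_one₀ hw0.ne', mul_comm]
  have hball : ∀ r > 0, ∃ m : ℤ, ‖w‖ ^ m < r ∧ ∀ c : F,
      Metric.ball c r = Metric.closedBall c (‖w‖ ^ m) := by
    intro r hr
    obtain ⟨n, hn1, hn2⟩ := exists_mem_Ioc_zpow hr hwinv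
    rw [inv_zpow'] at hn1 hn2
    refine ⟨-n, hn1, fun c => ?_⟩
    ext x
    simp only [Metric.mem_ball, Metric.mem_closedBall, dist_eq_norm]
    refine ⟨fun h => ?_, fun h => h.trans_lt hn1⟩
    have := hval (x - c) (-(n + 1)) (h.trans_le hn2)
    rwa [show -(n + 1) + 1 = -n by ring] at this
  have hstep : ∀ m : ℤ, ν (Metric.closedBall 0 (‖w‖ ^ m)) =
      q * ν (Metric.closedBall 0 (‖w‖ ^ (m + 1))) := by
    intro m
    have h := measure_closedBall_eq_mul ν (zpow_ne_zero m hw0')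
    rw [norm_zpow] at h
    rw [h]
    congr 2
    ext x
    simp only [mem_ball_zero_iff, mem_closedBall_zero_iff]
    refine ⟨hval x m, fun h => h.trans_lt ?_⟩
    exact zpow_lt_zpow_right_of_lt_one₀ hw0 hw1 (by omega)
  have hfin : ∀ m : ℤ, ν (Metric.closedBall 0 (‖w‖ ^ m)) ≠ ∞ := fun m =>
    (isCompact_closedBall _ _).measure_lt_top.ne
  have hV : ∀ m : ℤ, ν.real (Metric.closedBall 0 (‖w‖ ^ m)) =
      (q : ℝ) ^ (-m) * ν.real (Metric.closedBall 0 (‖w‖ ^ (0 : ℤ))) := by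
    have hstep' : ∀ m : ℤ, ν.real (Metric.closedBall 0 (‖w‖ ^ m)) =
        q * ν.real (Metric.closedBall 0 (‖w‖ ^ (m + 1))) := by
      intro m
      rw [Measure.real, hstep m, ENNReal.toReal_mul, ENNReal.toReal_natCast, Measure.real]
    intro m
    induction m using Int.induction_on with
    | zero => simp
    | succ i ih =>
      have h := hstep' i
      rw [ih] at h
      rw [neg_add, zpow_add₀ hq0.ne', zpow_neg_one]
      field_simp at h ⊢
      linarith
    | pred i ih =>
      have h := hstep' (-(i : ℤ) - 1)
      rw [sub_add_cancel, ih] at h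
      rw [h, show -(-(i : ℤ) - 1) = -(-(i : ℤ)) + 1 by ring, zpow_add_one₀ hq0.ne']
      ring
  refine ⟨s, by positivity, ?_, ?_⟩
  · intro hnorm
    have h : Metric.diam (Metric.ball (0 : F) 1) = 1 / (q : ℝ) := hnorm
    rw [hdiam] at h
    rw [hs, h, one_div, inv_inv, div_self hlogq.ne']
  · intro r hr
    obtain ⟨m, -, hm⟩ := hball r hr
    refine ⟨‖w‖ ^ m, by positivity, fun c => ⟨fun x hx y hy => ?_, fun x δ hδ => ?_⟩⟩
    · rw [hm] at hx hy
      rw [Metric.mem_closedBall, dist_eq_norm] at hx hy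
      rw [show x - y = (x - c) + -(y - c) by ring]
      refine (IsUltrametricDist.norm_add_le_max _ _).trans (max_le hx ?_)
      rwa [norm_neg]
    · obtain ⟨l, hlδ, hl⟩ := hball δ hδ
      rw [hl, hm, Measure.addHaar_closedBall_center, Measure.addHaar_closedBall_center ν c]
      rw [← ENNReal.ofReal_toReal (hfin l), ← ENNReal.ofReal_toReal (hfin m),
        ← ENNReal.ofReal_mul (by positivity)]
      refine ENNReal.ofReal_le_ofReal ?_
      have hl' := hV l
      have hm' := hV m
      simp only [Measure.real] at hl' hm'
      rw [hl', hm', ← mul_assoc, one_mul]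
      refine mul_le_mul_of_nonneg_right ?_ ENNReal.toReal_nonneg
      have h1 : (‖w‖ ^ l / ‖w‖ ^ m) ^ s = (q : ℝ) ^ (-l) * (q : ℝ) ^ m := by
        rw [← zpow_sub₀ hw0.ne', ← Real.rpow_intCast, ← Real.rpow_mul hw0.le, mul_comm,
          Real.rpow_mul hw0.le, hws, Real.rpow_intCast, inv_zpow', ← zpow_add₀ hq0.ne']
        congr 1
        ring
      have h2 : (‖w‖ ^ l / ‖w‖ ^ m) ^ s ≤ (δ / ‖w‖ ^ m) ^ s := by
        refine Real.rpow_le_rpow (by positivity) ?_ (by positivity)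
        gcongr
      rw [h1] at h2
      calc (q : ℝ) ^ (-l) = (q : ℝ) ^ (-l) * (q : ℝ) ^ m * (q : ℝ) ^ (-m) := by
            rw [mul_assoc, ← zpow_add₀ hq0.ne', add_neg_cancel, zpow_zero, mul_one]
        _ ≤ _ := by gcongr

end BallGrowth

/-! ### Sublevel bounds on boxes -/

section Box

variable {F : Type*} [MeasurableSpace F] {d : ℕ}

/-- Fubini's theorem on a box in the single variable `j`. -/
theorem pi_le_of_fiber_le (ν : Measure F) [SigmaFinite ν] (B : Fin d → Set F)
    (hB : ∀ j, MeasurableSet (B j)) {A : Set (Fin d → F)} (hA : MeasurableSet A)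
    (hAB : A ⊆ Set.univ.pi B) (j : Fin d) (c : ℝ≥0∞)
    (hc : ∀ x ∈ Set.univ.pi B, ν {t ∈ B j | Function.update x j t ∈ A} ≤ c * ν (B j)) :
    Measure.pi (fun _ => ν) A ≤ c * Measure.pi (fun _ => ν) (Set.univ.pi B) := by
  obtain ⟨m, rfl⟩ : ∃ m, d = m + 1 := ⟨d - 1, by have := j.pos; omega⟩
  have hmp := (measurePreserving_piFinSuccAbove (fun _ : Fin (m + 1) => ν) j).symm
  set e := MeasurableEquiv.piFinSuccAbove (fun _ : Fin (m + 1) => F) j with he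
  have hsymm : ∀ (s : F) (w : Fin m → F), e.symm (s, w) = j.insertNth s w := fun s w => rfl
  set B' : Set (Fin m → F) := Set.univ.pi fun i => B (j.succAbove i) with hB'
  have hB'm : MeasurableSet B' := MeasurableSet.univ_pi fun i => hB _
  rw [← hmp.measure_preimage_equiv A, Measure.prod_apply_symm (e.symm.measurable hA),
    Measure.pi_pi, Fin.prod_univ_succAbove _ j]
  have hle : ∀ w, ν ((fun s => (s, w)) ⁻¹' (e.symm ⁻¹' A)) ≤
      B'.indicator (fun _ => c * ν (B j)) w := by
    intro w
    by_cases hw : w ∈ B'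
    · rw [Set.indicator_of_mem hw]
      rcases (B j).eq_empty_or_nonempty with h0 | ⟨t₀, ht₀⟩
      · have : (fun s => (s, w)) ⁻¹' (e.symm ⁻¹' A) = ∅ := by
          ext s
          simp only [Set.mem_preimage, hsymm, Set.mem_empty_iff_false, iff_false]
          intro h
          have := hAB h j (Set.mem_univ j)
          simp [h0] at this
        rw [this, measure_empty]; exact zero_le
      · refine le_trans (measure_mono ?_) (hc (j.insertNth t₀ w) ?_)
        · intro s hs
          simp only [Set.mem_preimage, hsymm] at hs
          refine ⟨by simpa using hAB hs j (Set.mem_univ j), ?_⟩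
          rwa [Fin.update_insertNth]
        · intro i _
          rcases Fin.eq_self_or_eq_succAbove j i with rfl | ⟨l, rfl⟩
          · simpa using ht₀
          · simpa using hw l (Set.mem_univ l)
    · have : (fun s => (s, w)) ⁻¹' (e.symm ⁻¹' A) = ∅ := by
        ext s
        simp only [Set.mem_preimage, hsymm, Set.mem_empty_iff_false, iff_false]
        intro h
        refine hw fun i _ => ?_
        simpa using hAB h (j.succAbove i) (Set.mem_univ _)
      rw [this, measure_empty]; exact zero_le
  calc _ ≤ ∫⁻ w, B'.indicator (fun _ => c * ν (B j)) w ∂Measure.pi fun _ => ν :=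
        lintegral_mono hle
    _ = c * ν (B j) * ∏ i, ν (B (j.succAbove i)) := by
        rw [lintegral_indicator_const hB'm, hB', Measure.pi_pi]
    _ = _ := by ring

/-- If a function satisfies sublevel bounds in every single variable, then it satisfies a sublevel
bound on the box. -/
theorem SublevelBound.pi [NormedField F] [BorelSpace F] [SecondCountableTopology F] (hd : 0 < d)
    (ν : Measure F) [SigmaFinite ν] {B : Fin d → Set F} (hB : ∀ j, IsOpen (B j))
    {h : (Fin d → F) → F} (hh : ContinuousOn h (Set.univ.pi B)) {C α : ℝ} (hC : 1 ≤ C)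
    (hα : 0 < α)
    (hbound : ∀ j, ∀ x ∈ Set.univ.pi B,
      SublevelBound ν (B j) (fun t => h (Function.update x j t)) C α) :
    SublevelBound (Measure.pi fun _ => ν) (Set.univ.pi B) h (d * C) (α / d) := by
  intro y hy hy0 ε hε
  have hyp : 0 < ‖h y‖ := norm_pos_iff.2 hy0
  have hd' : (0 : ℝ) < d := by exact_mod_cast hd
  have hd1 : (1 : ℝ) ≤ d := by exact_mod_cast hd
  set π := Measure.pi fun _ : Fin d => ν with hπ
  rcases le_or_gt ‖h y‖ ε with hle | hlt
  · have h2 : (1 : ℝ≥0∞) ≤ ENNReal.ofReal (d * C * (ε / ‖h y‖) ^ (α / d)) := by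
      rw [← ENNReal.ofReal_one]
      refine ENNReal.ofReal_le_ofReal (one_le_mul_of_one_le_of_one_le
        (one_le_mul_of_one_le_of_one_le hd1 hC) (Real.one_le_rpow ?_ (by positivity)))
      rwa [le_div_iff₀ hyp, one_mul]
    calc π {x ∈ Set.univ.pi B | ‖h x‖ < ε} ≤ 1 * π (Set.univ.pi B) := by
          rw [one_mul]; exact measure_mono fun x hx => hx.1
      _ ≤ _ := by gcongr
  -- The thresholds decrease geometrically from `|h y|` to `ε` in `d` steps, and `mix j x`
  -- moves from `y` to `x` one coordinate at a time.
  set q : ℝ := (ε / ‖h y‖) ^ (1 / (d : ℝ)) with hq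
  set mix : ℕ → (Fin d → F) → Fin d → F := fun j x i => if (i : ℕ) < j then x i else y i with hmix
  have hmixB : ∀ j, ∀ x ∈ Set.univ.pi B, mix j x ∈ Set.univ.pi B := by
    intro j x hx i _
    simp only [hmix]
    split_ifs
    exacts [hx i (Set.mem_univ i), hy i (Set.mem_univ i)]
  have hmixc : ∀ j, Continuous (mix j) := by
    intro j
    refine continuous_pi fun i => ?_
    simp only [hmix]
    split_ifs <;> fun_prop
  have hBo : IsOpen (Set.univ.pi B) := isOpen_set_pi Set.finite_univ fun j _ => hB j
  set L : ℕ → ℝ → Set (Fin d → F) := fun j c => Set.univ.pi B ∩ {x | ‖h (mix j x)‖ < c} with hL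
  have hLm : ∀ j c, MeasurableSet (L j c) := by
    intro j c
    have hc : ContinuousOn (fun x => ‖h (mix j x)‖) (Set.univ.pi B) :=
      (hh.comp (hmixc j).continuousOn (hmixB j)).norm
    exact (hc.isOpen_inter_preimage hBo isOpen_Iio).measurableSet
  set thr : ℕ → ℝ := fun j => ‖h y‖ * q ^ j with hthr
  set A : ℕ → Set (Fin d → F) := fun j => L (j + 1) (thr (j + 1)) \ L j (thr j) with hA
  have hmixd : ∀ x, mix d x = x := fun x => by ext i; simp [hmix]
  have hmix0 : ∀ x, mix 0 x = y := fun x => by ext i; simp [hmix]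
  have hthrd : thr d = ε := by
    simp only [hthr, hq]
    rw [← Real.rpow_natCast, ← Real.rpow_mul (by positivity), one_div,
      inv_mul_cancel₀ hd'.ne', Real.rpow_one]
    field_simp
  have hcover : {x ∈ Set.univ.pi B | ‖h x‖ < ε} ⊆ ⋃ j : Fin d, A j := by
    rintro x ⟨hxB, hx⟩
    have hex : ∃ j, x ∈ L j (thr j) := ⟨d, hxB, by
      rw [Set.mem_ofPred_eq, hmixd, hthrd]; exact hx⟩
    have hmin := fun m => Nat.find_min hex (m := m)
    have hspec := Nat.find_spec hex
    have hled : Nat.find hex ≤ d := Nat.find_min' hex ⟨hxB, by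
      rw [Set.mem_ofPred_eq, hmixd, hthrd]; exact hx⟩
    obtain ⟨m, hm⟩ : ∃ m, Nat.find hex = m + 1 := by
      refine Nat.exists_eq_succ_of_ne_zero fun h0 => ?_
      rw [h0] at hspec
      have := hspec.2
      rw [Set.mem_ofPred_eq, hmix0] at this
      simp [hthr] at this
    rw [hm] at hspec hled
    exact Set.mem_iUnion.2 ⟨⟨m, by omega⟩, hspec, hmin m (by omega)⟩
  have hAj : ∀ j : Fin d, π (A j) ≤ ENNReal.ofReal (C * q ^ α) * π (Set.univ.pi B) := by
    intro j
    refine pi_le_of_fiber_le ν B (fun j => (hB j).measurableSet)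
      ((hLm _ _).diff (hLm _ _)) (fun x hx => hx.1.1) j _ fun x hx => ?_
    have hfix : ∀ t, mix j (Function.update x j t) = mix j x := by
      intro t
      ext i
      simp only [hmix]
      split_ifs with hi
      · have : i ≠ j := fun h => by rw [h] at hi; exact lt_irrefl _ hi
        rw [Function.update_of_ne this]
      · rfl
    have hnext : ∀ t, mix (j + 1) (Function.update x j t) = Function.update (mix j x) j t := by
      intro t
      ext i
      by_cases hi : i = j
      · subst hi; simp [hmix]
      · have hij : (i : ℕ) < j + 1 ↔ (i : ℕ) < j := by
          omega
        simp only [hmix, Function.update_of_ne hi, hij]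
    rcases lt_or_ge ‖h (mix j x)‖ (thr j) with hsmall | hbig
    · have : {t ∈ B j | Function.update x j t ∈ A j} = ∅ := by
        ext t
        simp only [Set.mem_ofPred_eq, Set.mem_empty_iff_false, iff_false]
        rintro ⟨ht, h1, h2⟩
        exact h2 ⟨h1.1, by rw [Set.mem_ofPred_eq, hfix]; exact hsmall⟩
      rw [this, measure_empty]; exact zero_le
    · have hthr0 : 0 < thr j := by positivity
      have hz0 : 0 < ‖h (mix j x)‖ := hthr0.trans_le hbig
      have hupd : Function.update (mix j x) j (mix j x j) = mix j x := Function.update_eq_self _ _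
      have hb := hbound j (mix j x) (hmixB j x hx) (mix j x j)
        (hmixB j x hx j (Set.mem_univ j)) (by simp only [hupd]; exact norm_pos_iff.1 hz0)
        (thr (j + 1)) (by positivity)
      simp only [hupd] at hb
      refine le_trans (measure_mono ?_) (hb.trans ?_)
      · rintro t ⟨ht, h1, -⟩
        refine ⟨ht, ?_⟩
        have := h1.2
        rwa [Set.mem_ofPred_eq, hnext] at this
      · gcongr
        rw [div_le_iff₀ hz0]
        calc thr (j + 1) = q * thr j := by simp only [hthr]; ring
          _ ≤ q * ‖h (mix j x)‖ := by gcongr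
  calc π {x ∈ Set.univ.pi B | ‖h x‖ < ε} ≤ π (⋃ j : Fin d, A j) := measure_mono hcover
    _ ≤ ∑ j : Fin d, π (A j) := measure_iUnion_fintype_le _ _
    _ ≤ ∑ _j : Fin d, ENNReal.ofReal (C * q ^ α) * π (Set.univ.pi B) :=
        Finset.sum_le_sum fun j _ => hAj j
    _ = _ := by
        rw [Finset.sum_const, Finset.card_univ, Fintype.card_fin, nsmul_eq_mul, ← mul_assoc,
          ← ENNReal.ofReal_natCast, ← ENNReal.ofReal_mul (by positivity), hq,
          ← Real.rpow_mul (by positivity)]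
        congr 2
        rw [show 1 / (d : ℝ) * α = α / d by ring]
        ring

end Box

/-! ### Directions in which divided differences are nearly constant -/

section Directions

variable {F : Type*} [NontriviallyNormedField F] {d n : ℕ}

theorem exists_nodes_eq {T : Finset F} {m : ℕ} (hT : T.card = m + 1) :
    ∃ t : ℕ → F, Set.InjOn t (Set.Iic (0 + m)) ∧ nodes t 0 m = T := by
  set e : Fin (m + 1) ≃ T := (T.equivFinOfCardEq hT).symm with he
  refine ⟨fun i => if h : i < m + 1 then e ⟨i, h⟩ else 0, ?_, ?_⟩
  · intro a ha b hb hab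
    simp only [Set.mem_Iic, zero_add] at ha hb
    simp only [Nat.lt_succ_iff.2 ha, Nat.lt_succ_iff.2 hb, dite_true] at hab
    simpa using e.injective (Subtype.ext hab)
  · ext y
    simp only [nodes, Finset.mem_image, Finset.mem_range, zero_add]
    constructor
    · rintro ⟨i, hi, rfl⟩
      simp [hi]
    · intro hy
      refine ⟨e.symm ⟨y, hy⟩, (e.symm ⟨y, hy⟩).2, ?_⟩
      rw [dif_pos (e.symm ⟨y, hy⟩).2]
      simp

/-- The homogeneous polynomial of degree `m` formed by the coefficients of order `m` of a jet: the
limit of the divided differences of order `m` along lines in the direction `v`. -/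
noncomputable def jetForm (a : (Fin d → ℕ) → Fin n → F) (m : ℕ) (i : Fin n) (v : Fin d → F) : F :=
  ∑ β ∈ Finset.Nat.antidiagonalTuple d m, (∏ j, v j ^ β j) * a β i

/-- Divided differences along lines in a fixed direction converge to the value of the jet form. -/
theorem HasGridJet.divDiff_line {k : ℕ} {f : (Fin d → F) → Fin n → F} {x₀ : Fin d → F}
    {a : (Fin d → ℕ) → Fin n → F} (h : HasGridJet k f x₀ a) {m : ℕ} (hm : m ≤ k)
    {v : Fin d → F} (hv : ∀ j, v j ≠ 0) {η : ℝ} (hη : 0 < η) :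
    ∃ r > 0, ∀ i z (T : Finset F), T.card = m + 1 →
      (∀ τ ∈ T, z + τ • v ∈ Metric.ball x₀ r) →
        ‖divDiff (fun τ => f (z + τ • v) i) T - jetForm a m i v‖ < η := by
  set S := Finset.Nat.antidiagonalTuple d m with hS
  set A : ℝ := 1 + ∑ β ∈ S, ‖∏ j, v j ^ β j‖ with hA
  have hA0 : 0 < A := by positivity
  have hev : ∀ β ∈ S, ∀ i, ∀ᶠ r in 𝓝[>] (0 : ℝ), ∀ T : Fin d → Finset F,
      (∀ j, (T j).card = β j + 1) → (∀ j, ∀ y ∈ T j, ‖y - x₀ j‖ < r) →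
        ‖gridDiff (fun x => f x i) T - a β i‖ < η / A := by
    intro β hβ i
    obtain ⟨r, hr, hT⟩ := h β (by rw [Finset.Nat.mem_antidiagonalTuple.1 hβ]; exact hm) i (η / A)
      (by positivity)
    filter_upwards [Ioo_mem_nhdsGT hr] with r' hr' T hTc hTr
    exact hT T hTc fun j y hy => (hTr j y hy).trans hr'.2
  obtain ⟨r, hr, hr0⟩ := (((Finset.eventually_all S).2 fun β hβ =>
    eventually_all.2 (hev β hβ)).and self_mem_nhdsWithin).exists
  refine ⟨r, hr0, fun i z T hT hTr => ?_⟩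
  obtain ⟨t, ht, rfl⟩ := exists_nodes_eq hT
  obtain ⟨G, hG, hGf⟩ := exists_divDiff_line z v hv 0 m ht
  rw [hGf fun x => f x i, jetForm, ← Finset.sum_sub_distrib]
  have hterm : ∀ β ∈ S, ‖(∏ j, v j ^ β j) * gridDiff (fun x => f x i) (G β) -
      (∏ j, v j ^ β j) * a β i‖ ≤ ‖∏ j, v j ^ β j‖ * (η / A) := by
    intro β hβ
    rw [← mul_sub, norm_mul]
    have hβ' := Finset.Nat.mem_antidiagonalTuple.1 hβ
    have := hr β hβ i (G β) (fun j => (hG β hβ' j).1) fun j y hy => by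
      obtain ⟨τ, hτ, rfl⟩ := Finset.mem_image.1 ((hG β hβ' j).2 hy)
      have h1 := hTr τ hτ
      rw [Metric.mem_ball, dist_pi_lt_iff hr0] at h1
      simpa [dist_eq_norm] using h1 j
    gcongr
  calc _ ≤ ∑ β ∈ S, ‖∏ j, v j ^ β j‖ * (η / A) := norm_sum_le_of_le _ hterm
    _ = (A - 1) * (η / A) := by rw [← Finset.sum_mul, hA]; ring
    _ < A * (η / A) := by
      have : 0 < η / A := by positivity
      nlinarith
    _ = η := by field_simp

/-- A nonzero combination of jet coefficients of order `m` gives a nonzero form, so there are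
vectors near the standard basis, with nonzero coordinates, on which the form does not vanish. -/
theorem exists_directions {a : (Fin d → ℕ) → Fin n → F} {c : Fin n → F} {β : Fin d → ℕ}
    (hβ : ∑ i, c i * a β i ≠ 0) {δ : ℝ} (hδ : 0 < δ) :
    ∃ v : Fin d → Fin d → F, ∀ j, ‖v j - Pi.single j 1‖ < δ ∧ (∀ l, v j l ≠ 0) ∧
      ∑ i, c i * jetForm a (∑ j, β j) i (v j) ≠ 0 := by
  set m := ∑ j, β j with hm
  set P : MvPolynomial (Fin d) F := ∑ γ ∈ Finset.Nat.antidiagonalTuple d m,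
    MvPolynomial.monomial (Finsupp.equivFunOnFinite.symm γ) (∑ i, c i * a γ i) with hP
  have hPe : ∀ v, MvPolynomial.eval v P = ∑ i, c i * jetForm a m i v := by
    intro v
    simp only [hP, map_sum, MvPolynomial.eval_monomial, jetForm, Finset.mul_sum]
    rw [Finset.sum_comm]
    refine Finset.sum_congr rfl fun γ _ => ?_
    refine Finset.sum_congr rfl fun i _ => ?_
    rw [Finsupp.prod_fintype _ _ fun i => pow_zero _]
    simp only [Finsupp.equivFunOnFinite_symm_apply_apply]
    ring
  have hP0 : P ≠ 0 := by
    intro h0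
    apply hβ
    have := congrArg (MvPolynomial.coeff (Finsupp.equivFunOnFinite.symm β)) h0
    rw [hP, MvPolynomial.coeff_sum, Finset.sum_eq_single β] at this
    · rwa [MvPolynomial.coeff_monomial, if_pos rfl, MvPolynomial.coeff_zero] at this
    · intro γ _ hγ
      rw [MvPolynomial.coeff_monomial, if_neg]
      exact fun h => hγ (Finsupp.equivFunOnFinite.symm.injective h)
    · intro h
      exact absurd (Finset.Nat.mem_antidiagonalTuple.2 hm.symm) h
  set Q : MvPolynomial (Fin d) F := P * ∏ l, MvPolynomial.X l with hQ
  have hQ0 : Q ≠ 0 := mul_ne_zero hP0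
    (Finset.prod_ne_zero_iff.2 fun l _ => MvPolynomial.X_ne_zero l)
  have key : ∀ e : Fin d → F, ∃ v, ‖v - e‖ < δ ∧ MvPolynomial.eval v Q ≠ 0 := by
    intro e
    by_contra! hcon
    refine hQ0 (MvPolynomial.funext_set (fun l => Metric.ball (e l) δ) (fun l => ?_) ?_)
    · exact infinite_of_mem_nhds (e l) (Metric.ball_mem_nhds _ hδ)
    · intro v hv
      rw [map_zero]
      refine hcon v ?_
      rw [pi_norm_lt_iff hδ]
      intro l
      have := hv l (Set.mem_univ l)
      rwa [Metric.mem_ball, dist_eq_norm] at this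
  choose v hv hvQ using fun j => key (Pi.single j 1)
  refine ⟨v, fun j => ⟨hv j, ?_, ?_⟩⟩
  · intro l hl
    apply hvQ j
    rw [hQ, map_mul, map_prod, Finset.prod_eq_zero (Finset.mem_univ l) (by simpa using hl),
      mul_zero]
  · rw [← hPe]
    intro h0
    exact hvQ j (by rw [hQ, map_mul, h0, zero_mul])

/-- In every direction `v j` of a system close to the standard basis, the divided differences of
order `m` of `c₀ + ∑ cᵢ fᵢ` near `x₀` are nearly constant, whatever `c₀` is. -/
def HasGoodDirections (k : ℕ) (f : (Fin d → F) → Fin n → F) (x₀ : Fin d → F) (δ r : ℝ)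
    (c : Fin n → F) : Prop :=
  ∃ m, 1 ≤ m ∧ m ≤ k ∧ ∃ v : Fin d → Fin d → F, (∀ j, ‖v j - Pi.single j 1‖ < δ) ∧
    ∃ p : Fin d → F, (∀ j, p j ≠ 0) ∧ ∀ j c₀ z,
      IsNearlyConstDivDiff m (fun τ => c₀ + ∑ i, c i * f (z + τ • v j) i)
        {τ | z + τ • v j ∈ Metric.ball x₀ r} (p j)

theorem HasGoodDirections.mono {k : ℕ} {f : (Fin d → F) → Fin n → F} {x₀ : Fin d → F}
    {δ r r' : ℝ} {c : Fin n → F} (h : HasGoodDirections k f x₀ δ r c) (hr : r' ≤ r) :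
    HasGoodDirections k f x₀ δ r' c := by
  obtain ⟨m, h1, h2, v, hv, p, hp, h⟩ := h
  exact ⟨m, h1, h2, v, hv, p, hp, fun j c₀ z T hT hTr =>
    h j c₀ z T hT fun τ hτ => Metric.ball_subset_ball hr (hTr τ hτ)⟩

theorem divDiff_combination {m : ℕ} (hm : 1 ≤ m) (c₀ : F) (c : Fin n → F) (g : F → Fin n → F)
    {T : Finset F} (hT : T.card = m + 1) :
    divDiff (fun τ => c₀ + ∑ i, c i * g τ i) T = ∑ i, c i * divDiff (fun τ => g τ i) T := by
  rw [divDiff_add, divDiff_const _ (by omega), zero_add, divDiff_sum]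
  exact Finset.sum_congr rfl fun i _ => divDiff_const_mul _ _ _

theorem HasGoodDirections.smul {k : ℕ} {f : (Fin d → F) → Fin n → F} {x₀ : Fin d → F}
    {δ r : ℝ} {c : Fin n → F} (h : HasGoodDirections k f x₀ δ r c) {b : F} (hb : b ≠ 0) :
    HasGoodDirections k f x₀ δ r (b • c) := by
  obtain ⟨m, h1, h2, v, hv, p, hp, h⟩ := h
  refine ⟨m, h1, h2, v, hv, fun j => b * p j, fun j => mul_ne_zero hb (hp j),
    fun j c₀ z T hT hTr => ?_⟩
  have hlt := h j c₀ z T hT hTr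
  rw [divDiff_combination h1 _ _ (fun τ => f (z + τ • v j)) hT] at hlt ⊢
  simp only [Pi.smul_apply, smul_eq_mul, mul_assoc, ← Finset.mul_sum]
  rw [← mul_sub, norm_mul, norm_mul, mul_div_assoc]
  gcongr

/-- Near a fixed coefficient vector, good directions exist on a common ball. -/
theorem HasGridJet.eventually_hasGoodDirections {k : ℕ} {f : (Fin d → F) → Fin n → F}
    {x₀ : Fin d → F} {a : (Fin d → ℕ) → Fin n → F} (h : HasGridJet k f x₀ a)
    (ha : IsNondegenerateJet k a) {δ : ℝ} (hδ : 0 < δ) {c : Fin n → F} (hc : c ≠ 0) :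
    ∃ r > 0, ∀ᶠ c' in 𝓝 c, HasGoodDirections k f x₀ δ r c' := by
  obtain ⟨β, hβ1, hβk, hβ⟩ := ha c hc
  obtain ⟨v, hv⟩ := exists_directions hβ hδ
  set m := ∑ j, β j with hm
  set P : (Fin n → F) → Fin d → F := fun c' j => ∑ i, c' i * jetForm a m i (v j) with hP
  have hPc : ∀ j, Continuous fun c' => P c' j := fun j => by
    simp only [hP]
    fun_prop
  -- The total weight of the coefficient vectors is locally bounded.
  set A : ℝ := 1 + ∑ i, ‖c i‖ with hA
  have hA0 : 0 < A := by positivity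
  have hA' : ∀ᶠ c' in 𝓝 c, ∑ i, ‖c' i‖ < A := by
    have : Continuous fun c' : Fin n → F => ∑ i, ‖c' i‖ := by fun_prop
    exact this.continuousAt.eventually_lt continuousAt_const (by simp [hA])
  have hP' : ∀ᶠ c' in 𝓝 c, ∀ j, ‖P c j‖ / 2 < ‖P c' j‖ := by
    refine eventually_all.2 fun j => ?_
    refine continuousAt_const.eventually_lt (hPc j).norm.continuousAt ?_
    have : 0 < ‖P c j‖ := norm_pos_iff.2 (hv j).2.2
    linarith
  have hr : ∀ j, ∀ᶠ r in 𝓝[>] (0 : ℝ), ∀ i z (T : Finset F), T.card = m + 1 →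
      (∀ τ ∈ T, z + τ • v j ∈ Metric.ball x₀ r) →
        ‖divDiff (fun τ => f (z + τ • v j) i) T - jetForm a m i (v j)‖ < ‖P c j‖ / (4 * A) := by
    intro j
    have : 0 < ‖P c j‖ := norm_pos_iff.2 (hv j).2.2
    obtain ⟨r, hr, h'⟩ := h.divDiff_line hβk (hv j).2.1
      (show 0 < ‖P c j‖ / (4 * A) by positivity)
    filter_upwards [Ioo_mem_nhdsGT hr] with r' hr' i z T hT hTr
    exact h' i z T hT fun τ hτ => Metric.ball_subset_ball hr'.2.le (hTr τ hτ)
  obtain ⟨r, hr, hr0⟩ := ((eventually_all.2 hr).and self_mem_nhdsWithin).exists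
  refine ⟨r, hr0, ?_⟩
  filter_upwards [hA', hP'] with c' hc'A hc'P
  have hpos : ∀ j, 0 < ‖P c j‖ := fun j => norm_pos_iff.2 (hv j).2.2
  refine ⟨m, hβ1, hβk, v, fun j => (hv j).1, P c', fun j => ?_, fun j c₀ z T hT hTr => ?_⟩
  · have := hpos j
    exact norm_pos_iff.1 ((by positivity : 0 ≤ ‖P c j‖ / 2).trans_lt (hc'P j))
  · rw [divDiff_combination hβ1 _ _ (fun τ => f (z + τ • v j)) hT]
    simp only [hP]
    rw [← Finset.sum_sub_distrib]
    have hterm : ∀ i ∈ Finset.univ, ‖c' i * divDiff (fun τ => f (z + τ • v j) i) T -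
        c' i * jetForm a m i (v j)‖ ≤ ‖c' i‖ * (‖P c j‖ / (4 * A)) := by
      intro i _
      rw [← mul_sub, norm_mul]
      have := hr j i z T hT hTr
      gcongr
    have h2 := hc'P j
    calc _ ≤ ∑ i, ‖c' i‖ * (‖P c j‖ / (4 * A)) := norm_sum_le_of_le _ hterm
      _ = (∑ i, ‖c' i‖) * (‖P c j‖ / (4 * A)) := by rw [Finset.sum_mul]
      _ ≤ A * (‖P c j‖ / (4 * A)) := by gcongr
      _ = ‖P c j‖ / 4 := by field_simp
      _ < ‖P c' j‖ / 2 := by linarith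

/-- Good directions exist on a common ball for all nonzero coefficient vectors, by compactness of
the unit sphere and homogeneity. -/
theorem HasGridJet.exists_hasGoodDirections [ProperSpace F] {k : ℕ}
    {f : (Fin d → F) → Fin n → F}
    {x₀ : Fin d → F} {a : (Fin d → ℕ) → Fin n → F} (h : HasGridJet k f x₀ a)
    (ha : IsNondegenerateJet k a) {δ : ℝ} (hδ : 0 < δ) :
    ∃ r > 0, ∀ c : Fin n → F, c ≠ 0 → HasGoodDirections k f x₀ δ r c := by
  have hsph : ∃ r > 0, ∀ c ∈ Metric.sphere (0 : Fin n → F) 1, HasGoodDirections k f x₀ δ r c := by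
    refine (isCompact_sphere (0 : Fin n → F) 1).induction_on
      (p := fun s => ∃ r > 0, ∀ c ∈ s, HasGoodDirections k f x₀ δ r c) ?_ ?_ ?_ ?_
    · exact ⟨1, one_pos, by simp⟩
    · rintro s t hst ⟨r, hr, h⟩
      exact ⟨r, hr, fun c hc => h c (hst hc)⟩
    · rintro s t ⟨r, hr, h⟩ ⟨r', hr', h'⟩
      refine ⟨min r r', lt_min hr hr', fun c hc => ?_⟩
      rcases hc with hc | hc
      · exact (h c hc).mono (min_le_left _ _)
      · exact (h' c hc).mono (min_le_right _ _)
    · intro c hc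
      have hc0 : c ≠ 0 := by
        rintro rfl
        simp at hc
      obtain ⟨r, hr, hev⟩ := h.eventually_hasGoodDirections ha hδ hc0
      exact ⟨_, mem_nhdsWithin_of_mem_nhds hev, r, hr, fun c' hc' => hc'⟩
  obtain ⟨r, hr, hs⟩ := hsph
  refine ⟨r, hr, fun c hc => ?_⟩
  obtain ⟨l, hl⟩ := Function.ne_iff.1 hc
  obtain ⟨i, -, hi⟩ := Finset.exists_max_image Finset.univ (fun i => ‖c i‖) ⟨l, Finset.mem_univ l⟩
  have hi0 : c i ≠ 0 := norm_pos_iff.1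
    ((norm_pos_iff.2 hl).trans_le (hi l (Finset.mem_univ l)))
  have hnorm : ‖c‖ = ‖c i‖ := le_antisymm
    ((pi_norm_le_iff_of_nonneg (norm_nonneg _)).2 fun j => hi j (Finset.mem_univ j))
    (norm_le_pi_norm c i)
  have := (hs ((c i)⁻¹ • c) (by
    rw [mem_sphere_zero_iff_norm, norm_smul, norm_inv, hnorm,
      inv_mul_cancel₀ (norm_ne_zero_iff.2 hi0)])).smul hi0
  rwa [smul_smul, mul_inv_cancel₀ hi0, one_smul] at this

end Directions

/-! ### Nonplanarity -/

section Nonplanar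

variable {F : Type*} [NontriviallyNormedField F] {d n : ℕ}

theorem gridDiff_const (c : F) {T : Fin d → Finset F} {j : Fin d} (hT : 2 ≤ (T j).card) :
    gridDiff (fun _ => c) T = 0 := by
  rw [gridDiff_eq_divDiff_update _ T j,
    divDiff_congr (g := fun _ => gridDiff (fun _ => c) (Function.update T j {0})) fun t _ =>
      gridDiff_update_singleton _ _ _ _ _]
  exact divDiff_const _ hT

/-- A map with a nondegenerate jet is nonplanar: if a combination of `1, f₁, …, fₙ` vanishes near
`x₀`, then so do its divided differences. -/
theorem HasGridJet.isNonplanarAt {k : ℕ} {f : (Fin d → F) → Fin n → F} {x₀ : Fin d → F}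
    {a : (Fin d → ℕ) → Fin n → F} (h : HasGridJet k f x₀ a) (ha : IsNondegenerateJet k a)
    [MeasurableSpace F] (μ : Measure (Fin d → F))
    [μ.IsOpenPosMeasure] (U : Set (Fin d → F)) : IsNonplanarAt μ U f x₀ := by
  intro B hB _
  rw [Fintype.linearIndependent_iff]
  intro g hg
  have hsupp : μ.support = Set.univ := Measure.support_eq_univ
  have hval : ∀ x ∈ B, g 0 + ∑ i : Fin n, g i.succ * f x i = 0 := by
    intro x hx
    have := congrFun hg ⟨x, hx, by rw [hsupp]; exact Set.mem_univ x⟩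
    simpa [Fin.sum_univ_succ] using this
  obtain ⟨R, hR, hRB⟩ := Metric.mem_nhds_iff.1 hB
  have hc : (fun i : Fin n => g i.succ) = 0 := by
    by_contra hc
    obtain ⟨β, hβ1, hβk, hβ⟩ := ha _ hc
    set p := ∑ i : Fin n, g i.succ * a β i with hp
    set A : ℝ := 1 + ∑ i : Fin n, ‖g i.succ‖ with hA
    have hA0 : 0 < A := by positivity
    have hev : ∀ i, ∀ᶠ r in 𝓝[>] (0 : ℝ), ∀ T : Fin d → Finset F,
        (∀ j, (T j).card = β j + 1) → (∀ j, ∀ y ∈ T j, ‖y - x₀ j‖ < r) →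
          ‖gridDiff (fun x => f x i) T - a β i‖ < ‖p‖ / A := by
      intro i
      obtain ⟨r, hr, hT⟩ := h β hβk i (‖p‖ / A) (by positivity)
      filter_upwards [Ioo_mem_nhdsGT hr] with r' hr' T hTc hTr
      exact hT T hTc fun j y hy => (hTr j y hy).trans hr'.2
    obtain ⟨r, hr, hrR⟩ := ((eventually_all.2 hev).and (Ioo_mem_nhdsGT hR)).exists
    have hT : ∀ j, ∃ T : Finset F, (T : Set F) ⊆ Metric.ball (x₀ j) r ∧ T.card = β j + 1 :=
      fun j => (infinite_of_mem_nhds (x₀ j) (Metric.ball_mem_nhds _ hrR.1)).exists_subset_card_eq _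
    choose T hTb hTc using hT
    obtain ⟨j, hj⟩ : ∃ j, β j ≠ 0 := by
      by_contra! h0
      simp [h0] at hβ1
    have hzero : ∑ i : Fin n, g i.succ * gridDiff (fun x => f x i) T = 0 := by
      rw [← gridDiff_sum_mul, gridDiff_congr (g := fun _ => -g 0), gridDiff_const (j := j)]
      · rw [hTc]; omega
      · intro x hx
        have hxB : x ∈ B := hRB (by
          rw [Metric.mem_ball, dist_pi_lt_iff hR]
          exact fun j => (hTb j (hx j)).trans hrR.2)
        linear_combination hval x hxB
    have hle : ‖p‖ ≤ (A - 1) * (‖p‖ / A) := by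
      have e : p = -∑ i : Fin n, g i.succ * (gridDiff (fun x => f x i) T - a β i) := by
        simp only [mul_sub, Finset.sum_sub_distrib, hzero, hp]
        ring
      calc ‖p‖ = ‖∑ i : Fin n, g i.succ * (gridDiff (fun x => f x i) T - a β i)‖ := by
            conv_lhs => rw [e, norm_neg]
        _ ≤ ∑ i : Fin n, ‖g i.succ‖ * (‖p‖ / A) := by
            refine norm_sum_le_of_le _ fun i _ => ?_
            rw [norm_mul]
            have := hr i T hTc fun j y hy => by
              have := hTb j hy
              rwa [Metric.mem_ball, dist_eq_norm] at this
            gcongr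
        _ = _ := by rw [← Finset.sum_mul, hA]; ring
    have h1 : A * (‖p‖ / A) = ‖p‖ := by field_simp
    have h2 : 0 < ‖p‖ / A := by positivity
    nlinarith
  intro i
  refine Fin.cases ?_ (fun i => congrFun hc i) i
  have := hval x₀ (mem_of_mem_nhds hB)
  simpa [fun i : Fin n => show g i.succ = 0 from congrFun hc i] using this

end Nonplanar

/-! ### Sublevel bounds under linear maps -/

section Good

variable {F : Type*} [NontriviallyNormedField F] {d n : ℕ}

/-- The linear map with the columns `v j`. -/
def columnMap (v : Fin d → Fin d → F) : (Fin d → F) →ₗ[F] (Fin d → F) where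
  toFun u := ∑ j, u j • v j
  map_add' u w := by simp [add_smul, Finset.sum_add_distrib]
  map_smul' c u := by simp [mul_smul, Finset.smul_sum]

theorem columnMap_update (v : Fin d → Fin d → F) (u : Fin d → F) (j : Fin d) (s : F) :
    columnMap v (Function.update u j s) = columnMap v (Function.update u j 0) + s • v j := by
  have : Function.update u j s = Function.update u j 0 + s • Pi.single j (1 : F) := by
    ext i
    by_cases hi : i = j
    · subst hi; simp
    · simp [hi]
  rw [this, map_add, map_smul]
  congr 2
  simp [columnMap, Pi.single_apply]

theorem columnMap_sub_self (v : Fin d → Fin d → F) (u : Fin d → F) :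
    columnMap v u - u = ∑ j, u j • (v j - Pi.single j 1) := by
  have : u = ∑ j, u j • Pi.single j (1 : F) := by
    ext i
    simp [Finset.sum_apply, Pi.single_apply]
  conv_lhs => rw [this]
  simp only [smul_sub, Finset.sum_sub_distrib]
  rw [← this]
  rfl

/-- The trivial bound for constants, where the sublevel set is empty or `C * (ε / |h|) ^ α ≥ 1`. -/
theorem SublevelBound.const {X : Type*} [MeasurableSpace X] (ν : Measure X) (B : Set X) (c : F)
    {C α : ℝ} (hC : 1 ≤ C) (hα : 0 ≤ α) : SublevelBound ν B (fun _ => c) C α := by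
  intro y _ hc ε hε
  have hcp : 0 < ‖c‖ := norm_pos_iff.2 hc
  rcases le_or_gt ε ‖c‖ with h | h
  · have : {x ∈ B | ‖c‖ < ε} = ∅ := by
      ext x
      simp [h]
    rw [this, measure_empty]
    exact zero_le
  · have h2 : (1 : ℝ≥0∞) ≤ ENNReal.ofReal (C * (ε / ‖c‖) ^ α) := by
      rw [← ENNReal.ofReal_one]
      refine ENNReal.ofReal_le_ofReal (one_le_mul_of_one_le_of_one_le hC
        (Real.one_le_rpow ?_ hα))
      rw [le_div_iff₀ hcp, one_mul]
      exact h.le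
    calc ν {x ∈ B | ‖c‖ < ε} ≤ 1 * ν B := by
          rw [one_mul]; exact measure_mono fun x hx => hx.1
      _ ≤ _ := by gcongr

theorem SublevelBound.smul_measure {X : Type*} [MeasurableSpace X] {ν : Measure X} {B : Set X}
    {h : X → F} {C α : ℝ} (hb : SublevelBound ν B h C α) (κ : ℝ≥0∞) :
    SublevelBound (κ • ν) B h C α := by
  intro y hy hy0 ε hε
  simp only [Measure.smul_apply, smul_eq_mul]
  calc κ * ν {x ∈ B | ‖h x‖ < ε} ≤ κ * (ENNReal.ofReal (C * (ε / ‖h y‖) ^ α) * ν B) := by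
        gcongr; exact hb y hy hy0 ε hε
    _ = _ := by ring

/-- Shrinking the set of a sublevel bound to a subset of comparable measure. -/
theorem SublevelBound.of_subset {X : Type*} [MeasurableSpace X] {ν : Measure X} {B B' : Set X}
    {h : X → F} {C α D : ℝ} (hb : SublevelBound ν B' h C α) (hBB' : B ⊆ B') (hD : 0 ≤ D)
    (hν : ν B' ≤ ENNReal.ofReal D * ν B) : SublevelBound ν B h (D * C) α := by
  intro y hy hy0 ε hε
  calc ν {x ∈ B | ‖h x‖ < ε} ≤ ν {x ∈ B' | ‖h x‖ < ε} :=
        measure_mono fun x hx => ⟨hBB' hx.1, hx.2⟩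
    _ ≤ ENNReal.ofReal (C * (ε / ‖h y‖) ^ α) * ν B' := hb y (hBB' hy) hy0 ε hε
    _ ≤ ENNReal.ofReal (C * (ε / ‖h y‖) ^ α) * (ENNReal.ofReal D * ν B) := by gcongr
    _ = _ := by
        rw [mul_assoc D, ENNReal.ofReal_mul hD]
        ring

/-- Transport of a sublevel bound on a box along a linear change of coordinates. -/
theorem SublevelBound.image_equiv [ProperSpace F] [MeasurableSpace F] [BorelSpace F]
    (ν : Measure F) [ν.IsAddHaarMeasure] (μ : Measure (Fin d → F)) [μ.IsAddHaarMeasure]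
    (e : (Fin d → F) ≃L[F] (Fin d → F)) {B : Set (Fin d → F)} {h : (Fin d → F) → F} {C α : ℝ}
    (hb : SublevelBound (Measure.pi fun _ => ν) B (fun u => h (e u)) C α) :
    SublevelBound μ (e '' B) h C α := by
  have hκ := Measure.isAddLeftInvariant_eq_smul (μ.map e.symm) (Measure.pi fun _ : Fin d => ν)
  have hb' : SublevelBound (μ.map e.symm) B (fun u => h (e u)) C α := by
    rw [hκ]
    exact hb.smul_measure _
  have hmap : ∀ s : Set (Fin d → F), μ.map e.symm s = μ (e '' s) := by
    intro s
    have h1 : (e.symm : (Fin d → F) → Fin d → F) = e.symm.toHomeomorph.toMeasurableEquiv := rfl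
    rw [h1, MeasurableEquiv.map_apply]
    congr 1
    ext x
    simp only [Set.mem_preimage, Set.mem_image]
    exact ⟨fun hx => ⟨_, hx, e.apply_symm_apply x⟩, by
      rintro ⟨u, hu, rfl⟩
      rwa [show e.symm.toHomeomorph.toMeasurableEquiv (e u) = u from e.symm_apply_apply u]⟩
  rintro _ ⟨y, hy, rfl⟩ hy0 ε hε
  have := hb' y hy hy0 ε hε
  rw [hmap, hmap] at this
  refine (measure_mono ?_).trans this
  rintro _ ⟨⟨u, hu, rfl⟩, hx⟩
  exact ⟨u, ⟨hu, hx⟩, rfl⟩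

/-- Goodness from a nondegenerate jet. The hypotheses isolate what depends on the field: the
sublevel estimate `h1` in one variable, the distortion `κ` of balls under linear maps close to the
identity, and the volume of dilated balls. -/
theorem HasGridJet.exists_combinationsGoodOn [ProperSpace F] [MeasurableSpace F] [BorelSpace F]
    (hd : 0 < d) (ν : Measure F) [ν.IsAddHaarMeasure] (μ : Measure (Fin d → F))
    [μ.IsAddHaarMeasure] {k : ℕ}
    {f : (Fin d → F) → Fin n → F} {x₀ : Fin d → F} {a : (Fin d → ℕ) → Fin n → F}
    (h : HasGridJet k f x₀ a) (ha : IsNondegenerateJet k a)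
    {W : Set (Fin d → F)} (hW : W ∈ 𝓝 x₀) (hf : ContinuousOn f W)
    {C α κ δ D : ℝ} (hC : 1 ≤ C) (hα : 0 < α) (hκ : 0 < κ) (hδ : 0 < δ) (hD1 : 1 ≤ D)
    (h1 : ∀ m, 1 ≤ m → m ≤ k → ∀ R > 0, ∀ (c : F) (g : F → F) (p : F), p ≠ 0 →
      IsNearlyConstDivDiff m g (Metric.ball c R) p → SublevelBound ν (Metric.ball c R) g C α)
    (hκv : ∀ v : Fin d → Fin d → F, (∀ j, ‖v j - Pi.single j 1‖ < δ) → ∀ u,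
      ‖columnMap v u‖ ≤ κ * ‖u‖ ∧ ‖u‖ ≤ κ * ‖columnMap v u‖)
    (hD : ∀ (x : Fin d → F), ∀ R > 0,
      μ (Metric.ball x (κ * (κ * R))) ≤ ENNReal.ofReal D * μ (Metric.ball x R))
    (hV : ∀ r > 0, ∃ V ∈ 𝓝 x₀, ∀ (x : Fin d → F), ∀ R > 0, Metric.ball x R ⊆ V →
      Metric.ball x (κ * (κ * R)) ⊆ Metric.ball x₀ r) {U : Set (Fin d → F)} (hU : U ∈ 𝓝 x₀) :
    ∃ V ∈ 𝓝 x₀, V ⊆ U ∧ CombinationsGoodOn μ (D * (d * C)) (α / d) f V := by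
  have hd1 : (1 : ℝ) ≤ d := by exact_mod_cast hd
  have hdC : 1 ≤ d * C := one_le_mul_of_one_le_of_one_le hd1 hC
  obtain ⟨r₁, hr₁, hgood⟩ := h.exists_hasGoodDirections ha hδ
  obtain ⟨r₂, hr₂, hr₂W⟩ := Metric.mem_nhds_iff.1 hW
  obtain ⟨V, hVn, hVb⟩ := hV (min r₁ r₂) (lt_min hr₁ hr₂)
  refine ⟨V ∩ U, inter_mem hVn hU, Set.inter_subset_right, fun c₀ c x _ R hR hball ε hε => ?_⟩
  set H : (Fin d → F) → F := fun x => c₀ + ∑ i, c i * f x i with hH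
  suffices hb : SublevelBound μ (Metric.ball x R) H (D * (d * C)) (α / d) by
    exact measure_sublevel_le_of_sublevelBound (by positivity) (by positivity)
      measure_ball_lt_top.ne hε (fun y hy hy0 => hb y hy.1 hy0 ε hε)
      (measure_mono fun y hy => hy.1)
  rcases eq_or_ne c 0 with rfl | hc
  · have : H = fun _ => c₀ := by ext y; simp [hH]
    rw [this]
    exact SublevelBound.const μ _ c₀ (one_le_mul_of_one_le_of_one_le hD1 hdC) (by positivity)
  obtain ⟨m, hm1, hmk, v, hv, p, hp, hline⟩ := hgood c hc
  have hκv' := hκv v hv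
  have hinj : Function.Injective (columnMap v) := by
    rw [← LinearMap.ker_eq_bot, LinearMap.ker_eq_bot']
    intro u hu
    have := (hκv' u).2
    rw [hu, norm_zero, mul_zero] at this
    exact norm_le_zero_iff.1 this
  set e : (Fin d → F) ≃L[F] (Fin d → F) :=
    (LinearEquiv.ofInjectiveEndo (columnMap v) hinj).toContinuousLinearEquiv with he
  have hev : ∀ u, e u = columnMap v u := fun u => rfl
  have hbig : Metric.ball x (κ * (κ * R)) ⊆ Metric.ball x₀ (min r₁ r₂) :=
    hVb x R hR (hball.trans Set.inter_subset_left)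
  set w := e.symm x with hw
  have hew : e w = x := e.apply_symm_apply x
  -- The ball about `x` lies between the image of a ball and a slightly larger ball.
  have himg : e '' Metric.ball w (κ * R) ⊆ Metric.ball x (κ * (κ * R)) := by
    rintro _ ⟨u, hu, rfl⟩
    rw [Metric.mem_ball, dist_eq_norm] at hu ⊢
    rw [← hew, ← map_sub, hev]
    exact (hκv' _).1.trans_lt (by gcongr)
  have hsub : Metric.ball x R ⊆ e '' Metric.ball w (κ * R) := by
    intro y hy
    refine ⟨e.symm y, ?_, e.apply_symm_apply y⟩
    rw [Metric.mem_ball, dist_eq_norm] at hy ⊢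
    refine (hκv' _).2.trans_lt ?_
    rw [← hev, map_sub, e.apply_symm_apply, hew]
    gcongr
  have hκR : 0 < κ * R := by positivity
  have hpi : Metric.ball w (κ * R) = Set.univ.pi fun j => Metric.ball (w j) (κ * R) :=
    ball_pi w hκR
  have hHc : ContinuousOn H (e '' Metric.ball w (κ * R)) := by
    have hfc : ContinuousOn f (e '' Metric.ball w (κ * R)) :=
      hf.mono ((himg.trans hbig).trans
        ((Metric.ball_subset_ball (min_le_right _ _)).trans hr₂W))
    refine continuousOn_const.add (continuousOn_finsetSum _ fun i _ => ?_)
    exact continuousOn_const.mul (continuousOn_pi.1 hfc i)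
  have hbox : SublevelBound (Measure.pi fun _ => ν)
      (Set.univ.pi fun j => Metric.ball (w j) (κ * R)) (fun u => H (e u)) (d * C) (α / d) := by
    refine SublevelBound.pi hd ν (fun j => Metric.isOpen_ball) ?_ hC hα fun j u hu => ?_
    · rw [← hpi]
      exact hHc.comp e.continuous.continuousOn (Set.mapsTo_image _ _)
    · refine h1 m hm1 hmk _ hκR (w j) _ (p j) (hp j) fun T hT hTB => ?_
      have := hline j c₀ (columnMap v (Function.update u j 0)) T hT fun τ hτ => ?_
      · refine lt_of_eq_of_lt ?_ this
        congr 2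
        refine divDiff_congr fun τ _ => ?_
        simp only [hH, hev, columnMap_update v u j τ]
      · rw [Set.mem_ofPred_eq, ← columnMap_update, ← hev]
        refine Metric.ball_subset_ball (min_le_left _ _) (hbig (himg ⟨_, ?_, rfl⟩))
        rw [hpi]
        intro i _
        by_cases hi : i = j
        · subst hi; simpa using hTB τ hτ
        · simpa [Function.update_of_ne hi] using hu i (Set.mem_univ i)
  rw [← hpi] at hbox
  exact (SublevelBound.image_equiv ν μ e hbox).of_subset hsub (by linarith)
    ((measure_mono himg).trans (hD x R hR))

end Good

/-! ### Goodness -/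

section Fields

variable {d n : ℕ}

/-- In an ultrametric field, linear maps congruent to the identity are isometries. -/
theorem norm_columnMap_of_ultrametric {F : Type*} [NontriviallyNormedField F]
    [IsUltrametricDist F] {v : Fin d → Fin d → F}
    (hv : ∀ j, ‖v j - Pi.single j 1‖ < 1) (u : Fin d → F) : ‖columnMap v u‖ = ‖u‖ := by
  rcases eq_or_ne u 0 with rfl | hu
  · simp
  have hu0 : 0 < ‖u‖ := norm_pos_iff.2 hu
  have hlt : ‖columnMap v u - u‖ < ‖u‖ := by
    rw [columnMap_sub_self, pi_norm_lt_iff hu0]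
    intro l
    rcases (Finset.univ : Finset (Fin d)).eq_empty_or_nonempty with h0 | h0
    · exact absurd (Finset.mem_univ l) (by simp [h0])
    rw [Finset.sum_apply]
    obtain ⟨j, -, hj⟩ := IsUltrametricDist.exists_norm_finsetSum_le_of_nonempty h0
      (fun j => (u j • (v j - Pi.single j (1 : F)) : Fin d → F) l)
    refine hj.trans_lt ?_
    rw [Pi.smul_apply, smul_eq_mul, norm_mul]
    calc ‖u j‖ * ‖(v j - Pi.single j (1 : F) : Fin d → F) l‖
        ≤ ‖u‖ * ‖v j - Pi.single j (1 : F)‖ := by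
          gcongr
          · exact norm_le_pi_norm u j
          · exact norm_le_pi_norm _ l
      _ < ‖u‖ * 1 := by
          have := hv j
          gcongr
      _ = ‖u‖ := mul_one _
  refine le_antisymm ?_ ?_
  · refine (pi_norm_le_iff_of_nonneg hu0.le).2 fun l => ?_
    have e : columnMap v u l = (columnMap v u - u) l + u l := by simp
    rw [e]
    exact (IsUltrametricDist.norm_add_le_max _ _).trans (max_le
      ((norm_le_pi_norm _ l).trans hlt.le) (norm_le_pi_norm u l))
  · by_contra! hlt'
    have : ‖u‖ < ‖u‖ := by
      conv_lhs => rw [← sub_sub_cancel (columnMap v u) u]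
      rw [pi_norm_lt_iff hu0]
      intro l
      rw [Pi.sub_apply, sub_eq_add_neg]
      refine (IsUltrametricDist.norm_add_le_max _ _).trans_lt (max_lt
        ((norm_le_pi_norm _ l).trans_lt hlt') ?_)
      rw [norm_neg]
      exact (norm_le_pi_norm _ l).trans_lt hlt
    exact lt_irrefl _ this

/-- Goodness in the ultrametric case, with explicit constants. The exponent `s` describes the
growth of the measure of balls. -/
theorem exists_combinationsGoodOn_ultrametric {F : Type*} [NontriviallyNormedField F]
    [IsUltrametricDist F] [LocallyCompactSpace F] [MeasurableSpace F] [BorelSpace F] (hd : 0 < d)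
    (μ : Measure (Fin d → F)) [μ.IsAddHaarMeasure] :
    ∃ s : ℝ, 0 < s ∧ (IsNormalized F → s = 1) ∧ ∀ (k : ℕ), 1 ≤ k →
      ∀ (f : (Fin d → F) → Fin n → F) (x₀ : Fin d → F), UltraNondegenerateOfOrder k f x₀ →
        ∀ U ∈ 𝓝 x₀, ∃ V ∈ 𝓝 x₀, V ⊆ U ∧ CombinationsGoodOn μ (d * k) (s / k / d) f V := by
  have : ProperSpace F := ProperSpace.of_locallyCompactSpace F
  set ν : Measure F := Measure.addHaar with hν
  obtain ⟨s, hs, hs1, hgrow⟩ := exists_measure_ball_le ν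
  refine ⟨s, hs, hs1, fun k hk f x₀ hf U hU => ?_⟩
  obtain ⟨⟨W, hW, hxW, hfW⟩, hspan⟩ := hf
  obtain ⟨a, hjet, ha⟩ := hfW.exists_hasGridJet hxW
  have hk1 : (1 : ℝ) ≤ k := by exact_mod_cast hk
  have key := hjet.exists_combinationsGoodOn hd ν μ (hspan.isNondegenerateJet ha)
    (hW.mem_nhds hxW) hfW.continuousOn (C := k) (α := s / k) (κ := 1) (δ := 1) (D := 1)
    hk1 (by positivity) one_pos one_pos le_rfl ?_ ?_ ?_ ?_ hU
  · simpa using key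
  · intro m hm1 hmk R hR c g p _ hg
    obtain ⟨ρ, hρ, hc⟩ := hgrow R hR
    obtain ⟨hdiam, hball⟩ := hc c
    have hm0 : (0 : ℝ) < m := by exact_mod_cast hm1
    have hmk' : (m : ℝ) ≤ k := by exact_mod_cast hmk
    have hb := SublevelBound.of_separated (ν := ν) (B := Metric.ball c R) (h := g) hm1
      (K := 1) (M := 1) (s := s) (ρ := ρ) one_pos hρ hball
      (fun δ hδ ε hε T hT hTB hTd hTh y hy => by
        rw [one_mul]
        exact hg.norm_lt_of_ultrametric hm1 hdiam hδ hT hTB hTd hTh hy)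
    rw [mul_one, Real.one_rpow, mul_one] at hb
    refine hb.mono hmk' hk1 (by positivity) ?_
    gcongr
  · intro v hv u
    have := norm_columnMap_of_ultrametric hv u
    simp [this]
  · intro x R _
    simp
  · intro r hr
    exact ⟨_, Metric.ball_mem_nhds x₀ hr, fun x R _ h => by simpa using h⟩

theorem norm_columnMap_real (hd : 0 < d) {v : Fin d → Fin d → ℝ}
    (hv : ∀ j, ‖v j - Pi.single j 1‖ < 1 / (2 * d)) (u : Fin d → ℝ) :
    ‖columnMap v u‖ ≤ 2 * ‖u‖ ∧ ‖u‖ ≤ 2 * ‖columnMap v u‖ := by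
  have hd0 : (0 : ℝ) < d := by exact_mod_cast hd
  have hle : ‖columnMap v u - u‖ ≤ ‖u‖ / 2 := by
    rw [columnMap_sub_self]
    calc ‖∑ j, u j • (v j - Pi.single j (1 : ℝ))‖ ≤ ∑ _j : Fin d, ‖u‖ * (1 / (2 * d)) := by
          refine norm_sum_le_of_le _ fun j _ => ?_
          rw [norm_smul]
          have := (hv j).le
          have := norm_le_pi_norm u j
          gcongr
      _ = ‖u‖ / 2 := by
          rw [Finset.sum_const, Finset.card_univ, Fintype.card_fin, nsmul_eq_mul]
          field_simp
  have e1 := norm_sub_norm_le (columnMap v u) u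
  have e2 := norm_sub_norm_le u (columnMap v u)
  rw [norm_sub_rev] at e2
  constructor <;> linarith [norm_nonneg u]

/-- Goodness in the real case. -/
theorem isGoodAt_real (hd : 0 < d) {k : ℕ} (hk : 1 ≤ k) {f : (Fin d → ℝ) → Fin n → ℝ}
    {x₀ : Fin d → ℝ} (hf : RealNondegenerateOfOrder k f x₀) {U : Set (Fin d → ℝ)}
    (hU : U ∈ 𝓝 x₀) : IsGoodAt volume U f x₀ := by
  obtain ⟨⟨W, hW, hxW, hfW⟩, hspan⟩ := hf
  obtain ⟨a, hjet, ha⟩ := exists_hasGridJet_of_contDiffOn hW hfW hxW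
  have hd0 : (0 : ℝ) < d := by exact_mod_cast hd
  have hk0 : (0 : ℝ) < k := by exact_mod_cast hk
  have hk1 : (1 : ℝ) ≤ k := by exact_mod_cast hk
  set C : ℝ := k * 2 * (4 * k + 3 : ℕ) with hC
  have hC1 : 1 ≤ C := by
    rw [hC]; push_cast; nlinarith
  have key := hjet.exists_combinationsGoodOn hd volume volume (hspan.isNondegenerateJet ha)
    (hW.mem_nhds hxW) hfW.continuousOn (C := C) (α := 1 / k) (κ := 2) (δ := 1 / (2 * d))
    (D := 4 ^ d) hC1 (by positivity) two_pos (by positivity) (one_le_pow₀ (by norm_num))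
    ?_ (fun v hv u => norm_columnMap_real hd hv u) ?_ ?_ hU
  · obtain ⟨V, hV, hVU, hgood⟩ := key
    exact ⟨V, hV, hVU, _, _, by positivity, by positivity, hgood⟩
  · intro m hm1 hmk R hR c g p _ hg
    have hm0 : (0 : ℝ) < m := by exact_mod_cast hm1
    have hm1' : (1 : ℝ) ≤ m := by exact_mod_cast hm1
    have hmk' : (m : ℝ) ≤ k := by exact_mod_cast hmk
    have hdiam : ∀ x ∈ Metric.ball c R, ∀ y ∈ Metric.ball c R, ‖x - y‖ ≤ 2 * R := by
      intro x hx y hy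
      rw [Metric.mem_ball, dist_eq_norm] at hx hy
      rw [show x - y = (x - c) - (y - c) by ring]
      exact (norm_sub_le _ _).trans (by linarith)
    have hb := SublevelBound.of_separated (ν := volume) (B := Metric.ball c R) (h := g) hm1
      (K := (4 * m + 3 : ℕ)) (M := 2) (s := 1) (ρ := 2 * R) (by positivity) (by positivity)
      (fun x δ hδ => by
        rw [Real.volume_ball, Real.volume_ball, ← ENNReal.ofReal_mul (by positivity),
          Real.rpow_one]
        refine ENNReal.ofReal_le_ofReal (le_of_eq ?_)
        field_simp)
      (fun δ hδ ε hε T hT hTB hTd hTh y hy => hg.norm_lt hm1 hdiam hδ hT hTB hTd hTh hy)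
    refine hb.mono ?_ hC1 (by positivity) (by gcongr)
    have h43 : (1 : ℝ) ≤ (4 * m + 3 : ℕ) := by exact_mod_cast (by omega : 1 ≤ 4 * m + 3)
    have h44 : ((4 * m + 3 : ℕ) : ℝ) ≤ (4 * k + 3 : ℕ) := by
      exact_mod_cast (by omega : 4 * m + 3 ≤ 4 * k + 3)
    have h45 : ((4 * m + 3 : ℕ) : ℝ) ^ (1 / (m : ℝ)) ≤ (4 * m + 3 : ℕ) := by
      conv_rhs => rw [← Real.rpow_one ((4 * m + 3 : ℕ) : ℝ)]
      exact Real.rpow_le_rpow_of_exponent_le h43 ((div_le_one hm0).2 hm1')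
    rw [hC]
    gcongr
    exact h45.trans h44
  · intro x R hR
    rw [Real.volume_pi_ball _ (by positivity), Real.volume_pi_ball _ hR,
      Fintype.card_fin, ← ENNReal.ofReal_mul (by positivity), ← mul_pow]
    refine ENNReal.ofReal_le_ofReal (le_of_eq ?_)
    congr 1
    ring
  · intro r hr
    refine ⟨Metric.ball x₀ (r / 16), Metric.ball_mem_nhds x₀ (by positivity),
      fun x R hR h => ?_⟩
    have : Nonempty (Fin d) := ⟨⟨0, hd⟩⟩
    have hxr : dist x x₀ < r / 16 := h (Metric.mem_ball_self hR)
    -- The radius `R` is controlled by moving the centre by `r / 8` along the diagonal.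
    have hRr : R ≤ r / 8 := by
      by_contra! hlt
      have hdist : dist (x + fun _ => r / 8) x = r / 8 := by
        rw [dist_eq_norm, add_sub_cancel_left, pi_norm_const, Real.norm_of_nonneg (by positivity)]
      have hy : dist (x + fun _ => r / 8) x₀ < r / 16 :=
        h (by rw [Metric.mem_ball, hdist]; exact hlt)
      have := dist_triangle_right (x + fun _ => r / 8) x x₀
      linarith
    intro y hy
    rw [Metric.mem_ball] at hy ⊢
    have := dist_triangle y x x₀
    linarith

theorem SpannedByPartials.one_le {F : Type*} [NontriviallyNormedField F] (hn : 0 < n) {k : ℕ}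
    {f : (Fin d → F) → Fin n → F} {x₀ : Fin d → F} (h : SpannedByPartials k f x₀) : 1 ≤ k := by
  by_contra! hk
  have hempty : {v : Fin n → F | ∃ β : Fin d → ℕ, 1 ≤ ∑ j, β j ∧ ∑ j, β j ≤ k ∧
      v = multiPartialDeriv β f x₀} = ∅ := by
    ext v
    simp only [Set.mem_ofPred_eq, Set.mem_empty_iff_false, iff_false]
    rintro ⟨β, h1, h2, -⟩
    omega
  have : Nonempty (Fin n) := ⟨⟨0, hn⟩⟩
  rw [SpannedByPartials, hempty, Submodule.span_empty] at h
  exact bot_ne_top h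

theorem CombinationsGoodOn.mono {X F : Type*} [PseudoMetricSpace X] [MeasurableSpace X]
    [NormedField F] {μ : Measure X} {C C' α : ℝ} {f : X → Fin n → F} {V : Set X}
    (h : CombinationsGoodOn μ C α f V) (hC : C ≤ C') : CombinationsGoodOn μ C' α f V := by
  intro c₀ c x hx r hr hB ε hε
  refine (h c₀ c x hx r hr hB ε hε).trans ?_
  gcongr

end Fields

end KT

theorem theorem4p3 (d n ℓ : ℕ) (hd : 0 < d) (hn : 0 < n) (hl : 0 < ℓ) :
    -- the real case
    (∀ (U : Set (Fin d → ℝ)) (f : (Fin d → ℝ) → Fin n → ℝ),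
      IsOpen U → ContDiffOn ℝ ℓ f U →
      ∀ x₀ ∈ U, KT.RealNondegenerateAt f x₀ →
        KT.IsNonplanarAt volume U f x₀ ∧ KT.IsGoodAt volume U f x₀) ∧
    -- the ultrametric case
    (∀ (F : Type u) [NontriviallyNormedField F] [IsUltrametricDist F] [LocallyCompactSpace F]
      [MeasurableSpace F] [BorelSpace F] (μ : Measure (Fin d → F)) [μ.IsAddHaarMeasure]
      (U : Set (Fin d → F)) (f : (Fin d → F) → Fin n → F),
      IsOpen U → KT.UltraCkOn ℓ f U →
      ∀ x₀ ∈ U,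
        (KT.UltraNondegenerateAt f x₀ →
          KT.IsNonplanarAt μ U f x₀ ∧ KT.IsGoodAt μ U f x₀) ∧
        (KT.IsNormalized F → KT.UltraNondegenerateOfOrder ℓ f x₀ →
          ∃ V ∈ 𝓝 x₀, V ⊆ U ∧
            KT.CombinationsGoodOn μ ((d : ℝ) * (ℓ : ℝ) ^ (3 - 1 / (ℓ : ℝ)))
              (1 / ((d : ℝ) * (ℓ : ℝ))) f V)) := by
  have hd0 : (0 : ℝ) < d := by exact_mod_cast hd
  have hl1 : (1 : ℝ) ≤ ℓ := by exact_mod_cast hl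
  refine ⟨fun U f hU _ x₀ hx₀ => ?_, fun F _ _ _ _ _ μ _ U f hU _ x₀ hx₀ => ⟨?_, ?_⟩⟩
  · rintro ⟨k, hf⟩
    have hk := hf.2.one_le hn
    obtain ⟨⟨W, hW, hxW, hfW⟩, hspan⟩ := id hf
    obtain ⟨a, hjet, ha⟩ := KT.exists_hasGridJet_of_contDiffOn hW hfW hxW
    exact ⟨hjet.isNonplanarAt (hspan.isNondegenerateJet ha) volume U,
      KT.isGoodAt_real hd hk hf (hU.mem_nhds hx₀)⟩
  · rintro ⟨k, hf⟩
    have : ProperSpace F := ProperSpace.of_locallyCompactSpace F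
    have hk := hf.2.one_le hn
    have hk0 : (0 : ℝ) < k := by exact_mod_cast hk
    obtain ⟨⟨W, hW, hxW, hfW⟩, hspan⟩ := id hf
    obtain ⟨a, hjet, ha⟩ := hfW.exists_hasGridJet hxW
    refine ⟨hjet.isNonplanarAt (hspan.isNondegenerateJet ha) μ U, ?_⟩
    obtain ⟨s, hs, -, hgood⟩ := KT.exists_combinationsGoodOn_ultrametric (n := n) hd μ
    obtain ⟨V, hV, hVU, h⟩ := hgood k hk f x₀ hf U (hU.mem_nhds hx₀)
    exact ⟨V, hV, hVU, _, _, by positivity, by positivity, h⟩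
  · intro hnorm hf
    obtain ⟨s, -, hs1, hgood⟩ := KT.exists_combinationsGoodOn_ultrametric (n := n) hd μ
    obtain ⟨V, hV, hVU, h⟩ := hgood ℓ hl f x₀ hf U (hU.mem_nhds hx₀)
    refine ⟨V, hV, hVU, ?_⟩
    rw [hs1 hnorm, div_div, mul_comm (ℓ : ℝ)] at h
    refine h.mono ?_
    -- The proof gives the constant `d ℓ`, and the exponent `3 - 1 / ℓ` is at least `1`.
    have h1 : 1 / (ℓ : ℝ) ≤ 1 := (div_le_one (by linarith)).2 hl1
    have h2 : (ℓ : ℝ) ≤ (ℓ : ℝ) ^ (3 - 1 / (ℓ : ℝ)) := by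
      conv_lhs => rw [← Real.rpow_one (ℓ : ℝ)]
      exact Real.rpow_le_rpow_of_exponent_le hl1 (by linarith)
    gcongr
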